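/- Let $\mathcal A$ be a finite set, $\mathbb N=\{1,2,\dots\}$, $T$ the left shift on $\mathcal A^{\mathbb N}$, and let $\mathbb P,\mathbb Q$ be shift-invariant probability measures on $\mathcal A^{\mathbb N}$. For a word $a\in\mathcal A^n$ write $\mathbb P[a]=\mathbb P\{x: x_1\cdots x_n=a\}$, $\operatorname{supp}\mathbb P_n=\{a\in\mathcal A^n:\mathbb P[a]>0\}$, and $\operatorname{supp}\mathbb P=\{x:\mathbb P[x_1\cdots x_n]>0\text{ for all }n\}$; similarly for $\mathbb Q$. **Estimator.** Let $W_\ell(y,x)=\inf\{r\in\mathbb N: x_r\cdots x_{r+\ell-1}=y_1\cdots y_\ell\}$ (with $\inf\emptyset=\infty$) and $\Lambda_N(y,x)=\max\{1,\sup\{\ell\in\mathbb N: W_\ell(y,x)\le N-\ell+1\}\}$. Parse $y_1\cdots y_N$ from left to right: as long as the words obtained so far have total length $L<N$, the next word is $y_{L+1}\cdots y_{\min\{N,\,L+\Lambda_N(T^Ly,x)+1\}}$. Let $c_N(y|x)$ be the number of words, and $$Q_N(y,x)=\frac{c_N(y|x)\ln N}{N-c_N(y|x)}\qquad(\text{read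 as }+\infty\text{ if }c_N(y|x)=N).$$ **Pressure and cross entropy.** For $\alpha\in\mathbb R$ let $\overline q(\alpha)=\limsup_{n\to\infty}\frac1n\ln\sum_{a\in\operatorname{supp}\mathbb P_n}\mathbb P[a]^{-\alpha}\mathbb Q[a]\in[-\infty,\infty]$, let $D_-\overline q(0)\in[-\infty,\infty]$ denote the left derivative of $\overline q$ at $0$, and let $h_{\mathrm c}(\mathbb Q|\mathbb P)=\lim_{n\to\infty}-\frac1n\sum_{a\in\mathcal A^n}\mathbb Q[a]\ln\mathbb P[a]\in[-\infty,\infty]$ (with $0\ln 0=0$), when this limit exists. **Conditions.** In UD and SLD below, $(k_n)_{n\ge1}\subset[0,\infty)$ and $(\tau_n)_{n\ge1}\subset\{0,1,2,\dots\}$ denote sequences that are $o(n)$. * UD (for $\mathbb P$): there are such sequences with $\mathbb P[a\xi b]\le e^{k_n}\mathbb P[a]\mathbb P[b]$ for all $n,m\in\mathbb N$, $a\in\operatorname{supp}\mathbb P_n$, $\xi\in\operatorname{supp}\mathbb P_{\tau_n}$, $b\in\operatorname{supp}\mathbb P_m$. * SLD (for $\mathbb P$): there are such sequences so that for all $n,m\in\mathbb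 N$, $a\in\operatorname{supp}\mathbb P_n$, $b\in\operatorname{supp}\mathbb P_m$ there are $0\le\ell\le\tau_n$ and $\xi\in\operatorname{supp}\mathbb P_\ell$ with $\mathbb P[a\xi b]\ge e^{-k_n}\mathbb P[a]\mathbb P[b]$. * SE (for $\mathbb P$): there are $\beta\ge1$ and $\gamma_-<0$ with $\mathbb P[a]\ge e^{\gamma_-n^\beta}$ for all $n\in\mathbb N$ and $a\in\operatorname{supp}\mathbb P_n$. * ND (for the pair): $\overline q(-1)<0$. **Statement.** Assume throughout that $\operatorname{supp}\mathbb Q\subseteq\operatorname{supp}\mathbb P$ and that ND holds. 1. Suppose that $\mathbb P$ satisfies SLD, SE, and UD with $\tau_n=0$ for all $n$, that $\mathbb Q$ satisfies UD, and that $\mathbb Q$ is ergodic. Then the left derivative $D_-\overline q(0)$ and the limit $h_{\mathrm c}(\mathbb Q|\mathbb P)$ exist in $[-\infty,\infty]$, and $$D_-\overline q(0)\le\liminf_{N\to\infty}Q_N(y,x)\le\limsup_{N\to\infty}Q_N(y,x)\le h_{\mathrm c}(\mathbb Q|\mathbb P)$$ for $(\mathbb P\otimes\mathbb Q)$-almost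 every $(x,y)$. If, moreover, $\mathbb Q$ satisfies UD with $\tau_n=O(1)$ and $k_n=O(1)$, then $\lim_{N\to\infty}Q_N(y,x)=h_{\mathrm c}(\mathbb Q|\mathbb P)$ for $(\mathbb P\otimes\mathbb Q)$-almost every $(x,y)$. 2. Suppose that $\mathbb P$ and $\mathbb Q$ are irreducible finite hidden-Markov measures, i.e. each is of the form $$\mathbb P[a_1\cdots a_n]=\sum_{s_1,\dots,s_n\in\mathcal S}\pi_{s_1}R_{s_1,a_1}P_{s_1,s_2}R_{s_2,a_2}\cdots P_{s_{n-1},s_n}R_{s_n,a_n}\qquad(n\in\mathbb N)$$ with $\mathcal S$ a finite set, $P$ an irreducible stochastic matrix on $\mathcal S$ with stationary probability vector $\pi$, and $R$ an $\mathcal S\times\mathcal A$ matrix whose rows are probability vectors ($\mathcal S,\pi,P,R$ may differ for the two measures). Then all the hypotheses of part 1, including those of its last sentence, are satisfied; in particular $h_{\mathrm c}(\mathbb Q|\mathbb P)$ exists and $\lim_{N\to\infty}Q_N(y,x)=h_{\mathrm c}(\mathbb Q|\mathbb P)$ for $(\mathbb P\otimes\mathbb Q)$-almost every $(x,y)$.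 -/

import Mathlib

open MeasureTheory Filter Topology Asymptotics

noncomputable section

namespace ZivMerhav

variable {A : Type*}

/-- The left shift on one-sided sequences. The letter `x_k` (`k = 1, 2, …`) is `x (k - 1)`. -/
def shift (x : ℕ → A) : ℕ → A := fun k => x (k + 1)

/-- The basic cylinder `[a]` of a word `a` of length `n`: all sequences that start with `a`. -/
def cyl {n : ℕ} (a : Fin n → A) : Set (ℕ → A) := {x | ∀ i : Fin n, x i = a i}

/-- The prefix `x_1 … x_n` of a sequence. -/
def pre (n : ℕ) (x : ℕ → A) : Fin n → A := fun i => x i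

/-- The concatenation `aξb` of three words. -/
def concat3 {n l m : ℕ} (a : Fin n → A) (ξ : Fin l → A) (b : Fin m → A) : Fin (n + (l + m)) → A :=
  Fin.append a (Fin.append ξ b)

/-! ### The modified Ziv-Merhav estimator -/

/-- The waiting time `W_ℓ(y, x) = inf {r ≥ 1 : x_r … x_{r+ℓ-1} = y_1 … y_ℓ}`, with `inf ∅ = ∞`
(here `r = s + 1`). -/
def waitingTime (l : ℕ) (y x : ℕ → A) : ℕ∞ :=
  ⨅ (s : ℕ) (_ : ∀ i < l, x (s + i) = y i), ((s + 1 : ℕ) : ℕ∞)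

/-- The match length `Λ_N(y, x) = max {1, sup {ℓ ≥ 1 : W_ℓ(y, x) ≤ N - ℓ + 1}}`. The condition is
written as `W_ℓ + ℓ ≤ N + 1` to avoid truncated subtraction; it forces `ℓ ≤ N`. -/
def matchLength (N : ℕ) (y x : ℕ → A) : ℕ :=
  max 1 (sSup {l : ℕ | 1 ≤ l ∧ waitingTime l y x + (l : ℕ∞) ≤ (N : ℕ∞) + 1})

/-- The sum `L_{i,N}` of the lengths of the first `i` words of the mZM parsing of `y_1^N` with
respect to `x_1^N`: the word that comes after the position `L < N` is
`y_{L+1} … y_{min {N, L + Λ_N(T^L y, x) + 1}}`. Once `L_{i,N} = N` the parsing has terminated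
and the sequence stays at `N`. -/
def parseEnd (N : ℕ) (y x : ℕ → A) : ℕ → ℕ
  | 0 => 0
  | i + 1 => min N (parseEnd N y x i + matchLength N (shift^[parseEnd N y x i] y) x + 1)

/-- The number `c_N(y|x)` of words in the mZM parsing of `y_1^N` with respect to `x_1^N`. -/
def numWords (N : ℕ) (y x : ℕ → A) : ℕ := sInf {i : ℕ | parseEnd N y x i = N}

open Classical in
/-- The mZM estimator `Q_N(y, x) = c_N ln N / (N - c_N)`, read as `+∞` if `c_N = N`. -/
def mZM (N : ℕ) (y x : ℕ → A) : EReal :=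
  if numWords N y x = N then ⊤
  else (((numWords N y x : ℝ) * Real.log N / ((N : ℝ) - numWords N y x) : ℝ) : EReal)

/-! ### Supports, pressure, cross entropy -/

variable [MeasurableSpace A]

/-- `supp P_n`: the words of length `n` of positive probability. -/
def suppWords (P : Measure (ℕ → A)) (n : ℕ) : Set (Fin n → A) := {a | 0 < P.real (cyl a)}

/-- `supp P`: the sequences all of whose prefixes have positive probability. -/
def supp (P : Measure (ℕ → A)) : Set (ℕ → A) := {x | ∀ n, pre n x ∈ suppWords P n}

open Classical in
/-- The cross-entropic pressure
`q̄(α) = limsup_n (1/n) ln ∑_{a ∈ supp P_n} P[a]^{-α} Q[a]`, with values in `[-∞, ∞]`. -/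
def pressure [Fintype A] (P Q : Measure (ℕ → A)) (α : ℝ) : EReal :=
  limsup (fun n : ℕ =>
    (((1 / (n : ℝ)) * Real.log
      (∑ a : Fin n → A with a ∈ suppWords P n, P.real (cyl a) ^ (-α) * Q.real (cyl a)) : ℝ) :
        EReal)) atTop

/-- `D ∈ [-∞, ∞]` is the left derivative at `x` of the extended-real-valued function `f`. -/
def HasLeftDeriv (f : ℝ → EReal) (x : ℝ) (D : EReal) : Prop :=
  Tendsto (fun α : ℝ => (f α - f x) / ((α - x : ℝ) : EReal)) (𝓝[<] x) (𝓝 D)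

/-- The specific cross entropy `h_c(Q|P) = lim_n -(1/n) ∑_{a ∈ A^n} Q[a] ln P[a]` exists in
`[-∞, ∞]` and equals `h`. (Only used when `supp Q ⊆ supp P`: then each sum is a finite number and
every term with `P[a] = 0` has `Q[a] = 0`, hence vanishes.) -/
def HasCrossEntropy [Fintype A] (Q P : Measure (ℕ → A)) (h : EReal) : Prop :=
  Tendsto (fun n : ℕ =>
    ((-(1 / (n : ℝ)) * ∑ a : Fin n → A, Q.real (cyl a) * Real.log (P.real (cyl a)) : ℝ) : EReal))
    atTop (𝓝 h)

/-! ### Decoupling and decay conditions -/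

/-- `P` satisfies UD with the `o(n)`-sequences `k_n ≥ 0` and `τ_n ∈ {0, 1, 2, …}`. -/
structure IsUDWith (P : Measure (ℕ → A)) (k : ℕ → ℝ) (τ : ℕ → ℕ) : Prop where
  k_nonneg : ∀ n, 0 ≤ k n
  k_little : k =o[atTop] fun n : ℕ => (n : ℝ)
  tau_little : (fun n => (τ n : ℝ)) =o[atTop] fun n : ℕ => (n : ℝ)
  upper : ∀ n : ℕ, 1 ≤ n → ∀ a ∈ suppWords P n, ∀ ξ ∈ suppWords P (τ n),
    ∀ m : ℕ, 1 ≤ m → ∀ b ∈ suppWords P m,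
      P.real (cyl (concat3 a ξ b)) ≤ Real.exp (k n) * (P.real (cyl a) * P.real (cyl b))

/-- UD: upper decoupled. -/
def IsUD (P : Measure (ℕ → A)) : Prop := ∃ k τ, IsUDWith P k τ

/-- UD with `τ_n = 0` for all `n`. -/
def IsUDZeroGap (P : Measure (ℕ → A)) : Prop := ∃ k, IsUDWith P k (fun _ => 0)

/-- UD with `τ_n = O(1)` and `k_n = O(1)`. -/
def IsUDBounded (P : Measure (ℕ → A)) : Prop :=
  ∃ k τ, IsUDWith P k τ ∧ k =O[atTop] (fun _ : ℕ => (1 : ℝ)) ∧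
    (fun n => (τ n : ℝ)) =O[atTop] (fun _ : ℕ => (1 : ℝ))

/-- SLD: selectively lower decoupled. -/
def IsSLD (P : Measure (ℕ → A)) : Prop :=
  ∃ (k : ℕ → ℝ) (τ : ℕ → ℕ), (∀ n, 0 ≤ k n) ∧ (k =o[atTop] fun n : ℕ => (n : ℝ)) ∧
    ((fun n => (τ n : ℝ)) =o[atTop] fun n : ℕ => (n : ℝ)) ∧
    ∀ n : ℕ, 1 ≤ n → ∀ a ∈ suppWords P n, ∀ m : ℕ, 1 ≤ m → ∀ b ∈ suppWords P m,
      ∃ l ≤ τ n, ∃ ξ ∈ suppWords P l,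
        Real.exp (-k n) * (P.real (cyl a) * P.real (cyl b)) ≤ P.real (cyl (concat3 a ξ b))

/-- SE: the cylinder probabilities decay slowly enough. -/
def IsSE (P : Measure (ℕ → A)) : Prop :=
  ∃ β γ : ℝ, 1 ≤ β ∧ γ < 0 ∧ ∀ n : ℕ, 1 ≤ n → ∀ a ∈ suppWords P n,
    Real.exp (γ * (n : ℝ) ^ β) ≤ P.real (cyl a)

/-- ND: the pair `(P, Q)` is nondegenerate. -/
def IsND [Fintype A] (P Q : Measure (ℕ → A)) : Prop := pressure P Q (-1) < 0

/-! ### Hidden-Markov measures -/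

/-- `P` is a stationary hidden-Markov measure with a finite hidden alphabet and an irreducible
hidden chain: `p` is a stationary probability vector of the irreducible stochastic matrix `M`, the
rows of `R` are probability vectors on `A`, and
`P[a_1 … a_n] = ∑_{s_1 … s_n} p_{s_1} R_{s_1 a_1} M_{s_1 s_2} R_{s_2 a_2} ⋯ M_{s_{n-1} s_n} R_{s_n a_n}`
for all `n ≥ 1` (here `n = m + 1`). -/
def IsIrreducibleHMM [Fintype A] (P : Measure (ℕ → A)) : Prop :=
  ∃ (S : ℕ) (p : Fin S → ℝ) (M : Matrix (Fin S) (Fin S) ℝ) (R : Matrix (Fin S) A ℝ),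
    (∀ s, 0 ≤ p s) ∧ (∑ s, p s = 1) ∧
    (∀ s t, 0 ≤ M s t) ∧ (∀ s, ∑ t, M s t = 1) ∧
    (∀ s a, 0 ≤ R s a) ∧ (∀ s, ∑ a, R s a = 1) ∧
    (∀ t, ∑ s, p s * M s t = p t) ∧
    (∀ s t, ∃ n : ℕ, 0 < (M ^ n) s t) ∧
    ∀ (m : ℕ) (a : Fin (m + 1) → A), P.real (cyl a) =
      ∑ σ : Fin (m + 1) → Fin S,
        p (σ 0) * (∏ i, R (σ i) (a i)) * ∏ i : Fin m, M (σ i.castSucc) (σ i.succ)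

end ZivMerhav

end

set_option linter.unusedSectionVars false

namespace ZivMerhav

/-! ### Sequences, prefixes and cylinders -/

section Basics

variable {A : Type*}

/-! Write I_n(y) = -ln P[y_1…y_n]. Heuristically a word occurs in x_1…x_N when its P-probability
exceeds about 1/N, so a parsed word carries about ln N of information, and c_N ln N should be close
to I_N(y) ≈ N h_c. The two inequalities need different arguments.

Upper bound (y fixed, x random). A parsed word, the last one excepted, does not occur in x_1…x_N.
Under SLD a word of moderate length that fails to occur has probability at most N^{-(1-ε)}
(`IsSLD.ae_eventually_pr_le`); ND handles the longer words (`ae_eventually_pr_ceil_le`). Gapless UD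
of P makes I_n superadditive up to o(n), so the information of the parsed words adds up to at most
I_N(y) plus a small multiple of N and a constant per word (`numWords_mul_le_info`). A subadditive
ergodic theorem bounds I_N(y) by cN for any c > h_c (`HasCrossEntropy.ae_eventually_le`).

Lower bound (x fixed, y random). A parsed word without its last two letters does occur in x_1…x_N.
Suppose ∑ Q[a] P[a]^s decays like e^{-γn}, with 0 < s < 1. Since a occurs with probability at most
((N+1) P[a])^s, the Q-mass of the words of length n that occur is about N^s e^{-γn}
(`ae_exists_measure_occ_le`). UD of Q then bounds the mass of the sequences parsable into c words by
about N^{sc} e^{-γN} (`measure_parsable_le`). For c = dN/ln N this is e^{(sd-γ)N}, summable when d <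
γ/s, and Borel–Cantelli applies. By Jensen, the supremum of the attainable γ/s is the left
derivative of the pressure (`exists_hasLeftDeriv_pressure`).

Equality. If the constants in UD of Q are bounded, the moments are submultiplicative up to a bounded
factor, and the choice s = K/m with K large and then m large shows that the slopes reach h_c
(`exists_pressure_le_of_lt_crossEntropy`).

Hidden-Markov measures are products of transfer matrices. Positivity of the stationary vector gives
gapless UD with a constant, irreducibility gives SLD with a uniform gap and constant, hence also
ergodicity, and the smallest positive matrix entry gives SE. -/

theorem shift_iterate_apply (n : ℕ) (x : ℕ → A) (i : ℕ) : (shift^[n] x) i = x (i + n) := by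
  induction n generalizing x with
  | zero => rfl
  | succ n ih => rw [Function.iterate_succ_apply, ih]; simp [shift, add_assoc]

theorem pre_eq_iff {n : ℕ} {x y : ℕ → A} : pre n x = pre n y ↔ ∀ i < n, x i = y i := by
  constructor
  · intro h i hi
    exact congrFun h ⟨i, hi⟩
  · intro h
    ext i
    exact h i i.2

theorem cyl_eq_preimage {n : ℕ} (a : Fin n → A) : cyl a = pre n ⁻¹' {a} := by
  ext x
  simp only [cyl, pre, Set.mem_ofPred_eq, Set.mem_preimage, Set.mem_singleton_iff, funext_iff]

theorem mem_cyl_iff {n : ℕ} {a : Fin n → A} {x : ℕ → A} : x ∈ cyl a ↔ pre n x = a := by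
  rw [cyl_eq_preimage]; rfl

theorem mem_cyl_pre {n : ℕ} {x y : ℕ → A} : x ∈ cyl (pre n y) ↔ ∀ i < n, x i = y i := by
  rw [mem_cyl_iff, pre_eq_iff]

theorem cyl_zero (a : Fin 0 → A) : cyl a = Set.univ := by
  ext x; simp [cyl]

theorem mem_cyl_append {n m : ℕ} (a : Fin n → A) (b : Fin m → A) (x : ℕ → A) :
    x ∈ cyl (Fin.append a b) ↔ x ∈ cyl a ∧ shift^[n] x ∈ cyl b := by
  constructor
  · intro h
    refine ⟨fun i => ?_, fun i => ?_⟩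
    · simpa using h (Fin.castAdd m i)
    · rw [shift_iterate_apply]
      simpa [add_comm] using h (Fin.natAdd n i)
  · rintro ⟨h₁, h₂⟩ i
    refine Fin.addCases (fun i => ?_) (fun i => ?_) i
    · simpa using h₁ i
    · have := h₂ i
      rw [shift_iterate_apply] at this
      simpa [add_comm] using this

theorem mem_cyl_concat3 {n l m : ℕ} (a : Fin n → A) (ξ : Fin l → A) (b : Fin m → A) (x : ℕ → A) :
    x ∈ cyl (concat3 a ξ b) ↔ x ∈ cyl a ∧ shift^[n] x ∈ cyl ξ ∧ shift^[n + l] x ∈ cyl b := by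
  rw [concat3, mem_cyl_append, mem_cyl_append, ← Function.iterate_add_apply, add_comm l n]

variable [MeasurableSpace A]

theorem measurable_pre (n : ℕ) : Measurable (pre n : (ℕ → A) → (Fin n → A)) :=
  measurable_pi_lambda _ fun _ => measurable_pi_apply _

theorem measurable_shift : Measurable (shift : (ℕ → A) → (ℕ → A)) :=
  measurable_pi_lambda _ fun _ => measurable_pi_apply _

theorem measurable_shift_iterate (n : ℕ) : Measurable (shift^[n] : (ℕ → A) → (ℕ → A)) :=
  measurable_shift.iterate n

variable [Fintype A] [MeasurableSingletonClass A]

theorem measurableSet_pre_preimage {n : ℕ} (S : Set (Fin n → A)) : MeasurableSet (pre n ⁻¹' S) :=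
  measurable_pre n (Set.toFinite S).measurableSet

theorem measurableSet_cyl {n : ℕ} (a : Fin n → A) : MeasurableSet (cyl a) := by
  rw [cyl_eq_preimage]; exact measurableSet_pre_preimage _

theorem measurable_comp_pre {β : Type*} [MeasurableSpace β] {n : ℕ} (f : (Fin n → A) → β) :
    Measurable fun y : ℕ → A => f (pre n y) :=
  (measurable_of_finite f).comp (measurable_pre n)

/-- A finite measure on sequences is dominated by another one as soon as it is on cylinders. -/
theorem measure_le_of_cyl {μ ν : Measure (ℕ → A)} [IsFiniteMeasure μ] [IsFiniteMeasure ν]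
    (h : ∀ m : ℕ, 1 ≤ m → ∀ b : Fin m → A, μ (cyl b) ≤ ν (cyl b)) : μ ≤ ν := by
  classical
  -- For the discrete topology on the finite alphabet the product σ-algebra is Borel, so outer
  -- regularity of `ν` reduces the claim to open sets, which are increasing unions of finite unions
  -- of cylinders.
  let _ : TopologicalSpace A := ⊥
  have _ : DiscreteTopology A := ⟨rfl⟩
  have _ : BorelSpace A := ⟨by
    rw [borel_eq_top_of_discrete]
    exact eq_top_iff.2 fun s _ => (Set.toFinite s).measurableSet⟩
  have key : ∀ (m : ℕ) (S : Set (Fin m → A)), 1 ≤ m → μ (pre m ⁻¹' S) ≤ ν (pre m ⁻¹' S) := by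
    intro m S hm
    have e : pre m ⁻¹' S = ⋃ a ∈ (Set.toFinite S).toFinset, cyl a := by
      ext x; simp [mem_cyl_iff]
    have d : (((Set.toFinite S).toFinset : Finset (Fin m → A)) : Set (Fin m → A)).PairwiseDisjoint
        (fun a => cyl a) := by
      intro a _ b _ hab
      refine Set.disjoint_left.2 fun x hxa hxb => hab ?_
      rw [mem_cyl_iff] at hxa hxb
      exact hxa.symm.trans hxb
    rw [e, measure_biUnion_finset d fun a _ => measurableSet_cyl a,
      measure_biUnion_finset d fun a _ => measurableSet_cyl a]
    exact Finset.sum_le_sum fun a _ => h m hm a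
  have hopen : ∀ U : Set (ℕ → A), IsOpen U → μ U ≤ ν U := by
    intro U hU
    let V : ℕ → Set (ℕ → A) := fun n => pre (n + 1) ⁻¹' {a | cyl a ⊆ U}
    have hmono : Monotone V := by
      intro n m hnm x hx z hz
      refine hx ?_
      simp only [mem_cyl_iff, pre_eq_iff] at hz ⊢
      exact fun i hi => hz i (by omega)
    have hVU : ⋃ n, V n = U := by
      refine Set.Subset.antisymm (Set.iUnion_subset fun n x hx => hx (mem_cyl_iff.2 rfl)) ?_
      intro x hx
      obtain ⟨I, u, hu, hsub⟩ := isOpen_pi_iff.1 hU x hx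
      refine Set.mem_iUnion.2 ⟨I.sup id, fun z hz => hsub fun i hi => ?_⟩
      have hi' : i ≤ I.sup id := Finset.le_sup (f := id) hi
      have := (mem_cyl_pre.1 hz) i (by omega)
      rw [this]; exact (hu i hi).2
    have h1 := tendsto_measure_iUnion_atTop (μ := μ) hmono
    have h2 := tendsto_measure_iUnion_atTop (μ := ν) hmono
    rw [hVU] at h1 h2
    exact le_of_tendsto_of_tendsto' h1 h2 fun n => key _ _ (by omega)
  refine Measure.le_iff.2 fun s _ => ?_
  refine ENNReal.le_of_forall_pos_le_add fun ε hε _ => ?_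
  obtain ⟨U, hsU, hU, hlt⟩ := s.exists_isOpen_lt_add (μ := ν) (measure_ne_top ν s)
    (ε := (ε : ENNReal)) (by exact_mod_cast hε.ne')
  exact ((measure_mono hsU).trans (hopen U hU)).trans hlt.le

theorem integral_comp_pre (Q : Measure (ℕ → A)) [IsFiniteMeasure Q] {n : ℕ}
    (f : (Fin n → A) → ℝ) :
    ∫ y, f (pre n y) ∂Q = ∑ a : Fin n → A, Q.real (cyl a) * f a := by
  have h : ∫ a, f a ∂(Q.map (pre n)) = ∫ y, f (pre n y) ∂Q :=
    integral_map (measurable_pre n).aemeasurable (measurable_of_finite f).aestronglyMeasurable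
  rw [← h, integral_fintype Integrable.of_finite]
  refine Finset.sum_congr rfl fun a _ => ?_
  rw [map_measureReal_apply (measurable_pre n) (measurableSet_singleton a), smul_eq_mul,
    cyl_eq_preimage]

theorem integrable_comp_pre (Q : Measure (ℕ → A)) [IsFiniteMeasure Q] {n : ℕ}
    (f : (Fin n → A) → ℝ) : Integrable (fun y => f (pre n y)) Q := by
  obtain ⟨C, hC⟩ := (Set.finite_range fun a => ‖f a‖).bddAbove
  exact Integrable.of_bound (measurable_comp_pre f).aestronglyMeasurable C
    (ae_of_all _ fun y => hC ⟨_, rfl⟩)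

theorem measureReal_pre_preimage (Q : Measure (ℕ → A)) [IsFiniteMeasure Q] {n : ℕ}
    (S : Finset (Fin n → A)) (H : Set (ℕ → A)) (hH : MeasurableSet H) :
    Q.real (pre n ⁻¹' S ∩ H) = ∑ a ∈ S, Q.real (cyl a ∩ H) := by
  have e : pre n ⁻¹' (S : Set (Fin n → A)) ∩ H = ⋃ a ∈ S, (cyl a ∩ H) := by
    ext x; simp [mem_cyl_iff]
  rw [e, measureReal_biUnion_finset]
  · intro a _ b _ hab
    refine Set.disjoint_left.2 fun x hxa hxb => hab ?_
    exact (mem_cyl_iff.1 hxa.1).symm.trans (mem_cyl_iff.1 hxb.1)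
  · exact fun a _ => (measurableSet_cyl a).inter hH

end Basics

/-! ### Cylinder probabilities and decoupling of events -/

section Words

variable {A : Type*} [MeasurableSpace A]

/-- The probability `P[y_1 … y_n]` of the prefix of length `n` of `y`. -/
noncomputable def pr (P : Measure (ℕ → A)) (n : ℕ) (y : ℕ → A) : ℝ := P.real (cyl (pre n y))

variable {P Q : Measure (ℕ → A)}

theorem pr_nonneg (n : ℕ) (y : ℕ → A) : 0 ≤ pr P n y := measureReal_nonneg

theorem pr_le_one [IsProbabilityMeasure P] (n : ℕ) (y : ℕ → A) : pr P n y ≤ 1 :=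
  measureReal_le_one

theorem pr_anti [IsProbabilityMeasure P] {n m : ℕ} (h : n ≤ m) (y : ℕ → A) :
    pr P m y ≤ pr P n y := by
  refine measureReal_mono fun x hx => ?_
  rw [mem_cyl_pre] at hx ⊢
  exact fun i hi => hx i (by omega)

theorem pr_zero [IsProbabilityMeasure P] (y : ℕ → A) : pr P 0 y = 1 := by
  simp [pr, cyl_zero]

variable [Fintype A] [MeasurableSingletonClass A]

theorem measurable_pr (n : ℕ) : Measurable (pr P n) :=
  measurable_comp_pre fun a => P.real (cyl a)

theorem measureReal_shift_iterate (hP : MeasurePreserving shift P P) (n : ℕ) {H : Set (ℕ → A)}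
    (hH : MeasurableSet H) : P.real (shift^[n] ⁻¹' H) = P.real H := by
  rw [measureReal_def, (hP.iterate n).measure_preimage hH.nullMeasurableSet, measureReal_def]

theorem pr_add_le_shift [IsProbabilityMeasure P] (hP : MeasurePreserving shift P P) (n m : ℕ)
    (y : ℕ → A) : pr P (n + m) y ≤ pr P m (shift^[n] y) := by
  rw [pr, pr, ← measureReal_shift_iterate hP n (measurableSet_cyl (pre m (shift^[n] y)))]
  refine measureReal_mono fun x hx => ?_
  rw [Set.mem_preimage, mem_cyl_pre]
  rw [mem_cyl_pre] at hx
  intro i hi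
  rw [shift_iterate_apply, shift_iterate_apply]
  exact hx _ (by omega)

theorem pr_succ_le_shift [IsProbabilityMeasure P] (hP : MeasurePreserving shift P P) (n : ℕ)
    (y : ℕ → A) : pr P (n + 1) y ≤ pr P n (shift y) := by
  rw [add_comm]; exact pr_add_le_shift hP 1 n y

theorem shift_mem_supp [IsProbabilityMeasure P] (hP : MeasurePreserving shift P P) {y : ℕ → A}
    (hy : y ∈ supp P) : shift y ∈ supp P := fun n =>
  (hy (n + 1)).trans_le (pr_succ_le_shift hP n y)

theorem shift_iterate_mem_supp [IsProbabilityMeasure P] (hP : MeasurePreserving shift P P)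
    {y : ℕ → A} (hy : y ∈ supp P) (n : ℕ) : shift^[n] y ∈ supp P := by
  induction n with
  | zero => exact hy
  | succ n ih => rw [Function.iterate_succ_apply']; exact shift_mem_supp hP ih

theorem ae_mem_supp [IsProbabilityMeasure Q] : ∀ᵐ y ∂Q, y ∈ supp Q := by
  have : ∀ n, ∀ᵐ y ∂Q, pre n y ∈ suppWords Q n := by
    intro n
    have h : ∀ a : Fin n → A, ∀ᵐ y ∂Q, pre n y = a → a ∈ suppWords Q n := by
      intro a
      by_cases ha : a ∈ suppWords Q n
      · exact ae_of_all _ fun _ _ => ha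
      · have h0 : Q.real (cyl a) = 0 := le_antisymm (not_lt.1 ha) measureReal_nonneg
        rw [measureReal_eq_zero_iff] at h0
        have := measure_eq_zero_iff_ae_notMem.1 h0
        filter_upwards [this] with y hy h
        exact absurd (mem_cyl_iff.2 h) hy
    filter_upwards [ae_all_iff.2 h] with y hy using hy _ rfl
  exact ae_all_iff.2 this

theorem card_pos [IsProbabilityMeasure Q] : 1 ≤ Fintype.card A := by
  obtain ⟨x⟩ : Nonempty (ℕ → A) := nonempty_of_isProbabilityMeasure Q
  exact Fintype.card_pos_iff.2 ⟨x 0⟩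

/-- A word of positive probability occurs as a prefix of a point of the support. -/
theorem exists_mem_supp_of_pos [IsProbabilityMeasure Q] {n : ℕ} {a : Fin n → A}
    (ha : 0 < Q.real (cyl a)) : ∃ y ∈ supp Q, pre n y = a := by
  by_contra! h
  have : Q (cyl a) = 0 := by
    rw [measure_eq_zero_iff_ae_notMem]
    filter_upwards [ae_mem_supp (Q := Q)] with y hy hya
    exact h y hy (mem_cyl_iff.1 hya)
  rw [measureReal_def, this] at ha
  simp at ha

theorem real_cyl_concat3_le_left [IsFiniteMeasure P] {n l m : ℕ} (a : Fin n → A) (ξ : Fin l → A)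
    (b : Fin m → A) : P.real (cyl (concat3 a ξ b)) ≤ P.real (cyl a) :=
  measureReal_mono fun _ hx => ((mem_cyl_concat3 a ξ b _).1 hx).1

theorem real_cyl_concat3_le_mid [IsFiniteMeasure P] (hP : MeasurePreserving shift P P) {n l m : ℕ}
    (a : Fin n → A) (ξ : Fin l → A) (b : Fin m → A) :
    P.real (cyl (concat3 a ξ b)) ≤ P.real (cyl ξ) := by
  rw [← measureReal_shift_iterate hP n (measurableSet_cyl ξ)]
  exact measureReal_mono fun _ hx => ((mem_cyl_concat3 a ξ b _).1 hx).2.1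

theorem real_cyl_concat3_le_right [IsFiniteMeasure P] (hP : MeasurePreserving shift P P)
    {n l m : ℕ} (a : Fin n → A) (ξ : Fin l → A) (b : Fin m → A) :
    P.real (cyl (concat3 a ξ b)) ≤ P.real (cyl b) := by
  rw [← measureReal_shift_iterate hP (n + l) (measurableSet_cyl b)]
  exact measureReal_mono fun _ hx => ((mem_cyl_concat3 a ξ b _).1 hx).2.2

/-- Upper decoupling for arbitrary words, those of probability zero included. -/
theorem IsUDWith.upper_all [IsFiniteMeasure P] {k : ℕ → ℝ} {τ : ℕ → ℕ}
    (hP : MeasurePreserving shift P P) (h : IsUDWith P k τ) {n m : ℕ} (hn : 1 ≤ n) (hm : 1 ≤ m)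
    (a : Fin n → A) (ξ : Fin (τ n) → A) (b : Fin m → A) :
    P.real (cyl (concat3 a ξ b)) ≤ Real.exp (k n) * (P.real (cyl a) * P.real (cyl b)) := by
  by_cases h0 : 0 < P.real (cyl (concat3 a ξ b))
  · exact h.upper n hn a (h0.trans_le (real_cyl_concat3_le_left a ξ b)) ξ
      (h0.trans_le (real_cyl_concat3_le_mid hP a ξ b)) m hm b
      (h0.trans_le (real_cyl_concat3_le_right hP a ξ b))
  · exact (not_lt.1 h0).trans (by positivity)

/-- Upper decoupling in terms of events. -/
theorem IsUDWith.measure_cyl_inter_le [IsProbabilityMeasure Q] {k : ℕ → ℝ} {τ : ℕ → ℕ}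
    (hQ : MeasurePreserving shift Q Q) (h : IsUDWith Q k τ) {n : ℕ} (hn : 1 ≤ n)
    (a : Fin n → A) {H : Set (ℕ → A)} (hH : MeasurableSet H) :
    Q.real (cyl a ∩ shift^[n + τ n] ⁻¹' H) ≤
      Real.exp (k n) * (Fintype.card A : ℝ) ^ τ n * Q.real (cyl a) * Q.real H := by
  classical
  set c : ℝ := Real.exp (k n) * (Fintype.card A : ℝ) ^ τ n * Q.real (cyl a) with hc
  have hc0 : 0 ≤ c := by positivity
  -- Both sides are finite measures in `H`, so it suffices to compare them on cylinders. The power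
  -- of `Fintype.card A` counts the words that can fill the gap.
  let μ : Measure (ℕ → A) := (Q.restrict (cyl a)).map shift^[n + τ n]
  let ν : Measure (ℕ → A) := c.toNNReal • Q
  have hμ : ∀ H, MeasurableSet H → μ H = Q (cyl a ∩ shift^[n + τ n] ⁻¹' H) := fun H hH => by
    rw [Measure.map_apply (measurable_shift_iterate _) hH,
      Measure.restrict_apply (measurable_shift_iterate _ hH), Set.inter_comm]
  have hν : ∀ H, (ν H).toReal = c * Q.real H := fun H => by
    rw [Measure.coe_nnreal_smul_apply, ENNReal.toReal_mul, ENNReal.coe_toReal,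
      Real.coe_toNNReal _ hc0, measureReal_def]
  have hle : μ ≤ ν := by
    refine measure_le_of_cyl fun m hm b => ?_
    rw [← ENNReal.toReal_le_toReal (measure_ne_top _ _) (measure_ne_top _ _), hν,
      hμ _ (measurableSet_cyl b)]
    have hcov : cyl a ∩ shift^[n + τ n] ⁻¹' cyl b ⊆
        ⋃ ξ ∈ (Finset.univ : Finset (Fin (τ n) → A)), cyl (concat3 a ξ b) := by
      rintro x ⟨hxa, hxb⟩
      simp only [Set.mem_iUnion]
      exact ⟨pre _ (shift^[n] x), Finset.mem_univ _,
        (mem_cyl_concat3 _ _ _ _).2 ⟨hxa, mem_cyl_iff.2 rfl, hxb⟩⟩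
    calc Q.real (cyl a ∩ shift^[n + τ n] ⁻¹' cyl b)
        ≤ Q.real (⋃ ξ ∈ (Finset.univ : Finset (Fin (τ n) → A)), cyl (concat3 a ξ b)) :=
          measureReal_mono hcov (measure_ne_top _ _)
      _ ≤ ∑ ξ : Fin (τ n) → A, Q.real (cyl (concat3 a ξ b)) := measureReal_biUnion_finset_le _ _
      _ ≤ ∑ _ξ : Fin (τ n) → A, Real.exp (k n) * (Q.real (cyl a) * Q.real (cyl b)) :=
          Finset.sum_le_sum fun ξ _ => h.upper_all hQ hn hm a ξ b
      _ = c * Q.real (cyl b) := by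
          simp [hc]; ring
  have := ENNReal.toReal_mono (measure_ne_top _ _) (hle H)
  rwa [hν, hμ _ hH] at this

theorem IsUDWith.measure_pre_inter_le [IsProbabilityMeasure Q] {k : ℕ → ℝ} {τ : ℕ → ℕ}
    (hQ : MeasurePreserving shift Q Q) (h : IsUDWith Q k τ) {n : ℕ} (hn : 1 ≤ n)
    (S : Set (Fin n → A)) {H : Set (ℕ → A)} (hH : MeasurableSet H) :
    Q.real (pre n ⁻¹' S ∩ shift^[n + τ n] ⁻¹' H) ≤
      Real.exp (k n) * (Fintype.card A : ℝ) ^ τ n * Q.real (pre n ⁻¹' S) * Q.real H := by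
  classical
  obtain ⟨S, rfl⟩ := (Set.toFinite S).exists_finset_coe
  rw [measureReal_pre_preimage Q S _ (measurable_shift_iterate _ hH)]
  have h2 := measureReal_pre_preimage Q S Set.univ MeasurableSet.univ
  simp only [Set.inter_univ] at h2
  rw [h2, Finset.mul_sum, Finset.sum_mul]
  exact Finset.sum_le_sum fun a _ => h.measure_cyl_inter_le hQ hn a hH

/-- Selective lower decoupling in terms of events. -/
theorem measure_cyl_inter_sum_ge [IsProbabilityMeasure P] {n t : ℕ} {c : ℝ} (hc : 0 ≤ c) {a : Fin n → A}
    (h : ∀ m : ℕ, 1 ≤ m → ∀ b ∈ suppWords P m, ∃ l ≤ t, ∃ ξ : Fin l → A,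
      c * (P.real (cyl a) * P.real (cyl b)) ≤ P.real (cyl (concat3 a ξ b)))
    {H : Set (ℕ → A)} (hH : MeasurableSet H) :
    c * P.real (cyl a) * P.real H ≤
      ∑ l ∈ Finset.range (t + 1), P.real (cyl a ∩ shift^[n + l] ⁻¹' H) := by
  have hc0 : 0 ≤ c * P.real (cyl a) := by positivity
  -- The admissible gap length varies with the word `b`. Summing over all gap lengths up to `t`
  -- produces a right-hand side that does not depend on this choice and is a measure in `H`.
  let ν : Measure (ℕ → A) :=
    ∑ l ∈ Finset.range (t + 1), (P.restrict (cyl a)).map shift^[n + l]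
  let μ : Measure (ℕ → A) := (c * P.real (cyl a)).toNNReal • P
  have hν : ∀ H, MeasurableSet H → (ν H).toReal =
      ∑ l ∈ Finset.range (t + 1), P.real (cyl a ∩ shift^[n + l] ⁻¹' H) := fun H hH => by
    simp only [ν, Measure.coe_finsetSum, Finset.sum_apply]
    rw [ENNReal.toReal_sum fun _ _ => measure_ne_top _ _]
    refine Finset.sum_congr rfl fun l _ => ?_
    rw [Measure.map_apply (measurable_shift_iterate _) hH,
      Measure.restrict_apply (measurable_shift_iterate _ hH), Set.inter_comm, measureReal_def]
  have hμ : ∀ H, (μ H).toReal = c * P.real (cyl a) * P.real H := fun H => by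
    rw [Measure.coe_nnreal_smul_apply, ENNReal.toReal_mul, ENNReal.coe_toReal,
      Real.coe_toNNReal _ hc0]
    rfl
  have hle : μ ≤ ν := by
    refine measure_le_of_cyl fun m hm b => ?_
    rw [← ENNReal.toReal_le_toReal (measure_ne_top _ _) (measure_ne_top _ _), hμ,
      hν _ (measurableSet_cyl b)]
    by_cases hb : 0 < P.real (cyl b)
    · obtain ⟨l, hl, ξ, hξ⟩ := h m hm b hb
      rw [mul_assoc]
      refine (hξ.trans (measureReal_mono (fun x hx => ?_))).trans
        (Finset.single_le_sum (f := fun l => P.real (cyl a ∩ shift^[n + l] ⁻¹' cyl b))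
          (fun _ _ => measureReal_nonneg) (Finset.mem_range.2 (Nat.lt_succ_of_le hl)))
      have := (mem_cyl_concat3 a ξ b x).1 hx
      exact ⟨this.1, this.2.2⟩
    · rw [le_antisymm (not_lt.1 hb) measureReal_nonneg, mul_zero]
      exact Finset.sum_nonneg fun _ _ => measureReal_nonneg
  have := ENNReal.toReal_mono (measure_ne_top _ _) (hle H)
  rwa [hμ, hν _ hH] at this

end Words

/-! ### Almost subadditive processes and ergodic averages -/

section Subadditive

variable {Ω : Type*} [MeasurableSpace Ω] {μ : Measure Ω} {T : Ω → Ω}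

theorem measurableSet_frequently {p : ℕ → Ω → Prop} (h : ∀ n, MeasurableSet {y | p n y}) :
    MeasurableSet {y | ∃ᶠ n in atTop, p n y} := by
  have : {y | ∃ᶠ n in atTop, p n y} = limsup (fun n => {y | p n y}) atTop := by
    ext y; rw [mem_limsup_iff_frequently_mem]; rfl
  rw [this]
  exact MeasurableSet.measurableSet_limsup h

theorem integral_birkhoffSum (hT : MeasurePreserving T μ μ) {g : Ω → ℝ} (hg : Integrable g μ)
    (n : ℕ) : ∫ y, birkhoffSum T g n y ∂μ = n * ∫ y, g y ∂μ := by
  have hi : ∀ i, Integrable (fun y => g (T^[i] y)) μ := fun i =>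
    (hT.iterate i).integrable_comp_of_integrable hg
  have he : ∀ i, ∫ y, g (T^[i] y) ∂μ = ∫ y, g y ∂μ := fun i => by
    have hm := hT.iterate i
    conv_rhs => rw [← hm.map_eq]
    rw [integral_map hm.measurable.aemeasurable]
    rw [hm.map_eq]; exact hg.aestronglyMeasurable
  simp only [birkhoffSum]
  rw [integral_finsetSum _ fun i _ => hi i]
  simp [he]

theorem integrable_birkhoffSum (hT : MeasurePreserving T μ μ) {g : Ω → ℝ} (hg : Integrable g μ)
    (n : ℕ) : Integrable (birkhoffSum T g n) μ := by
  unfold birkhoffSum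
  exact integrable_finsetSum _ fun i _ => (hT.iterate i).integrable_comp_of_integrable hg

theorem measurable_birkhoffSum (hT : Measurable T) {g : Ω → ℝ} (hg : Measurable g)
    (n : ℕ) : Measurable (birkhoffSum T g n) := by
  unfold birkhoffSum
  exact Finset.measurable_sum _ fun i _ => hg.comp (hT.iterate i)

theorem exists_forall_ge_le_mul {k : ℕ → ℝ} (hk : k =o[atTop] fun n : ℕ => (n : ℝ)) {ε : ℝ}
    (hε : 0 < ε) : ∃ M : ℕ, ∀ n, M ≤ n → k n ≤ ε * n := by
  obtain ⟨M, hM⟩ := eventually_atTop.1 (hk.def hε)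
  refine ⟨M, fun n hn => (le_abs_self _).trans ?_⟩
  have := hM n hn
  simpa using this

/-- The covering step: if most points start a block, of length between `1` and `K`, on which `F` is
at most `-b` per unit length, then `F` is small. -/
theorem le_of_covering {F : ℕ → Ω → ℝ} {k : ℕ → ℝ} {Ω₀ : Set Ω} {b : ℝ} {K : ℕ} (hb : 0 ≤ b)
    (hinv : ∀ y ∈ Ω₀, T y ∈ Ω₀) (hnonpos : ∀ n, ∀ y ∈ Ω₀, F n y ≤ 0)
    (hshift : ∀ n, ∀ y ∈ Ω₀, F (n + 1) y ≤ F n (T y))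
    (hsub : ∀ n m, 1 ≤ n → ∀ y ∈ Ω₀, F (n + m) y ≤ F n y + F m (T^[n] y) + k n)
    {g : Ω → ℝ} (hg0 : ∀ y, 0 ≤ g y)
    (hg : ∀ y ∈ Ω₀, g y = 1 ∨ ∃ n, 1 ≤ n ∧ n ≤ K ∧ F n y + k n ≤ -b * n) :
    ∀ n, ∀ y ∈ Ω₀, F n y ≤ -b * (n - K - birkhoffSum T g n y) := by
  have hinv' : ∀ n, ∀ y ∈ Ω₀, T^[n] y ∈ Ω₀ := fun n => by
    induction n with
    | zero => exact fun y hy => hy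
    | succ n ih => exact fun y hy => ih _ (hinv y hy)
  have hS0 : ∀ n y, 0 ≤ birkhoffSum T g n y := fun n y => Finset.sum_nonneg fun _ _ => hg0 _
  intro n
  induction n using Nat.strong_induction_on with
  | _ n ih =>
    intro y hy
    -- Near the end no full block need fit; there the right-hand side is nonnegative and `F ≤ 0` is
    -- enough.
    by_cases hnK : n ≤ K
    · refine (hnonpos n y hy).trans ?_
      have : (n : ℝ) ≤ K := by exact_mod_cast hnK
      have := hS0 n y
      nlinarith
    -- A point with `g = 1` is skipped: it uses one letter and raises the Birkhoff sum by one, so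
    -- the bound does not move. Otherwise a whole block is removed, on which `F` decreases at rate
    -- `b`.
    · rcases hg y hy with h1 | ⟨l, hl1, hlK, hl⟩
      · obtain ⟨m, rfl⟩ : ∃ m, n = m + 1 := ⟨n - 1, by omega⟩
        have h2 := ih m (by omega) (T y) (hinv y hy)
        have h3 := hshift m y hy
        rw [birkhoffSum_succ', h1]
        push_cast
        have e : (m : ℝ) + 1 - K - (1 + birkhoffSum T g m (T y)) =
          m - K - birkhoffSum T g m (T y) := by ring
        rw [e]
        exact h3.trans h2
      · obtain ⟨m, rfl⟩ : ∃ m, n = l + m := ⟨n - l, by omega⟩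
        have h2 := ih m (by omega) _ (hinv' l y hy)
        have h3 := hsub l m hl1 y hy
        rw [birkhoffSum_add]
        push_cast
        have := hS0 l y
        nlinarith

/-- The lower half of the subadditive ergodic theorem for nonpositive processes. -/
theorem ae_eventually_ge_of_subadditive [IsProbabilityMeasure μ] (hT : Ergodic T μ)
    {F : ℕ → Ω → ℝ} {k : ℕ → ℝ} {Ω₀ : Set Ω} (h0 : ∀ᵐ y ∂μ, y ∈ Ω₀)
    (hinv : ∀ y ∈ Ω₀, T y ∈ Ω₀) (hmeas : ∀ n, Measurable (F n)) (hint : ∀ n, Integrable (F n) μ)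
    (hnonpos : ∀ n, ∀ y ∈ Ω₀, F n y ≤ 0) (hshift : ∀ n, ∀ y ∈ Ω₀, F (n + 1) y ≤ F n (T y))
    (hsub : ∀ n m, 1 ≤ n → ∀ y ∈ Ω₀, F (n + m) y ≤ F n y + F m (T^[n] y) + k n)
    (hk : k =o[atTop] fun n : ℕ => (n : ℝ)) {c : ℝ}
    (hc : ∃ᶠ n : ℕ in atTop, c * n ≤ ∫ y, F n y ∂μ) {ε : ℝ} (hε : 0 < ε) :
    ∀ᵐ y ∂μ, ∀ᶠ n : ℕ in atTop, (c - ε) * n ≤ F n y := by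
  have hFint : ∀ n, ∫ y, F n y ∂μ ≤ 0 := fun n =>
    integral_nonpos_of_ae (h0.mono fun y hy => hnonpos n y hy)
  have hc0 : c ≤ 0 := by
    obtain ⟨n, hn, hn1⟩ := (hc.and_eventually (eventually_ge_atTop 1)).exists
    have h1 : (1 : ℝ) ≤ n := by exact_mod_cast hn1
    have := hn.trans (hFint n)
    by_contra! h
    nlinarith
  -- Passing from `T y` to `y` replaces `n` by `n + 1` and so degrades the rate slightly. The union
  -- over all margins `δ` absorbs this loss and yields a set that contains its preimage.
  let E : ℝ → Set Ω := fun δ => {y | ∃ᶠ n : ℕ in atTop, F n y < (c - ε / 2 - δ) * n}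
  let U : Set Ω := ⋃ j : ℕ, E (1 / ((j : ℝ) + 1))
  have hEm : ∀ δ, MeasurableSet (E δ) := fun δ =>
    measurableSet_frequently fun n => measurableSet_lt (hmeas n) measurable_const
  have hUm : MeasurableSet U := MeasurableSet.iUnion fun j => hEm _
  have hmono : ∀ {δ δ' : ℝ}, δ ≤ δ' → E δ' ⊆ E δ := by
    intro δ δ' h y hy
    refine hy.mono fun n hn => hn.trans_le ?_
    have : (0 : ℝ) ≤ n := n.cast_nonneg
    nlinarith
  have hTU : T ⁻¹' U ≤ᵐ[μ] U := by
    filter_upwards [h0] with y hy hTy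
    obtain ⟨j, hj⟩ := Set.mem_iUnion.1 hTy
    set δ : ℝ := 1 / ((j : ℝ) + 1) with hδ
    have hδ0 : 0 < δ := by positivity
    have hy2 : y ∈ E (δ / 2) := by
      have h1 : ∃ᶠ n : ℕ in atTop, F (n + 1) y < (c - ε / 2 - δ / 2) * ((n + 1 : ℕ) : ℝ) := by
        have hev : ∀ᶠ n : ℕ in atTop, (-(c - ε / 2 - δ / 2)) / (δ / 2) ≤ n :=
          tendsto_natCast_atTop_atTop.eventually_ge_atTop _
        refine (Frequently.and_eventually hj hev).mono fun n hn => ?_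
        have h2 := hn.2
        rw [div_le_iff₀ (by positivity)] at h2
        refine (hshift n y hy).trans_lt (lt_of_lt_of_le hn.1 ?_)
        push_cast
        nlinarith
      exact (tendsto_add_atTop_nat 1).frequently h1
    refine Set.mem_iUnion.2 ⟨2 * j + 1, hmono ?_ hy2⟩
    rw [hδ]
    push_cast
    rw [div_div, div_le_div_iff₀ (by positivity) (by positivity)]
    ring_nf; linarith
  rcases hT.ae_empty_or_univ_of_preimage_ae_le hUm.nullMeasurableSet hTU with hU | hU
  · have hU' : ∀ᵐ y ∂μ, y ∉ U := measure_eq_zero_iff_ae_notMem.1 (ae_eq_empty.1 hU)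
    filter_upwards [hU'] with y hy
    obtain ⟨j, hj⟩ := exists_nat_one_div_lt (half_pos hε)
    have h1 : y ∉ E (1 / ((j : ℝ) + 1)) := fun h => hy (Set.mem_iUnion.2 ⟨j, h⟩)
    have h2 := not_frequently.1 h1
    filter_upwards [h2] with n hn
    have : (0 : ℝ) ≤ n := n.cast_nonneg
    nlinarith [not_lt.1 hn]
  · exfalso
    have hU' : ∀ᵐ y ∂μ, y ∈ U := by
      filter_upwards [hU] with y hy
      exact of_eq_true ((congrArg (fun p : Prop => p) hy).trans (eq_true trivial))
    obtain ⟨M, hM⟩ := exists_forall_ge_le_mul hk (show 0 < ε / 4 by positivity)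
    set M' := max M 1 with hM'
    -- These are the points that start no good block of length between `M'` and `K`. If `U` has full
    -- measure, their measure tends to zero as `K` grows, so good blocks cover almost everything;
    -- this contradicts the lower bound on the means.
    let B : ℕ → Set Ω := fun K => {y | ∀ n, M' ≤ n → n ≤ K → (c - ε / 2) * n ≤ F n y}
    have hBm : ∀ K, MeasurableSet (B K) := by
      intro K
      have : B K = ⋂ n ∈ {n : ℕ | M' ≤ n ∧ n ≤ K}, {y | (c - ε / 2) * n ≤ F n y} := by
        ext y; simp [B]
      rw [this]
      exact MeasurableSet.biInter (Set.to_countable _) fun n _ =>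
        measurableSet_le measurable_const (hmeas n)
    have hBanti : Antitone B := fun K K' h y hy n h1 h2 => hy n h1 (h2.trans h)
    have hB0 : μ (⋂ K, B K) = 0 := by
      rw [measure_eq_zero_iff_ae_notMem]
      filter_upwards [hU'] with y hy hyB
      obtain ⟨j, hj⟩ := Set.mem_iUnion.1 hy
      obtain ⟨n, hn, hnM⟩ := (Frequently.and_eventually hj (eventually_ge_atTop M')).exists
      have h1 := Set.mem_iInter.1 hyB n n hnM le_rfl
      have h2 : (0 : ℝ) ≤ 1 / ((j : ℝ) + 1) * n := by positivity
      linarith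
    have hlim := tendsto_measure_iInter_atTop (μ := μ) (fun K => (hBm K).nullMeasurableSet) hBanti
      ⟨0, measure_ne_top _ _⟩
    rw [hB0] at hlim
    have hlim' : Tendsto (fun K => μ.real (B K)) atTop (𝓝 0) := by
      have := (ENNReal.tendsto_toReal ENNReal.zero_ne_top).comp hlim
      rwa [ENNReal.toReal_zero] at this
    set b : ℝ := -(c - ε / 4) with hb
    have hb0 : 0 < b := by linarith
    -- The rate `-b` lies below `c` by `ε / 4`. The skipped points and the last incomplete block
    -- each cost at most `ε n / 8`, which does not make up this difference.
    obtain ⟨K, hK⟩ := (hlim'.eventually (gt_mem_nhds (show 0 < ε / (8 * b) by positivity))).exists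
    have hcov := le_of_covering (T := T) (F := F) (k := k) (Ω₀ := Ω₀) (b := b) (K := K) hb0.le hinv
      hnonpos hshift hsub (g := (B K).indicator 1)
      (fun y => Set.indicator_nonneg (fun _ _ => zero_le_one) _) (by
        intro y hy
        by_cases hyB : y ∈ B K
        · left; simp [hyB]
        · right
          simp only [B, Set.mem_ofPred_eq, not_forall, not_le] at hyB
          obtain ⟨n, h1, h2, h3⟩ := hyB
          refine ⟨n, (le_max_right _ _).trans h1, h2, ?_⟩
          have := hM n ((le_max_left _ _).trans h1)
          rw [hb]
          linarith)
    have hgi : Integrable ((B K).indicator (1 : Ω → ℝ)) μ := (integrable_const 1).indicator (hBm K)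
    have hmain : ∀ n : ℕ, ∫ y, F n y ∂μ ≤ -b * (n - K - n * μ.real (B K)) := by
      intro n
      have hb' := integral_birkhoffSum hT.toMeasurePreserving hgi n
      rw [integral_indicator_one (hBm K)] at hb'
      have hi := integrable_birkhoffSum hT.toMeasurePreserving hgi n
      calc ∫ y, F n y ∂μ
          ≤ ∫ y, -b * (n - K - birkhoffSum T ((B K).indicator 1) n y) ∂μ := by
            refine integral_mono_ae (hint n) ?_ (h0.mono fun y hy => hcov n y hy)
            exact (((integrable_const _).sub hi)).const_mul _
        _ = -b * (n - K - n * μ.real (B K)) := by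
            rw [integral_const_mul, integral_sub (integrable_const _) hi, hb']
            simp
    have hev : ∀ᶠ n : ℕ in atTop, b * K / (ε / 8) < n :=
      tendsto_natCast_atTop_atTop.eventually_gt_atTop _
    obtain ⟨n, hn1, hn2⟩ := (hc.and_eventually hev).exists
    have h1 := hn1.trans (hmain n)
    rw [div_lt_iff₀ (by positivity)] at hn2
    have hn0 : (0 : ℝ) ≤ n := n.cast_nonneg
    have h3 : b * μ.real (B K) ≤ ε / 8 := by
      rw [lt_div_iff₀ (by positivity)] at hK
      linarith
    have h4 : (b * μ.real (B K)) * n ≤ ε / 8 * n := mul_le_mul_of_nonneg_right h3 hn0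
    have h5 : c * n = -b * n + ε / 4 * n := by rw [hb]; ring
    nlinarith

/-- The lower half of the pointwise ergodic theorem for bounded functions. -/
theorem ae_eventually_birkhoffSum_ge [IsProbabilityMeasure μ] (hT : Ergodic T μ) {g : Ω → ℝ}
    (hg : Measurable g) {R R' : ℝ} (hR : ∀ y, g y ≤ R) (hR' : ∀ y, R' ≤ g y) {ε : ℝ} (hε : 0 < ε) :
    ∀ᵐ y ∂μ, ∀ᶠ n : ℕ in atTop, (∫ y, g y ∂μ - ε) * n ≤ birkhoffSum T g n y := by
  have hgi : Integrable g μ := by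
    refine Integrable.of_bound hg.aestronglyMeasurable (max |R| |R'|) (ae_of_all _ fun y => ?_)
    exact abs_le_max_abs_abs (hR' y) (hR y) |>.trans (by rw [max_comm])
  -- Subtracting an upper bound makes the Birkhoff sums nonpositive; being additive, they satisfy
  -- the subadditivity hypothesis with no error term.
  let g' : Ω → ℝ := fun y => g y - R
  have hg'i : Integrable g' μ := hgi.sub (integrable_const R)
  have hg'm : Measurable g' := hg.sub_const R
  have key := ae_eventually_ge_of_subadditive hT (F := birkhoffSum T g') (k := 0)
    (Ω₀ := Set.univ) (c := ∫ y, g' y ∂μ) (ae_of_all _ fun _ => trivial) (fun _ _ => trivial)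
    (fun n => measurable_birkhoffSum hT.measurable hg'm n)
    (fun n => integrable_birkhoffSum hT.toMeasurePreserving hg'i n)
    (fun n y _ => Finset.sum_nonpos fun i _ => sub_nonpos.2 (hR _))
    (fun n y _ => by
      rw [birkhoffSum_succ']
      have : g' y ≤ 0 := sub_nonpos.2 (hR _)
      linarith)
    (fun n m _ y _ => by rw [birkhoffSum_add]; simp)
    (isLittleO_zero _ _)
    (Frequently.of_forall fun n => by
      rw [integral_birkhoffSum hT.toMeasurePreserving hg'i]; linarith) hε
  filter_upwards [key] with y hy
  filter_upwards [hy] with n hn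
  have h1 : birkhoffSum T g' n y = birkhoffSum T g n y - n * R := by
    simp [birkhoffSum, g', Finset.sum_sub_distrib]
  have h2 : ∫ y, g' y ∂μ = ∫ y, g y ∂μ - R := by
    simp only [g']
    rw [integral_sub hgi (integrable_const R)]; simp
  rw [h1, h2] at hn
  linarith

end Subadditive

/-! ### Growth of the information and existence of the cross entropy -/

section Information

variable {A : Type*} [MeasurableSpace A]

/-- The information content `-ln P[y_1 … y_n]`. -/
noncomputable def info (P : Measure (ℕ → A)) (n : ℕ) (y : ℕ → A) : ℝ := -Real.log (pr P n y)

variable {P Q : Measure (ℕ → A)}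

theorem info_nonneg [IsProbabilityMeasure P] (n : ℕ) (y : ℕ → A) : 0 ≤ info P n y :=
  neg_nonneg.2 (Real.log_nonpos (pr_nonneg n y) (pr_le_one n y))

theorem pr_pos {y : ℕ → A} (hy : y ∈ supp P) (n : ℕ) : 0 < pr P n y := hy n

theorem exp_neg_info {n : ℕ} {y : ℕ → A} (hy : y ∈ supp P) :
    Real.exp (-info P n y) = pr P n y := by
  rw [info, neg_neg, Real.exp_log (pr_pos hy n)]

theorem info_mono [IsProbabilityMeasure P] {n m : ℕ} (h : n ≤ m) {y : ℕ → A} (hy : y ∈ supp P) :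
    info P n y ≤ info P m y :=
  neg_le_neg (Real.log_le_log (hy m) (pr_anti h y))

variable [Fintype A] [MeasurableSingletonClass A]

theorem measurable_info (n : ℕ) : Measurable (info P n) := (measurable_pr n).log.neg

theorem integrable_info [IsFiniteMeasure Q] (n : ℕ) : Integrable (info P n) Q :=
  integrable_comp_pre Q fun a => -Real.log (P.real (cyl a))

theorem exists_info_le (P : Measure (ℕ → A)) (n : ℕ) : ∃ R, ∀ y, info P n y ≤ R := by
  obtain ⟨R, hR⟩ := (Set.finite_range fun a : Fin n → A => -Real.log (P.real (cyl a))).bddAbove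
  exact ⟨R, fun y => hR ⟨pre n y, rfl⟩⟩

theorem info_shift_le [IsProbabilityMeasure P] (hP : MeasurePreserving shift P P) {n : ℕ}
    {y : ℕ → A} (hy : y ∈ supp P) : info P n (shift y) ≤ info P (n + 1) y :=
  neg_le_neg (Real.log_le_log (hy _) (pr_succ_le_shift hP n y))

theorem pr_add_le [IsProbabilityMeasure P] (hP : MeasurePreserving shift P P) {k : ℕ → ℝ}
    (h : IsUDWith P k fun _ => 0) {n : ℕ} (hn : 1 ≤ n) (m : ℕ) (y : ℕ → A) :
    pr P (n + m) y ≤ Real.exp (k n) * (pr P n y * pr P m (shift^[n] y)) := by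
  rcases Nat.eq_zero_or_pos m with rfl | hm
  · rw [pr_zero, mul_one]
    exact le_mul_of_one_le_left (pr_nonneg _ _) (Real.one_le_exp (h.k_nonneg n))
  · refine le_trans (le_of_eq ?_) (h.upper_all hP hn hm (pre n y) Fin.elim0 (pre m (shift^[n] y)))
    rw [pr]
    congr 1
    ext x
    rw [mem_cyl_concat3, mem_cyl_pre, mem_cyl_pre, cyl_zero, mem_cyl_pre]
    simp only [shift_iterate_apply, Set.mem_univ, true_and, add_zero]
    constructor
    · exact fun hx => ⟨fun i hi => hx i (by omega), fun i hi => hx _ (by omega)⟩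
    · rintro ⟨h1, h2⟩ i hi
      by_cases hin : i < n
      · exact h1 i hin
      · have := h2 (i - n) (by omega)
        rwa [Nat.sub_add_cancel (not_lt.1 hin)] at this

theorem info_add_ge [IsProbabilityMeasure P] (hP : MeasurePreserving shift P P) {k : ℕ → ℝ}
    (h : IsUDWith P k fun _ => 0) {n : ℕ} (hn : 1 ≤ n) (m : ℕ) {y : ℕ → A} (hy : y ∈ supp P) :
    info P n y + info P m (shift^[n] y) - k n ≤ info P (n + m) y := by
  have h1 := Real.log_le_log (pr_pos hy _) (pr_add_le hP h hn m y)
  have hn0 := pr_pos hy n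
  have hm0 := pr_pos (shift_iterate_mem_supp hP hy n) m
  rw [Real.log_mul (Real.exp_pos _).ne' (mul_pos hn0 hm0).ne', Real.log_exp,
    Real.log_mul hn0.ne' hm0.ne'] at h1
  simp only [info]
  linarith

/-- The blocks of length `n` starting at positions `0, …, j` split into `n` families of disjoint
adjacent blocks, one for each residue modulo `n`. Superadditivity bounds each family by the
information of one suffix of the prefix of length `n + j`. The induction peels off the first block,
which rotates the families. -/
theorem birkhoffSum_info_le [IsProbabilityMeasure P] (hP : MeasurePreserving shift P P) {k : ℕ → ℝ}
    (h : IsUDWith P k fun _ => 0) {n : ℕ} (hn : 1 ≤ n) (j : ℕ) {y : ℕ → A} (hy : y ∈ supp P) :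
    birkhoffSum shift (fun y => info P n y - k n) (j + 1) y ≤ n * info P (n + j) y := by
  have key : ∀ j, ∀ y ∈ supp P, birkhoffSum shift (fun y => info P n y - k n) (j + 1) y ≤
      ∑ r ∈ Finset.range n, info P (n + j - r) (shift^[r] y) := by
    intro j
    induction j with
    | zero =>
      intro y _
      simp only [zero_add, birkhoffSum_one, add_zero]
      have h1 := Finset.single_le_sum (f := fun r => info P (n - r) (shift^[r] y))
        (fun _ _ => info_nonneg _ _) (Finset.mem_range.2 (show 0 < n by omega))
      have h2 := h.k_nonneg n
      simp only [Function.iterate_zero, id, Nat.sub_zero] at h1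
      linarith
    | succ j ih =>
      intro y hy
      rw [birkhoffSum_succ']
      have h1 := ih (shift y) (shift_mem_supp hP hy)
      have h2 := info_add_ge hP h hn (j + 1) hy
      obtain ⟨n, rfl⟩ : ∃ n', n = n' + 1 := ⟨n - 1, by omega⟩
      rw [Finset.sum_range_succ] at h1
      rw [Finset.sum_range_succ']
      have e1 : ∑ r ∈ Finset.range n, info P (n + 1 + j - r) (shift^[r] (shift y)) =
          ∑ r ∈ Finset.range n, info P (n + 1 + (j + 1) - (r + 1)) (shift^[r + 1] y) :=
        Finset.sum_congr rfl fun r _ => by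
          rw [Function.iterate_succ_apply]; congr 1; omega
      have e2 : info P (n + 1 + j - n) (shift^[n] (shift y)) =
          info P (j + 1) (shift^[n + 1] y) := by
        rw [Function.iterate_succ_apply]; congr 1; omega
      rw [e1, e2] at h1
      simp only [Function.iterate_zero, id, Nat.sub_zero]
      linarith
  refine (key j y hy).trans ?_
  calc ∑ r ∈ Finset.range n, info P (n + j - r) (shift^[r] y)
      ≤ ∑ r ∈ Finset.range n, info P (n + j) y := by
        refine Finset.sum_le_sum fun r hr => ?_
        have hr' := Finset.mem_range.1 hr
        have := pr_add_le_shift hP r (n + j - r) y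
        rw [show r + (n + j - r) = n + j by omega] at this
        exact neg_le_neg (Real.log_le_log (hy _) this)
    _ = n * info P (n + j) y := by simp

theorem ae_mem_supp_of_subset [IsProbabilityMeasure Q] (hsupp : supp Q ⊆ supp P) :
    ∀ᵐ y ∂Q, y ∈ supp P :=
  (ae_mem_supp (Q := Q)).mono fun _ hy => hsupp hy

theorem integral_birkhoffSum_info [IsProbabilityMeasure Q] (hQ : MeasurePreserving shift Q Q)
    (n : ℕ) (k : ℝ) (j : ℕ) :
    ∫ y, birkhoffSum shift (fun y => info P n y - k) j y ∂Q = j * (∫ y, info P n y ∂Q - k) := by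
  rw [integral_birkhoffSum (g := fun y => info P n y - k) hQ
    ((integrable_info n).sub (integrable_const k)), integral_sub (integrable_info n) (integrable_const k)]
  simp

/-- The mean information `-∑ Q[a] ln P[a]`, almost superadditive, grows at least linearly. -/
theorem mean_info_superadditive [IsProbabilityMeasure P] [IsProbabilityMeasure Q]
    (hP : MeasurePreserving shift P P) (hQ : MeasurePreserving shift Q Q)
    (hsupp : supp Q ⊆ supp P) {k : ℕ → ℝ} (hk : IsUDWith P k fun _ => 0) {n : ℕ} (hn : 1 ≤ n)
    (j : ℕ) : ((j : ℝ) + 1) * (∫ y, info P n y ∂Q - k n) ≤ n * ∫ y, info P (n + j) y ∂Q := by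
  have h1 := integral_birkhoffSum_info (P := P) hQ n (k n) (j + 1)
  push_cast at h1
  rw [← h1, ← integral_const_mul]
  refine integral_mono_ae (integrable_birkhoffSum hQ
    ((integrable_info n).sub (integrable_const _)) _) ((integrable_info _).const_mul _) ?_
  filter_upwards [ae_mem_supp_of_subset hsupp] with y hy
  exact birkhoffSum_info_le hP hk hn j hy

theorem hasCrossEntropy_iff [IsProbabilityMeasure Q] {h : EReal} :
    HasCrossEntropy Q P h ↔
      Tendsto (fun n : ℕ => (((∫ y, info P n y ∂Q) / n : ℝ) : EReal)) atTop (𝓝 h) := by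
  unfold HasCrossEntropy
  refine tendsto_congr fun n => ?_
  congr 1
  have := integral_comp_pre Q fun a : Fin n → A => -Real.log (P.real (cyl a))
  simp only [info, pr]
  rw [this]
  simp only [mul_neg, Finset.sum_neg_distrib]
  ring

theorem eventually_mul_le_of_add {H : ℕ → ℝ} (n : ℕ) {c c' : ℝ} (hc : c' < c)
    (h : ∀ᶠ j : ℕ in atTop, c * (j + 1) ≤ H (n + j)) (hc0 : 0 ≤ c') :
    ∀ᶠ m : ℕ in atTop, c' * m ≤ H m := by
  have hev : ∀ᶠ j : ℕ in atTop, c' * n / (c - c') ≤ j :=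
    tendsto_natCast_atTop_atTop.eventually_ge_atTop _
  obtain ⟨J, hJ⟩ := eventually_atTop.1 (h.and hev)
  refine eventually_atTop.2 ⟨J + n, fun m hm => ?_⟩
  obtain ⟨j, rfl⟩ : ∃ j, m = n + j := ⟨m - n, by omega⟩
  obtain ⟨h1, h2⟩ := hJ j (by omega)
  rw [div_le_iff₀ (by linarith)] at h2
  refine le_trans ?_ h1
  push_cast
  nlinarith

theorem exists_mul_lt_mean_info_sub [IsProbabilityMeasure Q] {k : ℕ → ℝ}
    (hk : k =o[atTop] fun n : ℕ => (n : ℝ)) {c c' : ℝ} (hc : c < c')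
    (h : ∃ᶠ n : ℕ in atTop, c' * n ≤ ∫ y, info P n y ∂Q) :
    ∃ n : ℕ, 1 ≤ n ∧ c * n < ∫ y, info P n y ∂Q - k n := by
  obtain ⟨M, hM⟩ := exists_forall_ge_le_mul hk (half_pos (sub_pos.2 hc))
  obtain ⟨n, h1, h2⟩ := (h.and_eventually (eventually_ge_atTop (max M 1))).exists
  have hn1 : 1 ≤ n := (le_max_right _ _).trans h2
  refine ⟨n, hn1, ?_⟩
  have h3 := hM n ((le_max_left _ _).trans h2)
  have : (1 : ℝ) ≤ n := by exact_mod_cast hn1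
  nlinarith

theorem eventually_mul_le_mean_info [IsProbabilityMeasure P] [IsProbabilityMeasure Q]
    (hP : MeasurePreserving shift P P) (hQ : MeasurePreserving shift Q Q)
    (hsupp : supp Q ⊆ supp P) {k : ℕ → ℝ} (hk : IsUDWith P k fun _ => 0) {c : ℝ} {n : ℕ}
    (hn : 1 ≤ n) (h : c * n < ∫ y, info P n y ∂Q - k n) :
    ∀ᶠ m : ℕ in atTop, c * m ≤ ∫ y, info P m y ∂Q := by
  have hn0 : (0 : ℝ) < n := by exact_mod_cast hn
  rcases lt_or_ge c 0 with hc | hc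
  · refine Eventually.of_forall fun m => ?_
    exact (mul_nonpos_of_nonpos_of_nonneg hc.le m.cast_nonneg).trans
      (integral_nonneg fun y => info_nonneg m y)
  · rw [← lt_div_iff₀ hn0] at h
    refine eventually_mul_le_of_add n h (Eventually.of_forall fun j => ?_) hc
    have := mean_info_superadditive hP hQ hsupp hk hn j
    rw [div_mul_eq_mul_div, div_le_iff₀ hn0]
    linarith

/-- A single scale `n` suffices: the Birkhoff averages of the bounded function `info P n - k n` are
eventually at least nearly its mean, and `birkhoffSum_info_le` transfers this to all long prefixes.
-/
theorem ae_eventually_mul_le_info [IsProbabilityMeasure P] [IsProbabilityMeasure Q]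
    (hP : MeasurePreserving shift P P) (hQ : Ergodic shift Q)
    (hsupp : supp Q ⊆ supp P) {k : ℕ → ℝ} (hk : IsUDWith P k fun _ => 0) {c : ℝ} {n : ℕ}
    (hn : 1 ≤ n) (h : c * n < ∫ y, info P n y ∂Q - k n) :
    ∀ᵐ y ∂Q, ∀ᶠ m : ℕ in atTop, c * m ≤ info P m y := by
  have hn0 : (0 : ℝ) < n := by exact_mod_cast hn
  rcases lt_or_ge c 0 with hc | hc
  · refine ae_of_all _ fun y => Eventually.of_forall fun m => ?_
    exact (mul_nonpos_of_nonpos_of_nonneg hc.le m.cast_nonneg).trans (info_nonneg m y)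
  · obtain ⟨c', hc1, hc2⟩ := exists_between ((lt_div_iff₀ hn0).2 h)
    obtain ⟨R, hR⟩ := exists_info_le P n
    have hi : ∫ y, (info P n y - k n) ∂Q = ∫ y, info P n y ∂Q - k n := by
      rw [integral_sub (integrable_info n) (integrable_const _)]; simp
    have hc3 : c' * n < ∫ y, info P n y ∂Q - k n := (lt_div_iff₀ hn0).1 hc2
    have key := ae_eventually_birkhoffSum_ge hQ (g := fun y => info P n y - k n)
      ((measurable_info n).sub_const _) (R := R - k n) (R' := 0 - k n)
      (fun y => sub_le_sub_right (hR y) _) (fun y => sub_le_sub_right (info_nonneg n y) _)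
      (sub_pos.2 hc3)
    rw [hi] at key
    filter_upwards [key, ae_mem_supp_of_subset hsupp] with y hy hyP
    refine eventually_mul_le_of_add n hc1 ?_ hc
    filter_upwards [(tendsto_add_atTop_nat 1).eventually hy] with j hj
    have h1 := birkhoffSum_info_le hP hk hn j hyP
    push_cast at hj
    refine le_of_mul_le_mul_left ?_ hn0
    linarith

/-- A Fekete argument: a rate below the limsup is beaten, even after subtracting `k n`, at some
scale `n`, and almost superadditivity propagates this rate to all large lengths. -/
theorem exists_hasCrossEntropy [IsProbabilityMeasure P] [IsProbabilityMeasure Q]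
    (hP : MeasurePreserving shift P P) (hQ : MeasurePreserving shift Q Q)
    (hsupp : supp Q ⊆ supp P) {k : ℕ → ℝ} (hk : IsUDWith P k fun _ => 0) :
    ∃ h, HasCrossEntropy Q P h := by
  set a : ℕ → EReal := fun n : ℕ => (((∫ y, info P n y ∂Q) / n : ℝ) : EReal) with ha
  have key : limsup a atTop ≤ liminf a atTop := by
    refine EReal.ge_of_forall_gt_iff_ge.1 fun c hc => ?_
    obtain ⟨c', hc1, hc2⟩ := EReal.exists_between_coe_real hc
    have hfr : ∃ᶠ n : ℕ in atTop, c' * n ≤ ∫ y, info P n y ∂Q := by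
      refine ((frequently_lt_of_lt_limsup (by isBoundedDefault) hc2).and_eventually
        (eventually_ge_atTop 1)).mono fun n hn => ?_
      have hn0 : (0 : ℝ) < n := by exact_mod_cast hn.2
      exact ((lt_div_iff₀ hn0).1 (EReal.coe_lt_coe_iff.1 hn.1)).le
    obtain ⟨n, hn, hn'⟩ := exists_mul_lt_mean_info_sub hk.k_little
      (EReal.coe_lt_coe_iff.1 hc1) hfr
    refine le_liminf_of_le (by isBoundedDefault) ?_
    filter_upwards [eventually_mul_le_mean_info hP hQ hsupp hk hn hn',
      eventually_ge_atTop 1] with m hm hm1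
    have hm0 : (0 : ℝ) < m := by exact_mod_cast hm1
    exact EReal.coe_le_coe_iff.2 ((le_div_iff₀ hm0).2 hm)
  exact ⟨_, hasCrossEntropy_iff.2 (tendsto_of_le_liminf_of_limsup_le key le_rfl)⟩

theorem HasCrossEntropy.eventually_mul_le_mean_info [IsProbabilityMeasure Q] {h : EReal}
    (hh : HasCrossEntropy Q P h) {c : ℝ} (hc : (c : EReal) < h) :
    ∀ᶠ n : ℕ in atTop, c * n ≤ ∫ y, info P n y ∂Q := by
  filter_upwards [(hasCrossEntropy_iff.1 hh).eventually (lt_mem_nhds hc),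
    eventually_ge_atTop 1] with n hn hn1
  have hn0 : (0 : ℝ) < n := by exact_mod_cast hn1
  exact ((lt_div_iff₀ hn0).1 (EReal.coe_lt_coe_iff.1 hn)).le

/-- Almost surely the information grows at least at the rate of the cross entropy. -/
theorem HasCrossEntropy.ae_eventually_ge [IsProbabilityMeasure P] [IsProbabilityMeasure Q]
    (hP : MeasurePreserving shift P P) (hQ : Ergodic shift Q)
    (hsupp : supp Q ⊆ supp P) {k : ℕ → ℝ} (hk : IsUDWith P k fun _ => 0) {h : EReal}
    (hh : HasCrossEntropy Q P h) {c : ℝ} (hc : (c : EReal) < h) :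
    ∀ᵐ y ∂Q, ∀ᶠ m : ℕ in atTop, c * m ≤ info P m y := by
  obtain ⟨c', hc1, hc2⟩ := EReal.exists_between_coe_real hc
  obtain ⟨n, hn, hn'⟩ := exists_mul_lt_mean_info_sub hk.k_little (EReal.coe_lt_coe_iff.1 hc1)
    (hh.eventually_mul_le_mean_info hc2).frequently
  exact ae_eventually_mul_le_info hP hQ hsupp hk hn hn'

/-- Almost surely the information grows at most at the rate of the cross entropy. -/
theorem HasCrossEntropy.ae_eventually_le [IsProbabilityMeasure P] [IsProbabilityMeasure Q]
    (hP : MeasurePreserving shift P P) (hQ : Ergodic shift Q)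
    (hsupp : supp Q ⊆ supp P) {k : ℕ → ℝ} (hk : IsUDWith P k fun _ => 0) {h : EReal}
    (hh : HasCrossEntropy Q P h) {c : ℝ} (hc : h < (c : EReal)) :
    ∀ᵐ y ∂Q, ∀ᶠ m : ℕ in atTop, info P m y ≤ c * m := by
  obtain ⟨c', hc1, hc2⟩ := EReal.exists_between_coe_real hc
  have hc2' := EReal.coe_lt_coe_iff.1 hc2
  have hev : ∀ᶠ n : ℕ in atTop, -c' * n ≤ ∫ y, -info P n y ∂Q := by
    filter_upwards [(hasCrossEntropy_iff.1 hh).eventually (gt_mem_nhds hc1),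
      eventually_ge_atTop 1] with n hn hn1
    have hn0 : (0 : ℝ) < n := by exact_mod_cast hn1
    have := (div_lt_iff₀ hn0).1 (EReal.coe_lt_coe_iff.1 hn)
    rw [integral_neg]
    linarith
  -- The negated information is nonpositive, and the superadditivity of the information becomes
  -- subadditivity with error `k`.
  have key := ae_eventually_ge_of_subadditive hQ (F := fun n y => -info P n y) (k := k)
    (Ω₀ := supp P) (ae_mem_supp_of_subset hsupp) (fun y hy => shift_mem_supp hP hy)
    (fun n => (measurable_info n).neg) (fun n => (integrable_info n).neg)
    (fun n y _ => neg_nonpos.2 (info_nonneg n y))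
    (fun n y hy => neg_le_neg (info_shift_le hP hy))
    (fun n m hn y hy => by have := info_add_ge hP hk hn m hy; linarith)
    hk.k_little hev.frequently (sub_pos.2 hc2')
  filter_upwards [key] with y hy
  filter_upwards [hy] with m hm
  linarith

end Information

/-! ### Extended-real quotients by negative numbers -/

section ERealDivision

/-- Difference quotients to the left of the origin have denominator `-s`. This turns a bound on a
slope into a bound on the pressure, which may be infinite. -/
theorem coe_lt_div_neg_iff {x : EReal} {s c : ℝ} (hs : 0 < s) :
    (c : EReal) < x / ((-s : ℝ) : EReal) ↔ x < ((-s * c : ℝ) : EReal) := by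
  have hs' : ((-s : ℝ) : EReal) < 0 := by exact_mod_cast neg_lt_zero.2 hs
  induction x with
  | bot =>
    rw [EReal.bot_div_of_neg_ne_bot hs' (EReal.coe_ne_bot _)]
    simp [EReal.coe_lt_top, EReal.bot_lt_coe, -EReal.coe_mul, -EReal.coe_neg]
  | top =>
    rw [EReal.top_div_of_neg_ne_bot hs' (EReal.coe_ne_bot _)]
    simp [-EReal.coe_mul, -EReal.coe_neg]
  | coe x =>
    rw [← EReal.coe_div, EReal.coe_lt_coe_iff, EReal.coe_lt_coe_iff, div_neg, lt_neg,
      div_lt_iff₀ hs]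
    constructor <;> intro h <;> linarith

theorem coe_le_div_neg_iff {x : EReal} {s c : ℝ} (hs : 0 < s) :
    (c : EReal) ≤ x / ((-s : ℝ) : EReal) ↔ x ≤ ((-s * c : ℝ) : EReal) := by
  have hs' : ((-s : ℝ) : EReal) < 0 := by exact_mod_cast neg_lt_zero.2 hs
  induction x with
  | bot =>
    rw [EReal.bot_div_of_neg_ne_bot hs' (EReal.coe_ne_bot _)]
    simp
  | top =>
    rw [EReal.top_div_of_neg_ne_bot hs' (EReal.coe_ne_bot _)]
    simp [-EReal.coe_mul, -EReal.coe_neg]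
  | coe x =>
    rw [← EReal.coe_div, EReal.coe_le_coe_iff, EReal.coe_le_coe_iff, div_neg, le_neg,
      div_le_iff₀ hs]
    constructor <;> intro h <;> linarith

end ERealDivision

/-! ### Moments, pressure and its left derivative -/

section Pressure

variable {A : Type*} [MeasurableSpace A]

/-- The moment `∑ Q[a] P[a]^s`, whose exponential growth rate is the pressure at `-s`. -/
noncomputable def moment (P Q : Measure (ℕ → A)) (n : ℕ) (s : ℝ) : ℝ := ∫ y, pr P n y ^ s ∂Q

variable {P Q : Measure (ℕ → A)} [Fintype A] [MeasurableSingletonClass A]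

theorem integrable_pr_rpow [IsFiniteMeasure Q] (n : ℕ) (s : ℝ) :
    Integrable (fun y => pr P n y ^ s) Q :=
  integrable_comp_pre Q fun a => P.real (cyl a) ^ s

theorem moment_nonneg (n : ℕ) (s : ℝ) : 0 ≤ moment P Q n s :=
  integral_nonneg fun y => Real.rpow_nonneg (pr_nonneg n y) s

theorem moment_le_one [IsProbabilityMeasure P] [IsProbabilityMeasure Q] (n : ℕ) {s : ℝ}
    (hs : 0 ≤ s) : moment P Q n s ≤ 1 := by
  have h : moment P Q n s ≤ ∫ _, (1 : ℝ) ∂Q :=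
    integral_mono (integrable_pr_rpow n s) (integrable_const 1)
      fun y => Real.rpow_le_one (pr_nonneg n y) (pr_le_one n y) hs
  simpa using h

theorem moment_pos [IsProbabilityMeasure Q] (hsupp : supp Q ⊆ supp P) (n : ℕ) (s : ℝ) :
    0 < moment P Q n s := by
  refine (moment_nonneg n s).lt_of_ne' fun h => ?_
  rw [moment, integral_eq_zero_iff_of_nonneg (fun y => Real.rpow_nonneg (pr_nonneg n y) s)
    (integrable_pr_rpow n s)] at h
  have : ∀ᵐ _ ∂Q, False := by
    filter_upwards [h, ae_mem_supp_of_subset hsupp] with y h1 h2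
    exact (Real.rpow_pos_of_pos (pr_pos h2 n) s).ne' h1
  exact this.exists.elim fun _ h => h

theorem moment_anti [IsProbabilityMeasure P] [IsProbabilityMeasure Q] {n m : ℕ} (h : n ≤ m)
    {s : ℝ} (hs : 0 ≤ s) : moment P Q m s ≤ moment P Q n s :=
  integral_mono (integrable_pr_rpow m s) (integrable_pr_rpow n s)
    fun y => Real.rpow_le_rpow (pr_nonneg m y) (pr_anti h y) hs

/-- Jensen's inequality for the concave function `u ↦ u ^ t`. It supplies the part of the convexity
of the pressure that is needed for monotone slopes at the origin. -/
theorem moment_mul_le [IsProbabilityMeasure Q] (n : ℕ) {s t : ℝ} (ht0 : 0 ≤ t) (ht1 : t ≤ 1) :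
    moment P Q n (s * t) ≤ moment P Q n s ^ t := by
  have h := (Real.concaveOn_rpow ht0 ht1).le_map_integral (μ := Q) (f := fun y => pr P n y ^ s)
    (Real.continuous_rpow_const ht0).continuousOn isClosed_Ici
    (ae_of_all _ fun y => Real.rpow_nonneg (pr_nonneg n y) s) (integrable_pr_rpow n s)
    (integrable_comp_pre Q fun a => (P.real (cyl a) ^ s) ^ t)
  refine le_trans (le_of_eq ?_) h
  exact integral_congr_ae (ae_of_all _ fun y => Real.rpow_mul (pr_nonneg n y) s t)

open Classical in
-- For positive `s`, words outside the support contribute `0 ^ s = 0`, so the restricted sum equals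
-- the full integral.
theorem pressure_neg [IsProbabilityMeasure Q] {s : ℝ} (hs : 0 < s) :
    pressure P Q (-s) =
      limsup (fun n : ℕ => ((1 / (n : ℝ) * Real.log (moment P Q n s) : ℝ) : EReal)) atTop := by
  unfold pressure
  congr 1
  funext n
  congr 3
  have h := integral_comp_pre Q fun a : Fin n → A => P.real (cyl a) ^ s
  rw [moment]
  simp only [pr]
  rw [h, neg_neg]
  refine (Finset.sum_filter_of_ne ?_).trans (Finset.sum_congr rfl fun a _ => mul_comm _ _)
  · intro a _ ha
    refine lt_of_le_of_ne measureReal_nonneg fun h0 => ha ?_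
    rw [← h0, Real.zero_rpow hs.ne', zero_mul]

open Classical in
theorem pressure_zero [IsProbabilityMeasure P] [IsProbabilityMeasure Q]
    (hsupp : supp Q ⊆ supp P) : pressure P Q 0 = 0 := by
  unfold pressure
  have : ∀ n : ℕ, (∑ a : Fin n → A with a ∈ suppWords P n,
      P.real (cyl a) ^ (-(0 : ℝ)) * Q.real (cyl a)) = 1 := by
    intro n
    have h := integral_comp_pre Q fun _ : Fin n → A => (1 : ℝ)
    simp only [integral_const, probReal_univ, smul_eq_mul, mul_one] at h
    rw [h, Finset.sum_filter_of_ne]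
    · simp
    · intro a _ ha
      have h0 : 0 < Q.real (cyl a) := lt_of_le_of_ne measureReal_nonneg fun h0 => ha (by simp [← h0])
      obtain ⟨y, hy, rfl⟩ := exists_mem_supp_of_pos h0
      exact hsupp hy n
  simp only [this, Real.log_one, mul_zero, EReal.coe_zero, limsup_const]

theorem eventually_moment_le_of_pressure_lt [IsProbabilityMeasure Q] (hsupp : supp Q ⊆ supp P)
    {s r : ℝ} (hs : 0 < s) (h : pressure P Q (-s) < (r : EReal)) :
    ∀ᶠ n : ℕ in atTop, moment P Q n s ≤ Real.exp (r * n) := by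
  rw [pressure_neg hs] at h
  filter_upwards [eventually_lt_of_limsup_lt h, eventually_ge_atTop 1] with n hn hn1
  have hn0 : (0 : ℝ) < n := by exact_mod_cast hn1
  have h1 := EReal.coe_lt_coe_iff.1 hn
  rw [one_div_mul_eq_div, div_lt_iff₀ hn0, Real.log_lt_iff_lt_exp (moment_pos hsupp n s)] at h1
  exact h1.le

theorem pressure_le_of_eventually_moment_le [IsProbabilityMeasure Q] (hsupp : supp Q ⊆ supp P)
    {s r : ℝ} (hs : 0 < s) (h : ∀ᶠ n : ℕ in atTop, moment P Q n s ≤ Real.exp (r * n)) :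
    pressure P Q (-s) ≤ (r : EReal) := by
  rw [pressure_neg hs]
  refine limsup_le_of_le (by isBoundedDefault) ?_
  filter_upwards [h, eventually_ge_atTop 1] with n hn hn1
  have hn0 : (0 : ℝ) < n := by exact_mod_cast hn1
  rw [EReal.coe_le_coe_iff, one_div_mul_eq_div, div_le_iff₀ hn0,
    Real.log_le_iff_le_exp (moment_pos hsupp n s)]
  exact hn

/-- The left derivative of the pressure at the origin exists and is the supremum of the slopes. -/
theorem exists_hasLeftDeriv_pressure [IsProbabilityMeasure P] [IsProbabilityMeasure Q]
    (hsupp : supp Q ⊆ supp P) :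
    ∃ D : EReal, HasLeftDeriv (pressure P Q) 0 D ∧
      (∀ c : ℝ, (c : EReal) < D →
        ∃ s : ℝ, 0 < s ∧ s < 1 ∧ pressure P Q (-s) < ((-s * c : ℝ) : EReal)) ∧
      ∀ c s : ℝ, 0 < s → s < 1 → pressure P Q (-s) ≤ ((-s * c : ℝ) : EReal) → (c : EReal) ≤ D := by
  set f : ℝ → EReal := fun α => (pressure P Q α - pressure P Q 0) / ((α - 0 : ℝ) : EReal) with hf
  have hfs : ∀ s, f (-s) = pressure P Q (-s) / ((-s : ℝ) : EReal) := fun s => by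
    simp only [hf, pressure_zero hsupp, sub_zero]
  -- Jensen makes the slopes monotone, so that the left limit is their supremum. The interval stops
  -- at `-1` because only orders `s < 1` can be used in the union bound for occurrences.
  have hmono : MonotoneOn f (Set.Ioo (-1) 0) := by
    intro α hα β hβ hαβ
    obtain ⟨s, rfl⟩ : ∃ s, α = -s := ⟨-α, by ring⟩
    obtain ⟨t, rfl⟩ : ∃ t, β = -t := ⟨-β, by ring⟩
    have hs : 0 < s := by linarith [hα.2]
    have ht : 0 < t := by linarith [hβ.2]
    rw [hfs, hfs]
    refine EReal.ge_of_forall_gt_iff_ge.1 fun c hc => ?_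
    rw [coe_lt_div_neg_iff hs] at hc
    rw [coe_le_div_neg_iff ht]
    refine pressure_le_of_eventually_moment_le hsupp ht ?_
    filter_upwards [eventually_moment_le_of_pressure_lt hsupp hs hc] with n hn
    have h1 := moment_mul_le (P := P) (Q := Q) n (s := s) (t := t / s) (by positivity)
      ((div_le_one hs).2 (by linarith))
    rw [mul_div_cancel₀ _ hs.ne'] at h1
    refine h1.trans ((Real.rpow_le_rpow (moment_nonneg n s) hn (by positivity)).trans (le_of_eq ?_))
    rw [← Real.exp_mul]
    congr 1
    field_simp
  have hlim := hmono.tendsto_nhdsWithin_Ioo_left (Set.nonempty_Ioo.2 (by norm_num))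
    (OrderTop.bddAbove _)
  refine ⟨_, hlim, fun c hc => ?_, fun c s hs0 hs1 hc => ?_⟩
  · obtain ⟨_, ⟨α, hα, rfl⟩, hlt⟩ := lt_sSup_iff.1 hc
    obtain ⟨s, rfl⟩ : ∃ s, α = -s := ⟨-α, by ring⟩
    have hs : 0 < s := by linarith [hα.2]
    rw [hfs, coe_lt_div_neg_iff hs] at hlt
    exact ⟨s, hs, by linarith [hα.1], hlt⟩
  · rw [← coe_le_div_neg_iff hs0, ← hfs] at hc
    exact hc.trans (le_sSup ⟨-s, ⟨by linarith, by linarith⟩, rfl⟩)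

end Pressure

/-! ### Combinatorics of the parsing -/

section Parsing

variable {A : Type*}

/-- The sequences whose prefix of length `n` occurs in `x_1 … x_N`. -/
def occ (N n : ℕ) (x : ℕ → A) : Set (ℕ → A) := {y | ∃ r, r + n ≤ N ∧ ∀ j < n, x (r + j) = y j}

theorem occ_anti {N n m : ℕ} (h : n ≤ m) (x : ℕ → A) : occ N m x ⊆ occ N n x :=
  fun _ ⟨r, hr, hx⟩ => ⟨r, by omega, fun j hj => hx j (by omega)⟩

theorem occ_mono {N N' : ℕ} (h : N ≤ N') (n : ℕ) (x : ℕ → A) : occ N n x ⊆ occ N' n x :=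
  fun _ ⟨r, hr, hx⟩ => ⟨r, by omega, hx⟩

theorem occ_zero (N : ℕ) (x : ℕ → A) : occ N 0 x = Set.univ :=
  Set.eq_univ_of_forall fun _ => ⟨0, by omega, fun _ hj => absurd hj (by omega)⟩

theorem le_of_mem_occ {N n : ℕ} {x y : ℕ → A} (h : y ∈ occ N n x) : n ≤ N := by
  obtain ⟨r, hr, -⟩ := h; omega

theorem occ_eq_preimage (N n : ℕ) (x : ℕ → A) :
    occ N n x = pre n ⁻¹' {a | ∃ r, r + n ≤ N ∧ pre n (shift^[r] x) = a} := by
  ext y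
  simp only [occ, Set.mem_ofPred_eq, Set.mem_preimage, pre_eq_iff, shift_iterate_apply]
  simp only [add_comm]

theorem waitingTime_add_le_iff {N l : ℕ} {y x : ℕ → A} :
    waitingTime l y x + (l : ℕ∞) ≤ (N : ℕ∞) + 1 ↔ y ∈ occ N l x := by
  constructor
  · intro h
    by_contra hy
    have h1 : ((N + 2 - l : ℕ) : ℕ∞) ≤ waitingTime l y x := by
      refine le_iInf₂ fun s hs => ?_
      have : ¬ s + l ≤ N := fun h => hy ⟨s, h, hs⟩
      exact_mod_cast (by omega : N + 2 - l ≤ s + 1)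
    have h2 : ((N + 2 - l : ℕ) : ℕ∞) + l ≤ N + 1 := (add_le_add_left h1 _).trans h
    have h3 : N + 2 - l + l ≤ N + 1 := by exact_mod_cast h2
    omega
  · rintro ⟨s, hs, hx⟩
    have h1 : waitingTime l y x ≤ ((s + 1 : ℕ) : ℕ∞) := iInf₂_le s hx
    refine (add_le_add_left h1 _).trans ?_
    exact_mod_cast (by omega : s + 1 + l ≤ N + 1)

theorem matchLength_eq (N : ℕ) (y x : ℕ → A) :
    matchLength N y x = max 1 (sSup {l : ℕ | 1 ≤ l ∧ y ∈ occ N l x}) := by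
  simp only [matchLength, waitingTime_add_le_iff]

theorem bddAbove_occ (N : ℕ) (y x : ℕ → A) : BddAbove {l : ℕ | 1 ≤ l ∧ y ∈ occ N l x} :=
  ⟨N, fun _ hl => le_of_mem_occ hl.2⟩

/-- The match length is forced to be at least `1`, even when the first letter does not occur; only
the prefix shorter by one is certain to occur. As a parsed word has one letter more than the match
length, this is why `parsable` drops two letters. -/
theorem mem_occ_matchLength_sub_one (N : ℕ) (y x : ℕ → A) :
    y ∈ occ N (matchLength N y x - 1) x := by
  rw [matchLength_eq]
  rcases Set.eq_empty_or_nonempty {l : ℕ | 1 ≤ l ∧ y ∈ occ N l x} with h | h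
  · rw [h]; simp [occ_zero]
  · have := Nat.sSup_mem h (bddAbove_occ N y x)
    rw [max_eq_right this.1]
    exact occ_anti (Nat.sub_le _ _) x this.2

theorem notMem_occ_matchLength_add_one (N : ℕ) (y x : ℕ → A) :
    y ∉ occ N (matchLength N y x + 1) x := by
  intro h
  have h1 := le_csSup (bddAbove_occ N y x)
    (show matchLength N y x + 1 ∈ {l : ℕ | 1 ≤ l ∧ y ∈ occ N l x} from ⟨by omega, h⟩)
  rw [matchLength_eq] at h1
  have := le_max_right 1 (sSup {l : ℕ | 1 ≤ l ∧ y ∈ occ N l x})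
  omega

theorem parseEnd_succ (N : ℕ) (y x : ℕ → A) (i : ℕ) : parseEnd N y x (i + 1) =
    min N (parseEnd N y x i + matchLength N (shift^[parseEnd N y x i] y) x + 1) := rfl

theorem parseEnd_le (N : ℕ) (y x : ℕ → A) (i : ℕ) : parseEnd N y x i ≤ N := by
  cases i with
  | zero => exact Nat.zero_le _
  | succ i => exact min_le_left _ _

theorem parseEnd_lt_succ {N : ℕ} {y x : ℕ → A} {i : ℕ} (h : parseEnd N y x i < N) :
    parseEnd N y x i < parseEnd N y x (i + 1) := by
  rw [parseEnd_succ]; omega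

theorem min_le_parseEnd (N : ℕ) (y x : ℕ → A) (i : ℕ) : min N i ≤ parseEnd N y x i := by
  induction i with
  | zero => simp
  | succ i ih => rw [parseEnd_succ]; omega

theorem parseEnd_numWords (N : ℕ) (y x : ℕ → A) : parseEnd N y x (numWords N y x) = N :=
  Nat.sInf_mem (s := {i : ℕ | parseEnd N y x i = N})
    ⟨N, le_antisymm (parseEnd_le N y x N) (by simpa using min_le_parseEnd N y x N)⟩

theorem parseEnd_lt {N : ℕ} {y x : ℕ → A} {i : ℕ} (h : i < numWords N y x) :
    parseEnd N y x i < N :=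
  lt_of_le_of_ne (parseEnd_le N y x i) fun he => Nat.notMem_of_lt_sInf h he

theorem numWords_le (N : ℕ) (y x : ℕ → A) : numWords N y x ≤ N :=
  Nat.sInf_le (le_antisymm (parseEnd_le N y x N) (by simpa using min_le_parseEnd N y x N))

theorem one_le_numWords {N : ℕ} (hN : 1 ≤ N) (y x : ℕ → A) : 1 ≤ numWords N y x := by
  by_contra! h
  have h1 := parseEnd_numWords N y x
  rw [Nat.lt_one_iff.1 h] at h1
  simp only [parseEnd] at h1
  omega

/-- The sequences whose prefix of length `M` is the concatenation of at most `c` nonempty words,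
each of which, deprived of its last two letters, is a prefix of an element of `O`. -/
def parsable (O : ℕ → Set (ℕ → A)) : ℕ → ℕ → Set (ℕ → A)
  | 0, M => {_y | M = 0}
  | c + 1, M => {_y | M = 0} ∪
      ⋃ l ∈ Finset.Icc 1 M, (O (l - 2) ∩ shift^[l] ⁻¹' parsable O c (M - l))

theorem parsable_mono_succ (O : ℕ → Set (ℕ → A)) (c M : ℕ) :
    parsable O c M ⊆ parsable O (c + 1) M := by
  induction c generalizing M with
  | zero => exact Set.subset_union_left
  | succ c ih =>
    refine Set.union_subset_union_right _ (Set.iUnion₂_mono fun l _ => ?_)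
    exact Set.inter_subset_inter_right _ (Set.preimage_mono (ih (M - l)))

theorem parsable_mono (O : ℕ → Set (ℕ → A)) {c c' : ℕ} (h : c ≤ c') (M : ℕ) :
    parsable O c M ⊆ parsable O c' M :=
  monotone_nat_of_le_succ (f := fun c => parsable O c M) (fun c => parsable_mono_succ O c M) h

theorem mem_parsable_of_parseEnd {N : ℕ} {y x : ℕ → A} (i : ℕ) :
    ∀ j, parseEnd N y x (j + i) = N → shift^[parseEnd N y x j] y ∈
      parsable (fun n => occ N n x) i (N - parseEnd N y x j) := by
  induction i with
  | zero =>
    intro j hj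
    rw [add_zero] at hj
    simp [parsable, hj]
  | succ i ih =>
    intro j hj
    have hle := parseEnd_le N y x j
    rcases hle.eq_or_lt with h | h
    · left; simp [h]
    · right
      have h1 := ih (j + 1) (by rw [← hj]; congr 1; omega)
      have h2 := parseEnd_lt_succ h
      have h3 := parseEnd_le N y x (j + 1)
      set l := parseEnd N y x (j + 1) - parseEnd N y x j with hl
      refine Set.mem_biUnion (x := l) (by simp; omega) ⟨?_, ?_⟩
      -- The last word may be cut at `N`, so its length is only at most the match length plus one;
      -- prefixes of occurring words still occur.
      · refine occ_anti ?_ x (mem_occ_matchLength_sub_one N _ x)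
        have := parseEnd_succ N y x j
        omega
      · rw [Set.mem_preimage, ← Function.iterate_add_apply,
          show l + parseEnd N y x j = parseEnd N y x (j + 1) by omega,
          show N - parseEnd N y x j - l = N - parseEnd N y x (j + 1) by omega]
        exact h1

theorem mem_parsable_numWords (N : ℕ) (y x : ℕ → A) :
    y ∈ parsable (fun n => occ N n x) (numWords N y x) N := by
  have := mem_parsable_of_parseEnd (numWords N y x) 0
    (by rw [zero_add]; exact parseEnd_numWords N y x)
  simpa [parseEnd] using this

end Parsing

/-! ### Finite dependence and measurability of the estimator -/

section LocalDependence

variable {A : Type*}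

theorem mem_occ_congr {N n : ℕ} {x x' y y' : ℕ → A} (hx : ∀ i < N, x i = x' i)
    (hy : ∀ i < N, y i = y' i) : y ∈ occ N n x ↔ y' ∈ occ N n x' := by
  refine exists_congr fun r => and_congr_right fun hr => forall₂_congr fun j hj => ?_
  rw [hx _ (by omega), hy _ (by omega)]

theorem matchLength_congr {N : ℕ} {x x' y y' : ℕ → A} (hx : ∀ i < N, x i = x' i)
    (hy : ∀ i < N, y i = y' i) : matchLength N y x = matchLength N y' x' := by
  simp only [matchLength_eq, mem_occ_congr hx hy]

/-- A match starts at a position at most `N` and inspects at most `N` further letters of `y`, whence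
the window `2 * N`. -/
theorem parseEnd_congr {N : ℕ} {x x' y y' : ℕ → A} (hx : ∀ i < N, x i = x' i)
    (hy : ∀ i < 2 * N, y i = y' i) (i : ℕ) : parseEnd N y x i = parseEnd N y' x' i := by
  induction i with
  | zero => rfl
  | succ i ih =>
    rw [parseEnd_succ, parseEnd_succ, ih]
    congr 3
    refine matchLength_congr hx fun i' hi' => ?_
    rw [shift_iterate_apply, shift_iterate_apply]
    have := parseEnd_le N y' x' i
    exact hy _ (by omega)

theorem numWords_congr {N : ℕ} {x x' y y' : ℕ → A} (hx : ∀ i < N, x i = x' i)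
    (hy : ∀ i < 2 * N, y i = y' i) : numWords N y x = numWords N y' x' := by
  simp only [numWords, parseEnd_congr hx hy]

variable [Fintype A] [MeasurableSpace A] [MeasurableSingletonClass A]

theorem measurable_of_local {β : Type*} [MeasurableSpace β] {f : (ℕ → A) × (ℕ → A) → β} (n : ℕ)
    (hf : ∀ z z', pre n z.1 = pre n z'.1 → pre n z.2 = pre n z'.2 → f z = f z') :
    Measurable f := by
  let g : (ℕ → A) × (ℕ → A) → (Fin n → A) × (Fin n → A) := fun z => (pre n z.1, pre n z.2)
  have hg : Measurable g := ((measurable_pre n).comp measurable_fst).prodMk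
    ((measurable_pre n).comp measurable_snd)
  intro s _
  have : f ⁻¹' s = g ⁻¹' (g '' (f ⁻¹' s)) := by
    refine Set.Subset.antisymm (Set.subset_preimage_image _ _) ?_
    rintro z ⟨z', hz', he⟩
    have he' := Prod.ext_iff.1 he
    rw [Set.mem_preimage, ← hf z' z he'.1 he'.2]
    exact hz'
  rw [this]
  exact hg (Set.toFinite _).measurableSet

theorem measurable_numWords (N : ℕ) :
    Measurable fun z : (ℕ → A) × (ℕ → A) => numWords N z.2 z.1 :=
  measurable_of_local (2 * N) fun _ _ h1 h2 =>
    numWords_congr (fun i hi => pre_eq_iff.1 h1 i (by omega)) (pre_eq_iff.1 h2)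

theorem measurable_mZM (N : ℕ) : Measurable fun z : (ℕ → A) × (ℕ → A) => mZM N z.2 z.1 := by
  have : Measurable fun c : ℕ => open Classical in if c = N then (⊤ : EReal)
    else (((c : ℝ) * Real.log N / ((N : ℝ) - c) : ℝ) : EReal) := measurable_from_top
  exact this.comp (measurable_numWords N)

end LocalDependence

/-! ### Lower bound on the number of words -/

section LowerBound

variable {A : Type*} [MeasurableSpace A] [Fintype A] [MeasurableSingletonClass A]
  {P Q : Measure (ℕ → A)}

theorem measurableSet_occ (N n : ℕ) (x : ℕ → A) : MeasurableSet (occ N n x) := by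
  rw [occ_eq_preimage]; exact measurableSet_pre_preimage _

theorem measurableSet_occ_prod (N n : ℕ) :
    MeasurableSet {z : (ℕ → A) × (ℕ → A) | z.2 ∈ occ N n z.1} := by
  have : Measurable fun z : (ℕ → A) × (ℕ → A) => z.2 ∈ occ N n z.1 :=
    measurable_of_local (N + n) fun z z' h1 h2 => by
      rw [pre_eq_iff] at h1 h2
      refine propext (exists_congr fun r => and_congr_right fun hr => forall₂_congr fun j hj => ?_)
      rw [h1 _ (by omega), h2 _ (by omega)]
  exact measurableSet_setOfPred.2 this

/-- The union bound and the trivial bound give `min 1 u` with `u = (N + 1) * pr P n y`, and `min 1 u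
≤ u ^ s` for `0 ≤ s ≤ 1`. This interpolation is what brings in moments of order `s`. -/
theorem measure_setOf_mem_occ_le [IsProbabilityMeasure P] (hP : MeasurePreserving shift P P)
    (N n : ℕ) (y : ℕ → A) {s : ℝ} (hs : 0 ≤ s) (hs1 : s ≤ 1) :
    P.real {x | y ∈ occ N n x} ≤ ((N : ℝ) + 1) ^ s * pr P n y ^ s := by
  have h1 : P.real {x | y ∈ occ N n x} ≤ ((N : ℝ) + 1) * pr P n y := by
    have hsub : {x | y ∈ occ N n x} ⊆
        ⋃ r ∈ Finset.range (N + 1), shift^[r] ⁻¹' cyl (pre n y) := by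
      rintro x ⟨r, hr, hx⟩
      refine Set.mem_biUnion (x := r) (by simp; omega) ?_
      rw [Set.mem_preimage, mem_cyl_pre]
      intro i hi
      rw [shift_iterate_apply, add_comm]
      exact hx i hi
    refine (measureReal_mono hsub (measure_ne_top _ _)).trans
      ((measureReal_biUnion_finset_le _ _).trans (le_of_eq ?_))
    simp [measureReal_shift_iterate hP _ (measurableSet_cyl _), pr]
  have h2 : P.real {x | y ∈ occ N n x} ≤ 1 := measureReal_le_one
  rw [← Real.mul_rpow (by positivity) (pr_nonneg n y)]
  rcases le_total 1 (((N : ℝ) + 1) * pr P n y) with h | h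
  · exact h2.trans (Real.one_le_rpow h hs)
  · refine h1.trans ?_
    have := pr_nonneg (P := P) n y
    have h0 : 0 ≤ ((N : ℝ) + 1) * pr P n y := by positivity
    rcases h0.eq_or_lt with h00 | h00
    · rw [← h00]; exact Real.rpow_nonneg le_rfl _
    · calc ((N : ℝ) + 1) * pr P n y = (((N : ℝ) + 1) * pr P n y) ^ (1 : ℝ) := (Real.rpow_one _).symm
        _ ≤ _ := Real.rpow_le_rpow_of_exponent_ge h00 h hs1

/-- Tonelli: the mean over `x` of the mass of the occurring words is the mean over `y` of the
probability that the prefix of `y` occurs. -/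
theorem lintegral_measure_occ_le [IsProbabilityMeasure P] [IsProbabilityMeasure Q]
    (hP : MeasurePreserving shift P P) (N n : ℕ) {s : ℝ} (hs : 0 ≤ s) (hs1 : s ≤ 1) :
    ∫⁻ x, Q (occ N n x) ∂P ≤ ENNReal.ofReal (((N : ℝ) + 1) ^ s * moment P Q n s) := by
  have hm := measurableSet_occ_prod (A := A) N n
  have h1 := Measure.prod_apply (μ := P) (ν := Q) hm
  have h2 := Measure.prod_apply_symm (μ := P) (ν := Q) hm
  rw [h1] at h2
  refine (le_of_eq h2).trans ?_
  rw [moment, ← integral_const_mul, ofReal_integral_eq_lintegral_ofReal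
    ((integrable_pr_rpow n s).const_mul _) (ae_of_all _ fun y =>
      mul_nonneg (by positivity) (Real.rpow_nonneg (pr_nonneg n y) s))]
  refine lintegral_mono fun y => ?_
  rw [← ENNReal.ofReal_toReal (measure_ne_top P _)]
  exact ENNReal.ofReal_le_ofReal (measure_setOf_mem_occ_le hP N n y hs hs1)

/-- Almost surely, the total `Q`-probability of the words of length `n` that occur in `x_1 … x_N`
is essentially bounded by `N^s` times the moment of order `s`. -/
theorem ae_exists_measure_occ_le [IsProbabilityMeasure P] [IsProbabilityMeasure Q]
    (hP : MeasurePreserving shift P P) {s : ℝ} (hs : 0 ≤ s) (hs1 : s ≤ 1) {C₀ γ : ℝ}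
    (hC₀ : 0 ≤ C₀) (hmom : ∀ n : ℕ, moment P Q n s ≤ C₀ * Real.exp (-γ * n)) {ε : ℝ}
    (hε : 0 < ε) :
    ∀ᵐ x ∂P, ∃ C : ℝ, 0 ≤ C ∧ ∀ N n : ℕ, 1 ≤ N →
      Q.real (occ N n x) ≤ C * (N : ℝ) ^ (s + ε) * Real.exp (-(γ - ε) * n) := by
  -- With these weights the sum over dyadic lengths `2 ^ j` and all `n` has finite expectation, by
  -- two geometric series of ratios `2 ^ (-ε)` and `exp (-ε)`. Its almost surely finite value bounds
  -- every term at once; other values of `N` are rounded up to a power of two.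
  let w : ℕ × ℕ → ℝ := fun p => ((2 : ℝ) ^ p.1) ^ (-(s + ε)) * Real.exp ((γ - ε) * p.2)
  have hw : ∀ p, 0 < w p := fun p => by positivity
  let Φ : (ℕ → A) → ENNReal := fun x =>
    ∑' p : ℕ × ℕ, ENNReal.ofReal (w p) * Q (occ (2 ^ p.1) p.2 x)
  have hmeas : ∀ N n, Measurable fun x => Q (occ N n x) := fun N n =>
    measurable_measure_prodMk_left (measurableSet_occ_prod (A := A) N n)
  have hΦm : ∀ p : ℕ × ℕ, Measurable fun x => ENNReal.ofReal (w p) * Q (occ (2 ^ p.1) p.2 x) :=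
    fun p => (hmeas _ _).const_mul _
  have hterm : ∀ p : ℕ × ℕ, ∫⁻ x, ENNReal.ofReal (w p) * Q (occ (2 ^ p.1) p.2 x) ∂P ≤
      ENNReal.ofReal (2 * C₀ * (((2 : ℝ) ^ (-ε)) ^ p.1 * Real.exp (-ε) ^ p.2)) := by
    rintro ⟨j, n⟩
    rw [lintegral_const_mul _ (hmeas _ _)]
    refine (mul_le_mul_right (lintegral_measure_occ_le hP _ _ hs hs1) _).trans ?_
    rw [← ENNReal.ofReal_mul (hw _).le]
    refine ENNReal.ofReal_le_ofReal ?_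
    have h2 : (0 : ℝ) < 2 ^ j := by positivity
    have h21 : (1 : ℝ) ≤ 2 ^ j := one_le_pow₀ (by norm_num)
    have h3 : ((((2 ^ j : ℕ) : ℝ)) + 1) ^ s ≤ 2 * ((2 : ℝ) ^ j) ^ s := by
      have h4 : ((((2 ^ j : ℕ) : ℝ)) + 1) ≤ 2 * 2 ^ j := by push_cast; linarith
      refine (Real.rpow_le_rpow (by positivity) h4 hs).trans ?_
      rw [Real.mul_rpow (by norm_num) h2.le]
      gcongr
      exact (Real.rpow_le_rpow_of_exponent_le (by norm_num) hs1).trans (le_of_eq (Real.rpow_one _))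
    calc w (j, n) * ((((2 ^ j : ℕ) : ℝ) + 1) ^ s * moment P Q n s)
        ≤ w (j, n) * ((2 * ((2 : ℝ) ^ j) ^ s) * (C₀ * Real.exp (-γ * n))) := by
          have := hmom n
          have := moment_nonneg (P := P) (Q := Q) n s
          have := hw (j, n)
          gcongr
      _ = 2 * C₀ * ((((2 : ℝ) ^ j) ^ (-(s + ε)) * ((2 : ℝ) ^ j) ^ s) *
            (Real.exp ((γ - ε) * n) * Real.exp (-γ * n))) := by simp only [w]; ring
      _ = 2 * C₀ * (((2 : ℝ) ^ (-ε)) ^ j * Real.exp (-ε) ^ n) := by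
          rw [← Real.rpow_add h2, ← Real.exp_add, ← Real.exp_nat_mul]
          congr 2
          · rw [← Real.rpow_natCast, ← Real.rpow_natCast, ← Real.rpow_mul (by norm_num),
              ← Real.rpow_mul (by norm_num)]
            congr 1; ring
          · congr 1; ring
  have hfin : ∫⁻ x, Φ x ∂P ≠ ⊤ := by
    rw [lintegral_tsum fun p => (hΦm p).aemeasurable]
    have hsum : Summable fun p : ℕ × ℕ =>
        2 * C₀ * (((2 : ℝ) ^ (-ε)) ^ p.1 * Real.exp (-ε) ^ p.2) := by
      refine Summable.mul_left _ (Summable.mul_of_nonneg (f := fun j : ℕ => ((2 : ℝ) ^ (-ε)) ^ j)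
        (g := fun n : ℕ => Real.exp (-ε) ^ n) ?_ ?_ (fun _ => by positivity) fun _ => by positivity)
      · exact summable_geometric_of_lt_one (by positivity)
          (Real.rpow_lt_one_of_one_lt_of_neg (by norm_num) (by linarith))
      · exact summable_geometric_of_lt_one (by positivity) (Real.exp_lt_one_iff.2 (by linarith))
    refine ne_top_of_le_ne_top ?_ (ENNReal.tsum_le_tsum hterm)
    rw [← ENNReal.ofReal_tsum_of_nonneg (fun p => by positivity) hsum]
    exact ENNReal.ofReal_ne_top
  have hΦmeas : Measurable Φ := Measurable.tsum hΦm
  filter_upwards [ae_lt_top hΦmeas hfin] with x hx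
  have key : ∀ j n : ℕ, Q.real (occ (2 ^ j) n x) ≤
      (Φ x).toReal * ((2 : ℝ) ^ j) ^ (s + ε) * Real.exp (-(γ - ε) * n) := by
    intro j n
    have h1 : ENNReal.ofReal (w (j, n)) * Q (occ (2 ^ j) n x) ≤ Φ x :=
      ENNReal.le_tsum (f := fun p : ℕ × ℕ => ENNReal.ofReal (w p) * Q (occ (2 ^ p.1) p.2 x)) (j, n)
    have h2 := ENNReal.toReal_mono hx.ne h1
    rw [ENNReal.toReal_mul, ENNReal.toReal_ofReal (hw _).le] at h2
    have h3 : w (j, n) * (((2 : ℝ) ^ j) ^ (s + ε) * Real.exp (-(γ - ε) * n)) = 1 := by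
      simp only [w]
      rw [mul_mul_mul_comm, ← Real.rpow_add (by positivity), ← Real.exp_add]
      simp; ring
    calc Q.real (occ (2 ^ j) n x)
        = (w (j, n) * Q.real (occ (2 ^ j) n x)) *
            (((2 : ℝ) ^ j) ^ (s + ε) * Real.exp (-(γ - ε) * n)) := by
          rw [mul_right_comm, h3, one_mul]
      _ ≤ (Φ x).toReal * (((2 : ℝ) ^ j) ^ (s + ε) * Real.exp (-(γ - ε) * n)) := by
          gcongr
          exact h2
      _ = _ := by ring
  refine ⟨(Φ x).toReal * 2 ^ (s + ε), by positivity, fun N n hN => ?_⟩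
  set j := Nat.log 2 N + 1
  have hj1 : N ≤ 2 ^ j := (Nat.lt_pow_succ_log_self (by norm_num) N).le
  have hj2 : (2 : ℝ) ^ j ≤ 2 * N := by
    have : 2 ^ Nat.log 2 N ≤ N := Nat.pow_log_le_self 2 (by omega)
    have h' : ((2 : ℝ) ^ Nat.log 2 N) ≤ N := by exact_mod_cast this
    rw [pow_succ]; linarith
  refine ((measureReal_mono (occ_mono hj1 n x)).trans (key j n)).trans ?_
  rw [mul_assoc (Φ x).toReal (2 ^ (s + ε)), ← Real.mul_rpow (by norm_num) (by positivity)]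
  gcongr

/-- A gap of sublinear length can be accommodated in every long word. -/
theorem exists_gap {k : ℕ → ℝ} {τ : ℕ → ℕ} (hk : k =o[atTop] fun n : ℕ => (n : ℝ))
    (hτ : (fun n => (τ n : ℝ)) =o[atTop] fun n : ℕ => (n : ℝ)) (a : ℝ) {η : ℝ} (hη : 0 < η)
    (hη1 : η ≤ 1) :
    ∃ l₀ : ℕ, ∀ l, l₀ ≤ l → ∃ n, 1 ≤ n ∧ n + τ n ≤ l ∧ n ≤ l - 2 ∧ (1 - η) * l ≤ n ∧
      k n + τ n * a ≤ η * l := by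
  have hkτ : (fun n => k n + τ n * a) =o[atTop] fun n : ℕ => (n : ℝ) := by
    refine hk.add ?_
    simpa [mul_comm] using hτ.const_mul_left a
  obtain ⟨M₁, hM₁⟩ := exists_forall_ge_le_mul hτ (show 0 < η / 2 by positivity)
  obtain ⟨M₂, hM₂⟩ := exists_forall_ge_le_mul hkτ hη
  obtain ⟨l₁, hl₁⟩ := exists_nat_ge (2 * ((M₁ : ℝ) + M₂ + 2) + 4 / η)
  refine ⟨l₁, fun l hl => ?_⟩
  have hl' : 2 * ((M₁ : ℝ) + M₂ + 2) + 4 / η ≤ l := hl₁.trans (by exact_mod_cast hl)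
  have h4 : 0 < 4 / η := by positivity
  have hηl : 4 ≤ η * l := by
    have : 4 / η ≤ l := by
      have : (0 : ℝ) ≤ 2 * ((M₁ : ℝ) + M₂ + 2) := by positivity
      linarith
    rw [div_le_iff₀ hη] at this
    linarith
  have hl0 : (0 : ℝ) ≤ l := l.cast_nonneg
  have hpos : 0 ≤ (1 - η / 2) * l := mul_nonneg (by linarith) hl0
  -- The remaining `η l / 2` letters leave room for the gap, at most `η n / 2` long, and, since `η l
  -- ≥ 4`, for the two dropped letters.
  set n := ⌊(1 - η / 2) * l⌋₊ with hn
  have hn1 : (n : ℝ) ≤ (1 - η / 2) * l := Nat.floor_le hpos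
  have hn2 : (1 - η / 2) * l < n + 1 := Nat.lt_floor_add_one _
  have hn3 : (M₁ : ℝ) + M₂ + 1 ≤ n := by nlinarith
  have hn3' : M₁ + M₂ + 1 ≤ n := by exact_mod_cast hn3
  have hτn := hM₁ n (by omega)
  have hkn := hM₂ n (by omega)
  have hnl : (n : ℝ) ≤ l := by nlinarith
  refine ⟨n, by omega, ?_, ?_, by linarith, hkn.trans (by gcongr)⟩
  · have : (n : ℝ) + τ n ≤ l := by nlinarith
    exact_mod_cast this
  · have : (n : ℝ) + 2 ≤ l := by linarith
    have : n + 2 ≤ l := by exact_mod_cast this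
    omega

/-- Only about the first `(1 - η) l` letters of a block of length `l` are used; the rest
accommodates the decoupling gap and the two dropped letters. The rate drops by a multiple of `η`,
and blocks too short for this are absorbed in `C₁`. -/
theorem IsUDWith.measure_occ_inter_le [IsProbabilityMeasure Q] {k : ℕ → ℝ} {τ : ℕ → ℕ}
    (hQ : MeasurePreserving shift Q Q) (h : IsUDWith Q k τ) {γ η : ℝ} (hγ : 0 ≤ γ) (hη : 0 < η)
    (hη1 : η ≤ 1) :
    ∃ C₁ : ℝ, 1 ≤ C₁ ∧ ∀ (N : ℕ) (x : ℕ → A) (B : ℝ), 1 ≤ B →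
      (∀ n : ℕ, Q.real (occ N n x) ≤ B * Real.exp (-γ * n)) →
      ∀ l : ℕ, ∀ H : Set (ℕ → A), MeasurableSet H → Q.real (occ N (l - 2) x ∩ shift^[l] ⁻¹' H) ≤
        C₁ * B * Real.exp (-(γ - (γ + 1) * η) * l) * Q.real H := by
  obtain ⟨l₀, hl₀⟩ := exists_gap h.k_little h.tau_little (Real.log (Fintype.card A)) hη hη1
  have hA : (0 : ℝ) < Fintype.card A := by exact_mod_cast card_pos (Q := Q)
  refine ⟨Real.exp (γ * l₀), Real.one_le_exp (by positivity), fun N x B hB hocc l H hH => ?_⟩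
  have hexp1 : 1 ≤ Real.exp (γ * l₀) := Real.one_le_exp (by positivity)
  rcases lt_or_ge l l₀ with hl | hl
  · have h1 : Q.real (occ N (l - 2) x ∩ shift^[l] ⁻¹' H) ≤ Q.real H := by
      rw [← measureReal_shift_iterate hQ l hH]
      exact measureReal_mono Set.inter_subset_right
    refine h1.trans (le_mul_of_one_le_left measureReal_nonneg ?_)
    have h2 : 1 ≤ Real.exp (γ * l₀) * Real.exp (-(γ - (γ + 1) * η) * l) := by
      rw [← Real.exp_add]
      refine Real.one_le_exp ?_
      have : (l : ℝ) ≤ l₀ := by exact_mod_cast hl.le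
      have h3 : γ * l ≤ γ * l₀ := by gcongr
      have h4 : 0 ≤ (γ + 1) * η * l := by positivity
      linarith
    nlinarith [Real.exp_pos (γ * l₀), Real.exp_pos (-(γ - (γ + 1) * η) * l)]
  · obtain ⟨n, hn1, hn2, hn3, hn4, hn5⟩ := hl₀ l hl
    have hH' : MeasurableSet (shift^[l - (n + τ n)] ⁻¹' H) := measurable_shift_iterate _ hH
    have hsub : occ N (l - 2) x ∩ shift^[l] ⁻¹' H ⊆
        occ N n x ∩ shift^[n + τ n] ⁻¹' (shift^[l - (n + τ n)] ⁻¹' H) := by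
      refine Set.inter_subset_inter (occ_anti hn3 x) (le_of_eq ?_)
      rw [← Set.preimage_comp, ← Function.iterate_add, Nat.sub_add_cancel hn2]
    have h1 := h.measure_pre_inter_le hQ hn1 {a | ∃ r, r + n ≤ N ∧ pre n (shift^[r] x) = a} hH'
    rw [← occ_eq_preimage, measureReal_shift_iterate hQ _ hH] at h1
    refine (measureReal_mono hsub).trans (h1.trans ?_)
    refine mul_le_mul_of_nonneg_right ?_ measureReal_nonneg
    have e : (Fintype.card A : ℝ) ^ τ n = Real.exp (τ n * Real.log (Fintype.card A)) := by
      rw [Real.exp_nat_mul, Real.exp_log hA]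
    rw [e, ← Real.exp_add]
    calc Real.exp (k n + τ n * Real.log (Fintype.card A)) * Q.real (occ N n x)
        ≤ Real.exp (η * l) * (B * Real.exp (-γ * ((1 - η) * l))) := by
          refine mul_le_mul (Real.exp_le_exp.2 hn5) ((hocc n).trans ?_) measureReal_nonneg
            (Real.exp_pos _).le
          refine mul_le_mul_of_nonneg_left (Real.exp_le_exp.2 ?_) (by linarith)
          nlinarith
      _ = 1 * B * Real.exp (-(γ - (γ + 1) * η) * l) := by
          rw [mul_left_comm, ← Real.exp_add, one_mul]
          congr 2; ring
      _ ≤ _ := by gcongr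

theorem sum_exp_neg_le {ε : ℝ} (hε : 0 < ε) (M : ℕ) :
    ∑ l ∈ Finset.Icc 1 M, Real.exp (-ε * l) ≤ (1 - Real.exp (-ε))⁻¹ := by
  have h1 : Real.exp (-ε) < 1 := Real.exp_lt_one_iff.2 (by linarith)
  rw [← tsum_geometric_of_lt_one (Real.exp_pos _).le h1]
  have e : ∀ l : ℕ, Real.exp (-ε * l) = Real.exp (-ε) ^ l := fun l => by
    rw [← Real.exp_nat_mul, mul_comm]
  simp only [e]
  exact (summable_geometric_of_lt_one (Real.exp_pos _).le h1).sum_le_tsum _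
    fun _ _ => by positivity

theorem measurableSet_parsable {O : ℕ → Set (ℕ → A)} (hO : ∀ n, MeasurableSet (O n)) (c M : ℕ) :
    MeasurableSet (parsable O c M) := by
  induction c generalizing M with
  | zero => exact MeasurableSet.const _
  | succ c ih =>
    refine (MeasurableSet.const _).union (Finset.measurableSet_biUnion _ fun l _ => ?_)
    exact (hO _).inter (measurable_shift_iterate l (ih _))

/-- Peel off the first word and sum over its length. Giving up `ε` in the rate makes this sum a
convergent geometric series, so each word costs one factor whatever its length, while the total
length keeps the rate `γ - ε`. -/
theorem measure_parsable_le [IsProbabilityMeasure Q] {O : ℕ → Set (ℕ → A)}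
    (hO : ∀ n, MeasurableSet (O n)) {b γ ε : ℝ} (hb : 0 ≤ b) (hε : 0 < ε)
    (h : ∀ l : ℕ, ∀ H : Set (ℕ → A), MeasurableSet H →
      Q.real (O (l - 2) ∩ shift^[l] ⁻¹' H) ≤ b * Real.exp (-γ * l) * Q.real H) (c M : ℕ) :
    Q.real (parsable O c M) ≤
      (1 + b * (1 - Real.exp (-ε))⁻¹) ^ c * Real.exp (-(γ - ε) * M) := by
  set K := (1 - Real.exp (-ε))⁻¹ with hK
  have hK0 : 0 ≤ K := inv_nonneg.2 (sub_nonneg.2 (Real.exp_le_one_iff.2 (by linarith)))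
  have hB1 : 1 ≤ 1 + b * K := by nlinarith
  have hzero : ∀ c : ℕ, Q.real (parsable O c 0) ≤
      (1 + b * K) ^ c * Real.exp (-(γ - ε) * (0 : ℕ)) := by
    intro c
    simp only [Nat.cast_zero, mul_zero, Real.exp_zero, mul_one]
    exact measureReal_le_one.trans (one_le_pow₀ hB1)
  induction c generalizing M with
  | zero =>
    rcases Nat.eq_zero_or_pos M with rfl | hM
    · exact hzero 0
    · have : parsable O 0 M = ∅ := by
        ext y; simp [parsable]; omega
      rw [this]; simp; positivity
  | succ c ih =>
    rcases Nat.eq_zero_or_pos M with rfl | hM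
    · exact hzero _
    · have e : parsable O (c + 1) M =
          ⋃ l ∈ Finset.Icc 1 M, (O (l - 2) ∩ shift^[l] ⁻¹' parsable O c (M - l)) := by
        have : {_y : ℕ → A | M = 0} = ∅ := by ext y; simp; omega
        rw [parsable, this, Set.empty_union]
      rw [e]
      calc _ ≤ ∑ l ∈ Finset.Icc 1 M, Q.real (O (l - 2) ∩ shift^[l] ⁻¹' parsable O c (M - l)) :=
            measureReal_biUnion_finset_le _ _
        _ ≤ ∑ l ∈ Finset.Icc 1 M, (b * (1 + b * K) ^ c * Real.exp (-(γ - ε) * M)) *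
              Real.exp (-ε * l) := by
            refine Finset.sum_le_sum fun l hl => ?_
            refine (h l _ (measurableSet_parsable hO _ _)).trans ?_
            refine (mul_le_mul_of_nonneg_left (ih (M - l)) (by positivity)).trans (le_of_eq ?_)
            have hl' : l ≤ M := (Finset.mem_Icc.1 hl).2
            rw [Nat.cast_sub hl']
            have : Real.exp (-γ * l) * Real.exp (-(γ - ε) * ((M : ℝ) - l)) =
                Real.exp (-(γ - ε) * M) * Real.exp (-ε * l) := by
              rw [← Real.exp_add, ← Real.exp_add]; congr 1; ring
            linear_combination b * (1 + b * K) ^ c * this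
        _ ≤ (b * (1 + b * K) ^ c * Real.exp (-(γ - ε) * M)) * K := by
            rw [← Finset.mul_sum]
            gcongr
            exact sum_exp_neg_le hε M
        _ ≤ _ := by
            rw [pow_succ]
            have : 0 ≤ (1 + b * K) ^ c * Real.exp (-(γ - ε) * M) := by positivity
            linarith

/-- If `B` grows at most like `N^σ`, then `B^(d N / ln N)` is essentially at most `e^(σ d N)`. -/
theorem eventually_rpow_le {K σ d ε : ℝ} (hK : 1 ≤ K) (hε : 0 < ε) :
    ∀ᶠ N : ℕ in atTop, (K * (N : ℝ) ^ σ) ^ (d * N / Real.log N) ≤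
      Real.exp ((σ * d + ε) * N) := by
  have hlog : Tendsto (fun N : ℕ => Real.log N) atTop atTop :=
    Real.tendsto_log_atTop.comp tendsto_natCast_atTop_atTop
  filter_upwards [eventually_ge_atTop 2, hlog.eventually_ge_atTop (d * Real.log K / ε),
    hlog.eventually_ge_atTop 1] with N hN h1 h2
  have hN0 : (0 : ℝ) < N := by exact_mod_cast (by omega : 0 < N)
  have hlog0 : 0 < Real.log N := by linarith
  rw [div_le_iff₀ hε] at h1
  rw [Real.rpow_def_of_pos (by positivity), Real.log_mul (by positivity) (by positivity),
    Real.log_rpow hN0, Real.exp_le_exp]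
  have e : (Real.log K + σ * Real.log N) * (d * N / Real.log N) =
      (d * Real.log K / Real.log N + σ * d) * N := by field_simp
  rw [e]
  have : d * Real.log K / Real.log N ≤ ε := (div_le_iff₀ hlog0).2 (by linarith)
  exact mul_le_mul_of_nonneg_right (by linarith) hN0.le

/-- If `Q` is upper decoupled and the moment of order `s` decays at a rate larger than `s d`, then
the number of words in the parsing is asymptotically at least `d N / ln N`. -/
theorem ae_ae_eventually_le_numWords [IsProbabilityMeasure P] [IsProbabilityMeasure Q]
    (hP : MeasurePreserving shift P P) (hQ : MeasurePreserving shift Q Q) {k : ℕ → ℝ} {τ : ℕ → ℕ}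
    (h : IsUDWith Q k τ) {s d γ : ℝ} (hs : 0 ≤ s) (hs1 : s ≤ 1) (hd : 0 ≤ d) (hγ : s * d < γ)
    (hmom : ∀ᶠ n : ℕ in atTop, moment P Q n s ≤ Real.exp (-γ * n)) :
    ∀ᵐ x ∂P, ∀ᵐ y ∂Q, ∀ᶠ N : ℕ in atTop, d * N ≤ numWords N y x * Real.log N := by
  have hγ0 : 0 < γ := lt_of_le_of_lt (by positivity) hγ
  obtain ⟨n₀, hn₀⟩ := eventually_atTop.1 hmom
  have hmom' : ∀ n : ℕ, moment P Q n s ≤ Real.exp (γ * n₀) * Real.exp (-γ * n) := by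
    intro n
    rw [← Real.exp_add]
    rcases le_or_gt n₀ n with hn | hn
    · refine (hn₀ n hn).trans (Real.exp_le_exp.2 ?_)
      have : 0 ≤ γ * n₀ := by positivity
      linarith
    · refine (moment_le_one n hs).trans (Real.one_le_exp ?_)
      have : (n : ℝ) ≤ n₀ := by exact_mod_cast hn.le
      nlinarith
  -- The denominator is so large that all the losses below, multiples of `ε` by at most `γ + d + 4`
  -- in total, leave a decay rate of at least `ε` in `hdecay`.
  set ε : ℝ := (γ - s * d) / (2 * (γ + d + 5)) with hε
  have hden : 0 < 2 * (γ + d + 5) := by positivity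
  have hε0 : 0 < ε := div_pos (by linarith) hden
  have hsd : 0 ≤ s * d := by positivity
  have hεγ : ε * (2 * (γ + d + 5)) = γ - s * d := div_mul_cancel₀ _ hden.ne'
  have hε1 : ε ≤ 1 := by rw [hε, div_le_one hden]; linarith
  have hεγ' : ε ≤ γ := by nlinarith
  obtain ⟨C₁, hC₁, hblock⟩ := h.measure_occ_inter_le hQ (γ := γ - ε) (sub_nonneg.2 hεγ') hε0 hε1
  filter_upwards [ae_exists_measure_occ_le (Q := Q) hP hs hs1 (Real.exp_pos _).le hmom' hε0]
    with x hx
  obtain ⟨C, hC, hocc⟩ := hx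
  set K₀ := (1 - Real.exp (-ε))⁻¹ with hK₀
  have hK₀0 : 0 ≤ K₀ := inv_nonneg.2 (sub_nonneg.2 (Real.exp_le_one_iff.2 (by linarith)))
  set K : ℝ := 1 + C₁ * (1 + C) * K₀ with hK
  have hK1 : 1 ≤ K := by
    have : 0 ≤ C₁ * (1 + C) * K₀ := by positivity
    linarith
  set γ' : ℝ := γ - ε - (γ - ε + 1) * ε - ε with hγ'
  have hpars : ∀ N c : ℕ, 1 ≤ N → Q.real (parsable (fun n => occ N n x) c N) ≤
      (K * (N : ℝ) ^ (s + ε)) ^ c * Real.exp (-γ' * N) := by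
    intro N c hN
    have hN1 : (1 : ℝ) ≤ N := by exact_mod_cast hN
    have hNp : 1 ≤ (N : ℝ) ^ (s + ε) := Real.one_le_rpow hN1 (by positivity)
    have h1 := measure_parsable_le (Q := Q) (fun n => measurableSet_occ N n x)
      (b := C₁ * ((1 + C) * (N : ℝ) ^ (s + ε))) (by positivity) hε0
      (hblock N x ((1 + C) * (N : ℝ) ^ (s + ε)) (by nlinarith) (fun n =>
        (hocc N n hN).trans (by gcongr; linarith))) c N
    refine h1.trans ?_
    gcongr
    rw [hK, add_mul, one_mul]
    linarith
  have hdecay : γ' - ((s + ε) * d + ε) ≥ ε := by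
    rw [hγ']
    nlinarith
  have hev := eventually_rpow_le (d := d) (σ := s + ε) hK1 hε0
  obtain ⟨N₀, hN₀⟩ := eventually_atTop.1 (hev.and (eventually_ge_atTop 2))
  let bad : ℕ → Set (ℕ → A) := fun N => {y | numWords N y x * Real.log N < d * N}
  have hbad : ∀ N, N₀ ≤ N → Q (bad N) ≤ ENNReal.ofReal (Real.exp (-ε) ^ N) := by
    intro N hN
    obtain ⟨h1, h2⟩ := hN₀ N hN
    have hN0 : (1 : ℝ) < N := by exact_mod_cast h2
    have hlog : 0 < Real.log N := Real.log_pos hN0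
    have hsub : bad N ⊆ parsable (fun n => occ N n x) ⌊d * N / Real.log N⌋₊ N := by
      intro y hy
      refine parsable_mono _ (Nat.le_floor ?_) N (mem_parsable_numWords N y x)
      rw [le_div_iff₀ hlog]
      exact le_of_lt hy
    refine (measure_mono hsub).trans ?_
    rw [← ENNReal.ofReal_toReal (measure_ne_top Q _)]
    refine ENNReal.ofReal_le_ofReal ((hpars N _ (by omega)).trans ?_)
    have hB : 1 ≤ K * (N : ℝ) ^ (s + ε) :=
      one_le_mul_of_one_le_of_one_le hK1 (Real.one_le_rpow hN0.le (by positivity))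
    have h3 : (K * (N : ℝ) ^ (s + ε)) ^ ⌊d * N / Real.log N⌋₊ ≤
        Real.exp (((s + ε) * d + ε) * N) := by
      rw [← Real.rpow_natCast]
      exact (Real.rpow_le_rpow_of_exponent_le hB (Nat.floor_le (by positivity))).trans h1
    calc _ ≤ Real.exp (((s + ε) * d + ε) * N) * Real.exp (-γ' * N) := by gcongr
      _ ≤ Real.exp (-ε) ^ N := by
        rw [← Real.exp_add, ← Real.exp_nat_mul, Real.exp_le_exp]
        have : (0 : ℝ) ≤ N := N.cast_nonneg
        nlinarith
  have hsum : ∑' N, Q (bad (N + N₀)) ≠ ⊤ := by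
    refine ne_top_of_le_ne_top ?_ (ENNReal.tsum_le_tsum fun N => hbad (N + N₀) (by omega))
    have : Summable fun N : ℕ => Real.exp (-ε) ^ (N + N₀) :=
      (summable_nat_add_iff N₀).2 (summable_geometric_of_lt_one (Real.exp_pos _).le
        (Real.exp_lt_one_iff.2 (by linarith)))
    rw [← ENNReal.ofReal_tsum_of_nonneg (fun _ => by positivity) this]
    exact ENNReal.ofReal_ne_top
  filter_upwards [ae_eventually_notMem hsum] with y hy
  obtain ⟨N₁, hN₁⟩ := eventually_atTop.1 hy
  refine eventually_atTop.2 ⟨N₁ + N₀, fun N hN => ?_⟩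
  have := hN₁ (N - N₀) (by omega)
  rw [Nat.sub_add_cancel (by omega)] at this
  exact not_lt.1 this

end LowerBound

/-! ### Slopes of the pressure under bounded decoupling -/

section BoundedDecoupling

variable {A : Type*} [MeasurableSpace A] [Fintype A] [MeasurableSingletonClass A]
  {P Q : Measure (ℕ → A)}

theorem IsUDWith.integral_mul_le [IsProbabilityMeasure Q] {k : ℕ → ℝ} {τ : ℕ → ℕ}
    (hQ : MeasurePreserving shift Q Q) (h : IsUDWith Q k τ) {n : ℕ} (hn : 1 ≤ n) (m : ℕ)
    {f : (Fin n → A) → ℝ} {g : (Fin m → A) → ℝ} (hf : ∀ a, 0 ≤ f a) (hg : ∀ b, 0 ≤ g b) :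
    ∫ y, f (pre n y) * g (pre m (shift^[n + τ n] y)) ∂Q ≤
      Real.exp (k n) * (Fintype.card A : ℝ) ^ τ n *
        ((∫ y, f (pre n y) ∂Q) * ∫ y, g (pre m y) ∂Q) := by
  let φ : (ℕ → A) → (Fin n → A) × (Fin m → A) := fun y => (pre n y, pre m (shift^[n + τ n] y))
  have hφ : Measurable φ :=
    (measurable_pre n).prodMk ((measurable_pre m).comp (measurable_shift_iterate _))
  have h1 : ∫ p, f p.1 * g p.2 ∂(Q.map φ) =
      ∫ y, f (pre n y) * g (pre m (shift^[n + τ n] y)) ∂Q :=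
    integral_map hφ.aemeasurable (measurable_of_finite _).aestronglyMeasurable
  rw [← h1, integral_fintype Integrable.of_finite, integral_comp_pre, integral_comp_pre,
    Finset.sum_mul_sum, Fintype.sum_prod_type, Finset.mul_sum]
  refine Finset.sum_le_sum fun a _ => ?_
  rw [Finset.mul_sum]
  refine Finset.sum_le_sum fun b _ => ?_
  rw [map_measureReal_apply hφ (measurableSet_singleton _), smul_eq_mul]
  have e : φ ⁻¹' {(a, b)} = cyl a ∩ shift^[n + τ n] ⁻¹' cyl b := by
    ext y
    simp only [φ, Set.mem_preimage, Set.mem_singleton_iff, Prod.mk.injEq, Set.mem_inter_iff,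
      mem_cyl_iff]
  rw [e]
  have h2 := h.measure_cyl_inter_le hQ hn a (measurableSet_cyl b)
  have := mul_le_mul_of_nonneg_right h2 (mul_nonneg (hf a) (hg b))
  refine this.trans (le_of_eq (by ring))

/-- Gapless UD of `P` splits the probability after `m` letters, the letters in the gap of `Q` are
dropped since this only increases `pr P`, and UD of `Q` then splits the integral. -/
theorem moment_add_le [IsProbabilityMeasure P] [IsProbabilityMeasure Q]
    (hP : MeasurePreserving shift P P) (hQ : MeasurePreserving shift Q Q) {κ : ℕ → ℝ}
    (hκ : IsUDWith P κ fun _ => 0) {k : ℕ → ℝ} {τ : ℕ → ℕ} (h : IsUDWith Q k τ) {m : ℕ}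
    (hm : 1 ≤ m) (n : ℕ) {s : ℝ} (hs : 0 ≤ s) :
    moment P Q (m + τ m + n) s ≤ Real.exp (κ m * s) *
      (Real.exp (k m) * (Fintype.card A : ℝ) ^ τ m) * moment P Q m s * moment P Q n s := by
  have h1 := h.integral_mul_le hQ hm n (f := fun a => P.real (cyl a) ^ s)
    (g := fun b => P.real (cyl b) ^ s) (fun a => Real.rpow_nonneg measureReal_nonneg s)
    (fun b => Real.rpow_nonneg measureReal_nonneg s)
  have h2 : moment P Q (m + τ m + n) s ≤
      ∫ y, Real.exp (κ m * s) * (pr P m y ^ s * pr P n (shift^[m + τ m] y) ^ s) ∂Q := by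
    refine integral_mono (integrable_pr_rpow _ s) (Integrable.const_mul ?_ _) fun y => ?_
    · have hφ := (measurable_pr (P := P) m).pow_const s
      have hψ := ((measurable_pr (P := P) n).comp (measurable_shift_iterate (m + τ m))).pow_const s
      refine Integrable.of_bound (hφ.mul hψ).aestronglyMeasurable 1 (ae_of_all _ fun y => ?_)
      rw [Real.norm_of_nonneg (mul_nonneg (Real.rpow_nonneg (pr_nonneg _ _) s)
        (Real.rpow_nonneg (pr_nonneg _ _) s))]
      exact mul_le_one₀ (Real.rpow_le_one (pr_nonneg _ _) (pr_le_one _ _) hs)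
        (Real.rpow_nonneg (pr_nonneg _ _) s) (Real.rpow_le_one (pr_nonneg _ _) (pr_le_one _ _) hs)
    · have h3 := pr_add_le hP hκ hm (τ m + n) y
      have h4 := pr_add_le_shift hP (τ m) n (shift^[m] y)
      rw [← Function.iterate_add_apply, add_comm (τ m) m] at h4
      have h5 : pr P (m + τ m + n) y ≤
          Real.exp (κ m) * (pr P m y * pr P n (shift^[m + τ m] y)) := by
        rw [add_assoc]
        refine h3.trans ?_
        have := pr_nonneg (P := P) m y
        gcongr
      have h6 := pr_nonneg (P := P) m y
      have h7 := pr_nonneg (P := P) n (shift^[m + τ m] y)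
      refine (Real.rpow_le_rpow (pr_nonneg _ _) h5 hs).trans (le_of_eq ?_)
      rw [Real.mul_rpow (Real.exp_pos _).le (by positivity), Real.mul_rpow h6 h7, ← Real.exp_mul]
  rw [integral_const_mul] at h2
  refine h2.trans ?_
  rw [mul_assoc, mul_assoc, mul_assoc]
  refine mul_le_mul_of_nonneg_left ?_ (Real.exp_pos _).le
  refine h1.trans (le_of_eq ?_)
  simp only [moment, pr]
  ring

theorem moment_mul_nat_le [IsProbabilityMeasure P] [IsProbabilityMeasure Q]
    {m' : ℕ} {s ρ : ℝ} (hs : 0 ≤ s) (hρ : 0 ≤ ρ)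
    (h : ∀ n, moment P Q (m' + n) s ≤ ρ * moment P Q n s) (j : ℕ) :
    moment P Q (j * m') s ≤ ρ ^ j := by
  induction j with
  | zero => simpa using moment_le_one 0 hs
  | succ j ih =>
    rw [Nat.succ_mul, add_comm, pow_succ']
    exact (h _).trans (mul_le_mul_of_nonneg_left ih hρ)

theorem tendsto_measure_info_lt [IsProbabilityMeasure Q] {c : ℝ}
    (h : ∀ᵐ y ∂Q, ∀ᶠ m : ℕ in atTop, c * m ≤ info P m y) :
    Tendsto (fun m : ℕ => Q.real {y | info P m y < c * m}) atTop (𝓝 0) := by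
  have h1 := tendsto_measure_of_ae_tendsto_indicator_of_isFiniteMeasure (μ := Q) (A := ∅)
    (As := fun m : ℕ => {y | info P m y < c * m}) atTop MeasurableSet.empty
    (fun m => measurableSet_lt (measurable_info m) measurable_const) (by
      filter_upwards [h] with y hy
      filter_upwards [hy] with m hm
      simp [hm])
  rw [measure_empty] at h1
  have := (ENNReal.tendsto_toReal ENNReal.zero_ne_top).comp h1
  rwa [ENNReal.toReal_zero] at this

theorem moment_le_of_info [IsProbabilityMeasure P] [IsProbabilityMeasure Q]
    (hsupp : supp Q ⊆ supp P) (m : ℕ) {s c : ℝ} (hs : 0 ≤ s) :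
    moment P Q m s ≤ Real.exp (-(s * c * m)) + Q.real {y | info P m y < c * m} := by
  have hm : MeasurableSet {y | info P m y < c * m} :=
    measurableSet_lt (measurable_info m) measurable_const
  have hi : Integrable ({y | info P m y < c * m}.indicator (1 : (ℕ → A) → ℝ)) Q :=
    (integrable_const 1).indicator hm
  rw [← integral_indicator_one hm]
  have : ∫ y, (Real.exp (-(s * c * m)) + {y | info P m y < c * m}.indicator 1 y) ∂Q =
      Real.exp (-(s * c * m)) + ∫ y, {y | info P m y < c * m}.indicator 1 y ∂Q := by
    rw [integral_add (integrable_const _) hi]; simp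
  rw [← this]
  refine integral_mono_ae (integrable_pr_rpow m s) ((integrable_const _).add hi) ?_
  filter_upwards [ae_mem_supp_of_subset hsupp] with y hy
  by_cases hlt : info P m y < c * m
  · have : pr P m y ^ s ≤ 1 := Real.rpow_le_one (pr_nonneg _ _) (pr_le_one _ _) hs
    have h0 := Real.exp_pos (-(s * c * m))
    simp only [Set.indicator_of_mem (show y ∈ {y | info P m y < c * m} from hlt), Pi.one_apply]
    linarith
  · simp only [Set.indicator_of_notMem (show y ∉ {y | info P m y < c * m} from hlt), add_zero]
    rw [← exp_neg_info hy, ← Real.exp_mul, Real.exp_le_exp]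
    nlinarith [not_lt.1 hlt]

/-- If `Q` is upper decoupled with bounded constants, then the slopes of the pressure at the origin
reach the cross entropy. -/
theorem exists_pressure_le_of_lt_crossEntropy [IsProbabilityMeasure P] [IsProbabilityMeasure Q]
    (hP : MeasurePreserving shift P P) (hQ : Ergodic shift Q) (hsupp : supp Q ⊆ supp P)
    {κ : ℕ → ℝ} (hκ : IsUDWith P κ fun _ => 0) (hUD : IsUDBounded Q) {h : EReal}
    (hh : HasCrossEntropy Q P h) {c : ℝ} (hc : (c : EReal) < h) :
    ∃ s : ℝ, 0 < s ∧ s < 1 ∧ pressure P Q (-s) ≤ ((-s * c : ℝ) : EReal) := by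
  rcases le_or_gt c 0 with hc0 | hc0
  · refine ⟨1 / 2, by norm_num, by norm_num,
      pressure_le_of_eventually_moment_le hsupp (by norm_num) (Eventually.of_forall fun n => ?_)⟩
    refine (moment_le_one n (by norm_num)).trans (Real.one_le_exp ?_)
    have : (0 : ℝ) ≤ n := n.cast_nonneg
    nlinarith
  obtain ⟨c', hcc', hc'⟩ := EReal.exists_between_coe_real hc
  have hcc := EReal.coe_lt_coe_iff.1 hcc'
  obtain ⟨c'', h1, h2⟩ := exists_between hcc
  obtain ⟨k, τ, hk, hkO, hτO⟩ := hUD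
  obtain ⟨Kb, hKb⟩ := hkO.bound
  obtain ⟨tb, htb⟩ := hτO.bound
  have hA : (1 : ℝ) ≤ Fintype.card A := by exact_mod_cast card_pos (Q := Q)
  set L : ℝ := Kb + tb * Real.log (Fintype.card A) with hL
  -- The gain `K (c' - c'')` has to beat the overhead of one concatenation: `L` from decoupling `Q`,
  -- one from decoupling `P`, and one for the factor `2` in the moment bound. `L` does not depend on
  -- `m`, and this is where bounded constants are needed.
  set K : ℝ := max 1 ((L + 2) / (c' - c'')) with hK
  have hK1 : 1 ≤ K := le_max_left _ _
  have hKL : L + 2 ≤ K * (c' - c'') := by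
    have := le_max_right 1 ((L + 2) / (c' - c''))
    rwa [← hK, div_le_iff₀ (by linarith)] at this
  have hinfo := tendsto_measure_info_lt (hh.ae_eventually_ge hP hQ hsupp hκ hc')
  obtain ⟨M, hM⟩ := exists_forall_ge_le_mul hκ.k_little (show 0 < 1 / K by positivity)
  have hcast : Tendsto (fun m : ℕ => (m : ℝ)) atTop atTop := tendsto_natCast_atTop_atTop
  obtain ⟨m, hkm, hτm, hbad, hMm, hm1, hm2⟩ := (hKb.and (htb.and
    ((hinfo.eventually (gt_mem_nhds (Real.exp_pos (-(K * c'))))).and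
    ((eventually_ge_atTop M).and ((hcast.eventually_gt_atTop K).and
    (hcast.eventually_gt_atTop (c * tb / (c'' - c)))))))).exists
  have hm0 : (0 : ℝ) < m := by linarith
  have hm1' : 1 ≤ m := by exact_mod_cast hm0
  -- With `s * m = K` fixed, typical prefixes contribute at most `exp (-K c')` to the moment, and
  -- the measure of the atypical ones falls below this value once `m` is large.
  set s : ℝ := K / m with hs
  have hs0 : 0 < s := by positivity
  have hsm : s * m = K := div_mul_cancel₀ _ hm0.ne'
  refine ⟨s, hs0, (div_lt_one hm0).2 hm1, pressure_le_of_eventually_moment_le hsupp hs0 ?_⟩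
  simp only [norm_one, mul_one] at hkm hτm
  have hkm' : k m ≤ Kb := (le_abs_self _).trans hkm
  have hτm' : (τ m : ℝ) ≤ tb := (le_abs_self _).trans hτm
  have hκm : κ m * s ≤ 1 := by
    have h3 := hM m hMm
    have h4 : κ m * s ≤ 1 / K * m * s := mul_le_mul_of_nonneg_right h3 hs0.le
    have h5 : 1 / K * m * s = 1 := by rw [mul_assoc, mul_comm (m : ℝ), hsm]; field_simp
    linarith
  have hmom : moment P Q m s ≤ 2 * Real.exp (-(K * c')) := by
    have := moment_le_of_info (P := P) (Q := Q) hsupp m (s := s) (c := c') hs0.le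
    rw [show s * c' * m = K * c' by rw [← hsm]; ring] at this
    linarith
  have hcard : Real.exp (k m) * (Fintype.card A : ℝ) ^ τ m ≤ Real.exp L := by
    have e : (Fintype.card A : ℝ) ^ τ m = Real.exp (τ m * Real.log (Fintype.card A)) := by
      rw [Real.exp_nat_mul, Real.exp_log (by linarith)]
    rw [e, ← Real.exp_add, Real.exp_le_exp, hL]
    have := Real.log_nonneg hA
    gcongr
  set ρ : ℝ := Real.exp (κ m * s) * (Real.exp (k m) * (Fintype.card A : ℝ) ^ τ m) *
    moment P Q m s with hρ
  have hρ0 : 0 ≤ ρ := mul_nonneg (by positivity) (moment_nonneg m s)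
  have hρle : ρ ≤ Real.exp (-(K * c'')) := by
    calc ρ ≤ Real.exp 1 * Real.exp L * (2 * Real.exp (-(K * c'))) := by
          have := moment_nonneg (P := P) (Q := Q) m s
          rw [hρ]
          gcongr
      _ ≤ Real.exp 1 * Real.exp L * (Real.exp 1 * Real.exp (-(K * c'))) := by
          have := Real.add_one_le_exp (1 : ℝ)
          gcongr
          linarith
      _ ≤ _ := by
          rw [← Real.exp_add, ← Real.exp_add, ← Real.exp_add, Real.exp_le_exp]
          linarith
  set m' : ℕ := m + τ m with hm'
  have hm'0 : (0 : ℝ) < m' := by rw [hm']; push_cast; positivity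
  have hpow := moment_mul_nat_le (P := P) (Q := Q) (m' := m') hs0.le hρ0 fun n =>
    moment_add_le hP hQ.toMeasurePreserving hκ hk hm1' n hs0.le
  -- One period has length `m' = m + τ m`; the bounded gap is paid for by the difference between
  -- `c''` and `c`.
  have hgap : 0 < c'' * m - c * m' := by
    rw [div_lt_iff₀ (by linarith)] at hm2
    have : c * τ m ≤ c * tb := by gcongr
    rw [hm']; push_cast
    linarith
  filter_upwards [hcast.eventually_ge_atTop (c'' * m * m' / (c'' * m - c * m'))] with n hn
  rw [div_le_iff₀ hgap] at hn
  have hj : n / m' * m' ≤ n := Nat.div_mul_le_self n m'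
  refine (moment_anti hj hs0.le).trans ((hpow _).trans
    ((pow_le_pow_left₀ hρ0 hρle _).trans ?_))
  rw [← Real.exp_nat_mul, Real.exp_le_exp]
  have hj2 : (n : ℝ) < ((n / m' : ℕ) + 1) * m' := by
    have hpos : 0 < m' := by exact_mod_cast hm'0
    exact_mod_cast Nat.lt_mul_of_div_lt (Nat.lt_succ_self (n / m')) hpos
  set j : ℝ := ((n / m' : ℕ) : ℝ)
  have h6 : c * n * m' ≤ j * c'' * m * m' := by
    have : c'' * m * n ≤ c'' * m * ((j + 1) * m') := by
      have : 0 < c'' := by linarith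
      gcongr
    linarith
  have h7 : c * n ≤ j * c'' * m := le_of_mul_le_mul_right h6 hm'0
  have h8 : s * (c * n) ≤ s * (j * c'' * m) := mul_le_mul_of_nonneg_left h7 hs0.le
  have h9 : s * (j * c'' * m) = j * (K * c'') := by rw [← hsm]; ring
  linarith

end BoundedDecoupling

/-! ### Probability that a word does not occur -/

section UpperBound

variable {A : Type*} [MeasurableSpace A] [Fintype A] [MeasurableSingletonClass A]
  {P Q : Measure (ℕ → A)}

theorem measurableSet_setOf_notMem_occ (N n : ℕ) (y : ℕ → A) :
    MeasurableSet {x | y ∉ occ N n x} := by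
  have : MeasurableSet {x | y ∈ occ N n x} :=
    (measurable_id.prodMk measurable_const : Measurable fun x : ℕ → A => (x, y))
      (measurableSet_occ_prod (A := A) N n)
  exact this.compl

/-- Given avoidance after position `l + t`, SLD makes the word occur within the first `l + t`
letters with a definite conditional probability. By pigeonhole some gap `i ≤ t` carries a share `1 /
(t + 1)` of the SLD bound; starting the word at position `t - i` makes the word and its gap end
exactly at `l + t`. -/
theorem measure_notMem_occ_add_le [IsProbabilityMeasure P] (hP : MeasurePreserving shift P P)
    {l t : ℕ} {c : ℝ} (hc : 0 ≤ c) (y : ℕ → A)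
    (h : ∀ m : ℕ, 1 ≤ m → ∀ b ∈ suppWords P m, ∃ l' ≤ t, ∃ ξ : Fin l' → A,
      c * (P.real (cyl (pre l y)) * P.real (cyl b)) ≤ P.real (cyl (concat3 (pre l y) ξ b)))
    (m : ℕ) : P.real {x | y ∉ occ (m + (l + t)) l x} ≤
      (1 - c * pr P l y / (t + 1)) * P.real {x | y ∉ occ m l x} := by
  set H : Set (ℕ → A) := {x | y ∉ occ m l x} with hH
  have hHm : MeasurableSet H := measurableSet_setOf_notMem_occ m l y
  have h1 := measure_cyl_inter_sum_ge (P := P) hc h hHm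
  obtain ⟨i, hi, hle⟩ : ∃ i ∈ Finset.range (t + 1), c * pr P l y / (t + 1) * P.real H ≤
      P.real (cyl (pre l y) ∩ shift^[l + i] ⁻¹' H) := by
    refine Finset.exists_le_of_sum_le (by simp) (le_trans (le_of_eq ?_) h1)
    rw [Finset.sum_const, Finset.card_range, nsmul_eq_mul, pr]
    push_cast
    field_simp
  have hit : i ≤ t := Nat.lt_succ_iff.1 (Finset.mem_range.1 hi)
  set E : Set (ℕ → A) := shift^[t - i] ⁻¹' (cyl (pre l y) ∩ shift^[l + i] ⁻¹' H) with hE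
  have hEm : MeasurableSet (cyl (pre l y) ∩ shift^[l + i] ⁻¹' H) :=
    (measurableSet_cyl _).inter (measurable_shift_iterate _ hHm)
  have hEP : P.real E = P.real (cyl (pre l y) ∩ shift^[l + i] ⁻¹' H) :=
    measureReal_shift_iterate hP _ hEm
  have hEsub : E ⊆ shift^[l + t] ⁻¹' H := by
    intro x hx
    have := hx.2
    rw [Set.mem_preimage, ← Function.iterate_add_apply,
      show l + i + (t - i) = l + t by omega] at this
    exact this
  have hsub : {x | y ∉ occ (m + (l + t)) l x} ⊆ shift^[l + t] ⁻¹' H \ E := by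
    intro x hx
    refine ⟨fun ⟨r, hr, hxr⟩ => hx ⟨r + (l + t), by omega, fun j hj => ?_⟩, fun hxE => hx ?_⟩
    · have := hxr j hj
      rw [shift_iterate_apply] at this
      rw [← this]; congr 1; omega
    · refine ⟨t - i, by omega, fun j hj => ?_⟩
      have := mem_cyl_pre.1 hxE.1 j hj
      rw [shift_iterate_apply] at this
      rw [← this]; congr 1; omega
  have hEm' : MeasurableSet E := measurable_shift_iterate _ hEm
  refine (measureReal_mono hsub).trans ?_
  rw [measureReal_sdiff hEsub hEm', measureReal_shift_iterate hP _ hHm, hEP]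
  linarith

/-- Iterate over `N / (l + t)` windows and use `1 - q ≤ exp (-q)`. Rounding the number of windows
down costs at most a factor `e < 3`. -/
theorem measure_notMem_occ_le_exp [IsProbabilityMeasure P] (hP : MeasurePreserving shift P P)
    {l t : ℕ} (hl : 1 ≤ l) {c : ℝ} (hc : 0 ≤ c) (hc1 : c ≤ 1) (y : ℕ → A)
    (h : ∀ m : ℕ, 1 ≤ m → ∀ b ∈ suppWords P m, ∃ l' ≤ t, ∃ ξ : Fin l' → A,
      c * (P.real (cyl (pre l y)) * P.real (cyl b)) ≤ P.real (cyl (concat3 (pre l y) ξ b)))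
    (N : ℕ) : P.real {x | y ∉ occ N l x} ≤
      3 * Real.exp (-(N * (c * pr P l y / ((t + 1) * (l + t))))) := by
  set q : ℝ := c * pr P l y / (t + 1) with hq
  have hq0 : 0 ≤ q := by have := pr_nonneg (P := P) l y; positivity
  have hq1 : q ≤ 1 := by
    rw [hq, div_le_one (by positivity)]
    have h1 : c * pr P l y ≤ 1 := mul_le_one₀ hc1 (pr_nonneg _ _) (pr_le_one _ _)
    have h2 : (0 : ℝ) ≤ t := t.cast_nonneg
    linarith
  set D := l + t with hD
  have hD0 : (0 : ℝ) < D := by exact_mod_cast (by omega : 0 < D)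
  have hpow : ∀ j : ℕ, P.real {x | y ∉ occ (j * D) l x} ≤ (1 - q) ^ j := by
    intro j
    induction j with
    | zero => simp
    | succ j ih =>
      rw [Nat.succ_mul, pow_succ']
      exact (measure_notMem_occ_add_le hP hc y h _).trans
        (mul_le_mul_of_nonneg_left ih (by linarith))
  have hsub : {x | y ∉ occ N l x} ⊆ {x | y ∉ occ (N / D * D) l x} :=
    fun x hx hx' => hx (occ_mono (Nat.div_mul_le_self N D) l x hx')
  have hj : (N : ℝ) < ((N / D : ℕ) + 1) * D := by
    exact_mod_cast Nat.lt_mul_of_div_lt (Nat.lt_succ_self (N / D)) (by omega)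
  have hj' : (N : ℝ) / D - 1 ≤ (N / D : ℕ) := by
    rw [← div_lt_iff₀ hD0] at hj
    linarith
  calc P.real {x | y ∉ occ N l x} ≤ (1 - q) ^ (N / D) := (measureReal_mono hsub).trans (hpow _)
    _ ≤ Real.exp (-q) ^ (N / D) :=
        pow_le_pow_left₀ (by linarith) (Real.one_sub_le_exp_neg q) _
    _ ≤ Real.exp (1 + -(N / D * q)) := by
        rw [← Real.exp_nat_mul, Real.exp_le_exp]
        nlinarith
    _ ≤ 3 * Real.exp (-(N / D * q)) := by
        rw [Real.exp_add]
        have := Real.exp_one_lt_d9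
        gcongr
        linarith
    _ = _ := by
        congr 3
        rw [hq, hD]
        push_cast
        field_simp

theorem exists_le_exp_mul {k : ℕ → ℝ} {τ : ℕ → ℕ} (hk : k =o[atTop] fun n : ℕ => (n : ℝ))
    (hτ : (fun n => (τ n : ℝ)) =o[atTop] fun n : ℕ => (n : ℝ)) {η : ℝ} (hη : 0 < η) :
    ∃ C : ℝ, 0 < C ∧ ∀ l : ℕ,
      Real.exp (k l) * ((τ l + 1) * (l + τ l)) ≤ C * Real.exp (η * l) := by
  obtain ⟨M₁, hM₁⟩ := exists_forall_ge_le_mul hk (half_pos hη)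
  obtain ⟨M₂, hM₂⟩ := exists_forall_ge_le_mul hτ one_pos
  set M := max (max M₁ M₂) 1 with hM
  let g : ℕ → ℝ := fun l => Real.exp (k l) * ((τ l + 1) * (l + τ l))
  have hg0 : ∀ l, 0 ≤ g l := fun l => by positivity
  have hsum0 : 0 ≤ ∑ l ∈ Finset.range M, g l := Finset.sum_nonneg fun l _ => hg0 l
  have h32 : 0 < 32 / η ^ 2 := by positivity
  refine ⟨32 / η ^ 2 + ∑ l ∈ Finset.range M, g l, by linarith, fun l => ?_⟩
  rcases lt_or_ge l M with hl | hl
  · have h1 : g l ≤ ∑ l ∈ Finset.range M, g l :=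
      Finset.single_le_sum (fun i _ => hg0 i) (Finset.mem_range.2 hl)
    have h2 : 1 ≤ Real.exp (η * l) := Real.one_le_exp (by positivity)
    have h3 := hg0 l
    have h4 : g l ≤ 32 / η ^ 2 + ∑ l ∈ Finset.range M, g l := by linarith
    exact h4.trans (le_mul_of_one_le_right (h3.trans h4) h2)
  · have hl1 : 1 ≤ l := (le_max_right _ _).trans hl
    have h1 := hM₁ l ((le_max_left _ _).trans ((le_max_left _ _).trans hl))
    have h2 := hM₂ l ((le_max_right _ _).trans ((le_max_left _ _).trans hl))
    rw [one_mul] at h2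
    have hl1' : (1 : ℝ) ≤ l := by exact_mod_cast hl1
    have h3 := Real.pow_div_factorial_le_exp (η / 2 * l) (by positivity) 2
    have h4 : ((τ l : ℝ) + 1) * (l + τ l) ≤ 32 / η ^ 2 * Real.exp (η / 2 * l) := by
      calc ((τ l : ℝ) + 1) * (l + τ l) ≤ (l + l) * (l + l) := by gcongr
        _ = 32 / η ^ 2 * ((η / 2 * l) ^ 2 / (2 : ℕ).factorial) := by
            simp [Nat.factorial]; field_simp; ring
        _ ≤ _ := by gcongr
    calc Real.exp (k l) * ((τ l + 1) * (l + τ l))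
        ≤ Real.exp (η / 2 * l) * (32 / η ^ 2 * Real.exp (η / 2 * l)) := by gcongr
      _ = 32 / η ^ 2 * Real.exp (η * l) := by
          rw [mul_left_comm, ← Real.exp_add]; congr 2; ring
      _ ≤ _ := by gcongr; linarith

/-- Under selective lower decoupling, a word is unlikely not to occur in `x_1 … x_N` when `N` is
much larger than the inverse of its probability. -/
theorem IsSLD.measure_notMem_occ_le [IsProbabilityMeasure P] (hP : MeasurePreserving shift P P)
    (h : IsSLD P) {η : ℝ} (hη : 0 < η) :
    ∃ C : ℝ, 0 < C ∧ ∀ l N : ℕ, ∀ y : ℕ → A, 1 ≤ l →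
      P.real {x | y ∉ occ N l x} ≤ 3 * Real.exp (-(N * (pr P l y * Real.exp (-(η * l)) / C))) := by
  obtain ⟨k, τ, hk0, hk, hτ, hsld⟩ := h
  obtain ⟨C, hC, hCl⟩ := exists_le_exp_mul hk hτ hη
  refine ⟨C, hC, fun l N y hl => ?_⟩
  by_cases hy : 0 < pr P l y
  · refine (measure_notMem_occ_le_exp hP hl (Real.exp_pos (-k l)).le
      (Real.exp_le_one_iff.2 (by linarith [hk0 l])) y (t := τ l) ?_ N).trans ?_
    · intro m hm b hb
      obtain ⟨l', hl', ξ, -, hξ⟩ := hsld l hl (pre l y) hy m hm b hb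
      exact ⟨l', hl', ξ, hξ⟩
    · refine mul_le_mul_of_nonneg_left (Real.exp_le_exp.2 (neg_le_neg
        (mul_le_mul_of_nonneg_left ?_ N.cast_nonneg))) (by norm_num)
      have hl0 : (0 : ℝ) < l := by exact_mod_cast hl
      have hden : (0 : ℝ) < (τ l + 1) * (l + τ l) := by positivity
      rw [div_le_div_iff₀ hC hden, Real.exp_neg, Real.exp_neg]
      have h1 := Real.exp_pos (k l)
      have h2 := Real.exp_pos (η * l)
      have h3 := hCl l
      rw [← div_eq_mul_inv, ← div_eq_inv_mul, div_mul_eq_mul_div, div_mul_eq_mul_div,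
        div_le_div_iff₀ h2 h1]
      linarith [mul_le_mul_of_nonneg_left h3 hy.le]
  · have h0 : pr P l y = 0 := le_antisymm (not_lt.1 hy) (pr_nonneg l y)
    rw [h0]
    simp only [zero_mul, zero_div, mul_zero, neg_zero, Real.exp_zero, mul_one]
    exact measureReal_le_one.trans (by norm_num)

end UpperBound

/-! ### Information carried by the parsed words -/

section UpperBound

variable {A : Type*} [MeasurableSpace A] [Fintype A] [MeasurableSingletonClass A]
  {P Q : Measure (ℕ → A)}

theorem ae_eventually_notMem_of_le {Ω : Type*} [MeasurableSpace Ω] {μ : Measure Ω}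
    [IsFiniteMeasure μ] {s : ℕ → Set Ω} {C : ℝ}
    (h : ∀ᶠ N : ℕ in atTop, μ.real (s N) ≤ C / (N : ℝ) ^ 2) :
    ∀ᵐ x ∂μ, ∀ᶠ N : ℕ in atTop, x ∉ s N := by
  obtain ⟨N₀, hN₀⟩ := eventually_atTop.1 h
  have hsum : Summable fun N : ℕ => C / ((N + N₀ : ℕ) : ℝ) ^ 2 := by
    have h1 : Summable fun N : ℕ => C * (1 / (N : ℝ) ^ 2) :=
      (Real.summable_one_div_nat_pow.2 (by norm_num)).mul_left C
    have h2 := (summable_nat_add_iff N₀).2 h1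
    refine h2.congr fun N => ?_
    rw [mul_one_div]
  have hfin : ∑' N, μ (s (N + N₀)) ≠ ⊤ := by
    have hle : ∀ N, μ (s (N + N₀)) ≤ ENNReal.ofReal (C / ((N + N₀ : ℕ) : ℝ) ^ 2) := fun N => by
      rw [← ENNReal.ofReal_toReal (measure_ne_top μ _)]
      exact ENNReal.ofReal_le_ofReal (hN₀ _ (by omega))
    refine ne_top_of_le_ne_top ?_ (ENNReal.tsum_le_tsum hle)
    rw [← ENNReal.ofReal_tsum_of_nonneg
      (fun N => measureReal_nonneg.trans (hN₀ (N + N₀) (by omega))) hsum]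
    exact ENNReal.ofReal_ne_top
  filter_upwards [ae_eventually_notMem hfin] with x hx
  obtain ⟨N₁, hN₁⟩ := eventually_atTop.1 hx
  refine eventually_atTop.2 ⟨N₁ + N₀, fun N hN => ?_⟩
  have := hN₁ (N - N₀) (by omega)
  rwa [Nat.sub_add_cancel (by omega)] at this

theorem exists_sq_mul_exp_le {a C : ℝ} (ha : 0 < a) (hC : 0 < C) :
    ∃ K : ℝ, ∀ N : ℕ, 1 ≤ N →
      3 * (N : ℝ) ^ 2 * Real.exp (-((N : ℝ) ^ a / C)) ≤ K / (N : ℝ) ^ 2 := by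
  obtain ⟨n, hn⟩ := exists_nat_ge (4 / a)
  rw [div_le_iff₀ ha] at hn
  refine ⟨3 * (n.factorial * C ^ n), fun N hN => ?_⟩
  have hN1 : (1 : ℝ) ≤ N := by exact_mod_cast hN
  have hN0 : (0 : ℝ) < N := by linarith
  have h1 := Real.pow_div_factorial_le_exp ((N : ℝ) ^ a / C) (by positivity) n
  have h2 : (N : ℝ) ^ 4 ≤ ((N : ℝ) ^ a) ^ n := by
    rw [← Real.rpow_natCast, ← Real.rpow_natCast, ← Real.rpow_mul hN0.le]
    refine Real.rpow_le_rpow_of_exponent_le hN1 ?_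
    push_cast; linarith
  have hf : (0 : ℝ) < n.factorial := by exact_mod_cast n.factorial_pos
  have h3 : (N : ℝ) ^ 4 ≤ n.factorial * C ^ n * Real.exp ((N : ℝ) ^ a / C) := by
    rw [div_pow, div_div, div_le_iff₀ (by positivity)] at h1
    linarith
  rw [Real.exp_neg, ← div_eq_mul_inv, div_le_div_iff₀ (Real.exp_pos _) (by positivity)]
  nlinarith

/-- Almost surely, all the words of moderate length of `y` that do not occur in `x_1 … x_N` have
a small probability. -/
theorem IsSLD.ae_eventually_pr_le [IsProbabilityMeasure P] (hP : MeasurePreserving shift P P)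
    (h : IsSLD P) (y : ℕ → A) {ε K : ℝ} (hε : 0 < ε) (hK : 0 < K) :
    ∀ᵐ x ∂P, ∀ᶠ N : ℕ in atTop, ∀ i l : ℕ, i < N → 1 ≤ l → l ≤ N → (l : ℝ) ≤ K * Real.log N →
      shift^[i] y ∉ occ N l x → pr P l (shift^[i] y) ≤ (N : ℝ) ^ (-(1 - ε)) := by
  classical
  -- With this exponent the SLD loss on words of length at most `K ln N` is at most `N ^ (ε / 2)`,
  -- so a word of probability above `N ^ (-(1 - ε))` is still missed only with probability `3 exp
  -- (-N ^ (ε / 2) / C)`, negligible against the `N ^ 2` choices of `(i, l)`.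
  obtain ⟨C, hC, hCl⟩ := h.measure_notMem_occ_le hP (show 0 < ε / (2 * K) by positivity)
  obtain ⟨K', hK'⟩ := exists_sq_mul_exp_le (half_pos hε) hC
  let I : ℕ → Finset (ℕ × ℕ) := fun N => (Finset.range N ×ˢ Finset.Icc 1 N).filter fun p =>
    (p.2 : ℝ) ≤ K * Real.log N ∧ (N : ℝ) ^ (-(1 - ε)) < pr P p.2 (shift^[p.1] y)
  have hbad : ∀ᶠ N : ℕ in atTop,
      P.real (⋃ p ∈ I N, {x | shift^[p.1] y ∉ occ N p.2 x}) ≤ K' / (N : ℝ) ^ 2 := by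
    filter_upwards [eventually_ge_atTop 1] with N hN
    have hN0 : (0 : ℝ) < N := by exact_mod_cast hN
    have hcard : ((I N).card : ℝ) ≤ (N : ℝ) ^ 2 := by
      have : (I N).card ≤ N * N := by
        refine (Finset.card_filter_le _ _).trans ?_
        simp
      calc ((I N).card : ℝ) ≤ ((N * N : ℕ) : ℝ) := by exact_mod_cast this
        _ = _ := by push_cast; ring
    refine le_trans ?_ (hK' N hN)
    calc P.real (⋃ p ∈ I N, {x | shift^[p.1] y ∉ occ N p.2 x})
        ≤ ∑ p ∈ I N, P.real {x | shift^[p.1] y ∉ occ N p.2 x} := measureReal_biUnion_finset_le _ _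
      _ ≤ ∑ _p ∈ I N, 3 * Real.exp (-((N : ℝ) ^ (ε / 2) / C)) := by
          refine Finset.sum_le_sum fun p hp => ?_
          simp only [I, Finset.mem_filter, Finset.mem_product, Finset.mem_range,
            Finset.mem_Icc] at hp
          obtain ⟨⟨hp1, hp2, hp3⟩, hp4, hp5⟩ := hp
          refine (hCl p.2 N _ hp2).trans ?_
          refine mul_le_mul_of_nonneg_left (Real.exp_le_exp.2 (neg_le_neg ?_)) (by norm_num)
          have h1 : (N : ℝ) ^ (-(ε / 2)) ≤ Real.exp (-(ε / (2 * K) * p.2)) := by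
            rw [Real.rpow_def_of_pos hN0, Real.exp_le_exp]
            have : ε / (2 * K) * p.2 ≤ ε / (2 * K) * (K * Real.log N) := by gcongr
            have e : ε / (2 * K) * (K * Real.log N) = Real.log N * (ε / 2) := by field_simp
            linarith
          calc (N : ℝ) ^ (ε / 2) / C
              = N * ((N : ℝ) ^ (-(1 - ε)) * (N : ℝ) ^ (-(ε / 2)) / C) := by
                rw [← Real.rpow_add hN0]
                have : (N : ℝ) ^ (ε / 2) = (N : ℝ) * (N : ℝ) ^ (-(1 - ε) + -(ε / 2)) := by
                  nth_rewrite 2 [← Real.rpow_one (N : ℝ)]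
                  rw [← Real.rpow_add hN0]; congr 1; ring
                rw [this]; ring
            _ ≤ _ := by
                have := pr_nonneg (P := P) p.2 (shift^[p.1] y)
                gcongr
      _ = (I N).card * (3 * Real.exp (-((N : ℝ) ^ (ε / 2) / C))) := by
          rw [Finset.sum_const, nsmul_eq_mul]
      _ ≤ (N : ℝ) ^ 2 * (3 * Real.exp (-((N : ℝ) ^ (ε / 2) / C))) := by gcongr
      _ = _ := by ring
  filter_upwards [ae_eventually_notMem_of_le hbad] with x hx
  filter_upwards [hx] with N hN i l hi hl hlN hlK hocc
  by_contra! hlt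
  refine hN (Set.mem_biUnion (x := (i, l)) ?_ hocc)
  simp only [I, Finset.coe_filter, Finset.mem_product, Finset.mem_range, Finset.mem_Icc,
    Set.mem_ofPred_eq]
  exact ⟨⟨hi, hl, hlN⟩, hlK, hlt⟩

/-- Almost surely, all the words of `y` of length a large multiple of `ln N` have a small
probability. -/
theorem ae_eventually_pr_ceil_le [IsProbabilityMeasure P] [IsProbabilityMeasure Q]
    (hQ : MeasurePreserving shift Q Q) {γ : ℝ} (hγ : 0 < γ)
    (hmom : ∀ᶠ n : ℕ in atTop, moment P Q n 1 ≤ Real.exp (-γ * n)) :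
    ∀ᵐ y ∂Q, ∀ᶠ N : ℕ in atTop, ∀ i < N,
      pr P ⌈4 / γ * Real.log N⌉₊ (shift^[i] y) ≤ (N : ℝ)⁻¹ := by
  have hlog : Tendsto (fun N : ℕ => 4 / γ * Real.log N) atTop atTop :=
    (Real.tendsto_log_atTop.comp tendsto_natCast_atTop_atTop).const_mul_atTop (by positivity)
  have hceil : Tendsto (fun N : ℕ => ⌈4 / γ * Real.log N⌉₊) atTop atTop :=
    tendsto_nat_ceil_atTop.comp hlog
  let n : ℕ → ℕ := fun N => ⌈4 / γ * Real.log N⌉₊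
  have hm : ∀ N : ℕ, MeasurableSet {y | (N : ℝ)⁻¹ < pr P (n N) y} := fun N =>
    measurableSet_lt measurable_const (measurable_pr _)
  have hbad : ∀ᶠ N : ℕ in atTop,
      Q.real (⋃ i ∈ Finset.range N, shift^[i] ⁻¹' {y | (N : ℝ)⁻¹ < pr P (n N) y}) ≤
        1 / (N : ℝ) ^ 2 := by
    filter_upwards [hceil.eventually hmom, eventually_ge_atTop 1] with N hN hN1
    have hN0 : (0 : ℝ) < N := by exact_mod_cast hN1
    have h1 : Q.real {y | (N : ℝ)⁻¹ < pr P (n N) y} ≤ N * moment P Q (n N) 1 := by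
      have h2 := mul_meas_ge_le_integral_of_nonneg (μ := Q) (f := fun y => pr P (n N) y ^ (1 : ℝ))
        (ae_of_all _ fun y => Real.rpow_nonneg (pr_nonneg _ y) 1) (integrable_pr_rpow _ 1) (N : ℝ)⁻¹
      have h3 : Q.real {y | (N : ℝ)⁻¹ < pr P (n N) y} ≤
          Q.real {y | (N : ℝ)⁻¹ ≤ pr P (n N) y ^ (1 : ℝ)} :=
        measureReal_mono fun y hy => by
          simp only [Set.mem_ofPred_eq, Real.rpow_one] at hy ⊢
          exact hy.le
      have h4 : (N : ℝ)⁻¹ * Q.real {y | (N : ℝ)⁻¹ < pr P (n N) y} ≤ moment P Q (n N) 1 :=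
        (mul_le_mul_of_nonneg_left h3 (by positivity)).trans h2
      rwa [inv_mul_le_iff₀ hN0] at h4
    -- The constant `4 / γ` is chosen for this: Markov's inequality and the union over starting
    -- points each lose a factor `N`, leaving the summable `1 / N ^ 2`.
    have h5 : moment P Q (n N) 1 ≤ 1 / (N : ℝ) ^ 4 := by
      refine hN.trans ?_
      have h6 : 4 / γ * Real.log N ≤ (n N : ℝ) := Nat.le_ceil _
      have h7 : 4 * Real.log N ≤ γ * n N := by
        have := mul_le_mul_of_nonneg_left h6 hγ.le
        rwa [← mul_assoc, mul_div_cancel₀ _ hγ.ne'] at this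
      rw [one_div, ← Real.exp_log (show (0 : ℝ) < (N : ℝ) ^ 4 by positivity), ← Real.exp_neg,
        Real.exp_le_exp, Real.log_pow]
      push_cast
      linarith
    calc _ ≤ ∑ i ∈ Finset.range N, Q.real (shift^[i] ⁻¹' {y | (N : ℝ)⁻¹ < pr P (n N) y}) :=
          measureReal_biUnion_finset_le _ _
      _ = N * Q.real {y | (N : ℝ)⁻¹ < pr P (n N) y} := by
          rw [Finset.sum_congr rfl fun i _ => measureReal_shift_iterate hQ i (hm N)]
          simp
      _ ≤ N * (N * (1 / (N : ℝ) ^ 4)) := by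
          gcongr
          exact h1.trans (by gcongr)
      _ = _ := by field_simp
  filter_upwards [ae_eventually_notMem_of_le hbad] with y hy
  filter_upwards [hy] with N hN i hi
  by_contra! hlt
  exact hN (Set.mem_biUnion (x := i) (by simpa using hi) hlt)

theorem parseEnd_mono (N : ℕ) (y x : ℕ → A) : Monotone (parseEnd N y x) := by
  refine monotone_nat_of_le_succ fun i => ?_
  have := parseEnd_le N y x i
  rw [parseEnd_succ]; omega

/-- Each complete word fails to occur, hence has information at least `a`, and superadditivity adds
these up. In the decoupling errors `η l + C` the linear parts sum to `η` times the total length,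
while `C` is charged to each word. -/
theorem parseEnd_mul_le_info [IsProbabilityMeasure P] (hP : MeasurePreserving shift P P)
    {κ : ℕ → ℝ} (hκ : IsUDWith P κ fun _ => 0) {N : ℕ} {y x : ℕ → A} (hy : y ∈ supp P)
    {a η C : ℝ} (hκb : ∀ l, κ l ≤ η * l + C)
    (h : ∀ i l : ℕ, i < N → 1 ≤ l → l ≤ N → shift^[i] y ∉ occ N l x →
      a ≤ info P l (shift^[i] y)) (i : ℕ) :
    ∀ j, parseEnd N y x (j + i) < N → i * (a - C) ≤
      info P (parseEnd N y x (j + i) - parseEnd N y x j) (shift^[parseEnd N y x j] y) +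
        η * ((parseEnd N y x (j + i) : ℝ) - parseEnd N y x j) := by
  induction i with
  | zero => intro j _; simpa using info_nonneg _ _
  | succ i ih =>
    intro j hj
    have e : j + (i + 1) = j + 1 + i := by omega
    rw [e] at hj ⊢
    have h1 := ih (j + 1) hj
    have hle : parseEnd N y x (j + 1) ≤ parseEnd N y x (j + 1 + i) :=
      parseEnd_mono N y x (by omega)
    have hlt : parseEnd N y x (j + 1) < N := hle.trans_lt hj
    have hs := parseEnd_succ N y x j
    set L := parseEnd N y x j
    set L' := parseEnd N y x (j + 1)
    set L'' := parseEnd N y x (j + 1 + i)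
    set l := matchLength N (shift^[L] y) x + 1 with hl
    have hL' : L' = l + L := by omega
    have h2 := h L l (by omega) (by omega) (by omega) (notMem_occ_matchLength_add_one N _ x)
    have h3 := info_add_ge hP hκ (show 1 ≤ l by omega) (L'' - L')
      (shift_iterate_mem_supp hP hy L)
    rw [← Function.iterate_add_apply, ← hL', show l + (L'' - L') = L'' - L by omega] at h3
    have h4 := hκb l
    have h5 : (L' : ℝ) = l + L := by exact_mod_cast hL'
    push_cast
    rw [h5] at h1
    linarith

/-- The last word is left out, because it may be truncated and then occur in `x`. -/
theorem numWords_mul_le_info [IsProbabilityMeasure P] (hP : MeasurePreserving shift P P)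
    {κ : ℕ → ℝ} (hκ : IsUDWith P κ fun _ => 0) {N : ℕ} (hN : 1 ≤ N) {y x : ℕ → A}
    (hy : y ∈ supp P) {a η C : ℝ} (hη : 0 ≤ η) (hκb : ∀ l, κ l ≤ η * l + C)
    (h : ∀ i l : ℕ, i < N → 1 ≤ l → l ≤ N → shift^[i] y ∉ occ N l x →
      a ≤ info P l (shift^[i] y)) :
    ((numWords N y x : ℝ) - 1) * (a - C) ≤ info P N y + η * N := by
  have h1 := one_le_numWords hN y x
  have h2 := parseEnd_lt (N := N) (y := y) (x := x) (i := 0 + (numWords N y x - 1)) (by omega)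
  have h3 := parseEnd_mul_le_info hP hκ hy hκb h (numWords N y x - 1) 0 h2
  rw [Nat.cast_sub h1, zero_add] at h3
  rw [zero_add] at h2
  simp only [parseEnd, Nat.sub_zero, Function.iterate_zero, id, Nat.cast_one, Nat.cast_zero,
    sub_zero] at h3
  have h4 := info_mono h2.le hy
  have h5 : ((parseEnd N y x (numWords N y x - 1) : ℕ) : ℝ) ≤ N := by exact_mod_cast h2.le
  have h6 := mul_le_mul_of_nonneg_left h5 hη
  linarith

end UpperBound

/-! ### From word counts to the estimator -/

section Estimator

/-- These asymptotics convert `(c_N - 1) (p ln N - w) ≤ r' N` into a bound on the estimator. The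
strict inequality `r' < p * r` absorbs the lower-order terms, including the uncounted last word. -/
theorem eventually_natCast_log_bounds {p r r' u w : ℝ} (h : r' < p * r) :
    ∀ᶠ N : ℕ in atTop, 0 < Real.log N + u ∧ 0 < Real.log N ∧
      (0 < p → 0 < p * Real.log N - w) ∧
      (Real.log N + u) * (p * Real.log N - w) ≤ N ∧
      1 ≤ r * (p * Real.log N - w) - r' * (Real.log N + u) := by
  have hlog : Tendsto (fun N : ℕ => Real.log N) atTop atTop :=
    Real.tendsto_log_atTop.comp tendsto_natCast_atTop_atTop
  have hsq : ∀ᶠ N : ℕ in atTop, (2 * (|p| + 1)) * Real.log N ^ 2 ≤ N := by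
    have h1 := (Real.isLittleO_pow_log_id_atTop (n := 2)).comp_tendsto
      tendsto_natCast_atTop_atTop (k := fun N : ℕ => (N : ℝ))
    have h2 : (0 : ℝ) < 1 / (2 * (|p| + 1)) := by positivity
    filter_upwards [h1.def h2] with N hN
    simp only [Function.comp, id] at hN
    rw [Real.norm_of_nonneg (by positivity), Real.norm_of_nonneg (by positivity),
      one_div, inv_mul_eq_div, le_div_iff₀ (by positivity)] at hN
    linarith
  filter_upwards [hsq, hlog.eventually_gt_atTop |u|, hlog.eventually_gt_atTop |w|,
    hlog.eventually_gt_atTop 0, hlog.eventually_gt_atTop (w / p),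
    hlog.eventually_gt_atTop ((1 + r * w + r' * u) / (p * r - r'))] with N h1 h2 h3 h4 h5 h6
  have hu := neg_abs_le u
  have hu' := le_abs_self u
  refine ⟨by linarith, h4, fun hp => ?_, ?_, ?_⟩
  · rw [div_lt_iff₀ hp] at h5
    linarith
  · refine le_trans ?_ h1
    have hw := neg_abs_le w
    have hp := le_abs_self p
    have h7 : p * Real.log N - w ≤ (|p| + 1) * Real.log N := by nlinarith
    have h8 : (Real.log N + u) * (p * Real.log N - w) ≤
        (Real.log N + u) * ((|p| + 1) * Real.log N) := mul_le_mul_of_nonneg_left h7 (by linarith)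
    have h9 : (Real.log N + u) * ((|p| + 1) * Real.log N) ≤
        (2 * Real.log N) * ((|p| + 1) * Real.log N) :=
      mul_le_mul_of_nonneg_right (by linarith) (by positivity)
    linarith
  · rw [div_lt_iff₀ (by linarith)] at h6
    linarith

theorem mZM_le_of_numWords_le {A : Type*} {N : ℕ} {y x : ℕ → A} {r : ℝ} (hlog : 0 < Real.log N)
    (hN : 1 ≤ N) (hr : 0 ≤ r) (h : (numWords N y x : ℝ) * (Real.log N + r) ≤ r * N) :
    mZM N y x ≤ (r : EReal) := by
  have hN0 : (0 : ℝ) < N := by exact_mod_cast hN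
  have hlt : (numWords N y x : ℝ) < N := by
    by_contra! hle
    nlinarith
  have hne : numWords N y x ≠ N := fun h => by rw [h] at hlt; exact lt_irrefl _ hlt
  rw [mZM, if_neg hne, EReal.coe_le_coe_iff, div_le_iff₀ (by linarith)]
  linarith

theorem le_mZM_of_le_numWords {A : Type*} {N : ℕ} {y x : ℕ → A} {d : ℝ} (hd : 0 ≤ d)
    (h : d * N ≤ numWords N y x * Real.log N) : (d : EReal) ≤ mZM N y x := by
  rw [mZM]
  split_ifs with he
  · exact le_top
  · have hlt : (numWords N y x : ℝ) < N := by
      exact_mod_cast lt_of_le_of_ne (numWords_le N y x) he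
    rw [EReal.coe_le_coe_iff, le_div_iff₀ (by linarith)]
    have : 0 ≤ d * numWords N y x := by positivity
    linarith

theorem mZM_nonneg {A : Type*} (N : ℕ) (y x : ℕ → A) : 0 ≤ mZM N y x :=
  le_mZM_of_le_numWords le_rfl (by
    rw [zero_mul]
    exact mul_nonneg (Nat.cast_nonneg _) (Real.log_natCast_nonneg N))

variable {A : Type*} [MeasurableSpace A] [Fintype A] [MeasurableSingletonClass A]
  {P Q : Measure (ℕ → A)}

theorem HasCrossEntropy.nonneg [IsProbabilityMeasure P] [IsProbabilityMeasure Q] {h : EReal}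
    (hh : HasCrossEntropy Q P h) : 0 ≤ h :=
  ge_of_tendsto' (hasCrossEntropy_iff.1 hh) fun n => by
    exact_mod_cast div_nonneg (integral_nonneg fun y => info_nonneg n y) n.cast_nonneg

theorem exists_le_mul_add {κ : ℕ → ℝ} (hκ : κ =o[atTop] fun n : ℕ => (n : ℝ)) (h0 : ∀ n, 0 ≤ κ n)
    {η : ℝ} (hη : 0 < η) : ∃ C : ℝ, ∀ l, κ l ≤ η * l + C := by
  obtain ⟨M, hM⟩ := exists_forall_ge_le_mul hκ hη
  have hsum0 : 0 ≤ ∑ l ∈ Finset.range M, κ l := Finset.sum_nonneg fun l _ => h0 l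
  refine ⟨∑ l ∈ Finset.range M, κ l, fun l => ?_⟩
  rcases lt_or_ge l M with hl | hl
  · have h1 : κ l ≤ ∑ l ∈ Finset.range M, κ l :=
      Finset.single_le_sum (fun i _ => h0 i) (Finset.mem_range.2 hl)
    have : 0 ≤ η * l := by positivity
    linarith
  · linarith [hM l hl]

/-- The upper bound: almost surely, the estimator is eventually smaller than any number exceeding
the cross entropy. -/
theorem ae_ae_eventually_mZM_le [IsProbabilityMeasure P] [IsProbabilityMeasure Q]
    (hP : MeasurePreserving shift P P) (hQ : Ergodic shift Q) (hsupp : supp Q ⊆ supp P)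
    (hND : IsND P Q) (hSLD : IsSLD P) {κ : ℕ → ℝ} (hκ : IsUDWith P κ fun _ => 0) {h : EReal}
    (hh : HasCrossEntropy Q P h) {r : ℝ} (hr : h < (r : EReal)) :
    ∀ᵐ y ∂Q, ∀ᵐ x ∂P, ∀ᶠ N : ℕ in atTop, mZM N y x ≤ (r : EReal) := by
  obtain ⟨c, hc1, hc2⟩ := EReal.exists_between_coe_real hr
  obtain ⟨r', hcr', hr'⟩ := exists_between (EReal.coe_lt_coe_iff.1 hc2)
  have hc0 : 0 < c := by exact_mod_cast hh.nonneg.trans_lt hc1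
  have hr0 : 0 < r := by linarith
  -- This makes `(1 - ε) * r` the midpoint of `r'` and `r`, as the asymptotic comparison requires.
  set ε : ℝ := (r - r') / (2 * r) with hε
  have hε0 : 0 < ε := div_pos (by linarith) (by linarith)
  have hεr : ε * (2 * r) = r - r' := div_mul_cancel₀ _ (by linarith)
  have hε1 : ε < 1 := by rw [hε, div_lt_one (by linarith)]; linarith
  obtain ⟨C, hC⟩ := exists_le_mul_add hκ.k_little hκ.k_nonneg (sub_pos.2 hcr')
  obtain ⟨g, hg1, hg2⟩ := EReal.exists_between_coe_real hND
  have hg0 : g < 0 := by exact_mod_cast hg2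
  have hmom : ∀ᶠ n : ℕ in atTop, moment P Q n 1 ≤ Real.exp (-(-g) * n) := by
    rw [neg_neg]
    exact eventually_moment_le_of_pressure_lt hsupp one_pos hg1
  have hlog : Tendsto (fun N : ℕ => Real.log N) atTop atTop :=
    Real.tendsto_log_atTop.comp tendsto_natCast_atTop_atTop
  have hK : 0 < 4 / (-g) := div_pos (by norm_num) (by linarith)
  filter_upwards [hh.ae_eventually_le hP hQ hsupp hκ hc1, ae_mem_supp_of_subset hsupp,
    ae_eventually_pr_ceil_le hQ.toMeasurePreserving (neg_pos.2 hg0) hmom] with y hy1 hy2 hy3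
  filter_upwards [hSLD.ae_eventually_pr_le hP y hε0 (show 0 < 4 / (-g) + 1 by linarith)] with x hx
  filter_upwards [hy1, hy3, hx, eventually_ge_atTop 1, hlog.eventually_ge_atTop 1,
    eventually_natCast_log_bounds (p := 1 - ε) (r := r) (r' := r') (u := r) (w := C)
      (by nlinarith)] with N h1 h3 h4 hN hN1 h5
  obtain ⟨h5a, h5b, h5c, h5d, h5e⟩ := h5
  replace h5c := h5c (by linarith)
  have hN0 : (0 : ℝ) < N := by exact_mod_cast hN
  have hkey : ∀ i l : ℕ, i < N → 1 ≤ l → l ≤ N → shift^[i] y ∉ occ N l x →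
      (1 - ε) * Real.log N ≤ info P l (shift^[i] y) := by
    intro i l hi hl hlN hocc
    have hpos := pr_pos (shift_iterate_mem_supp hP hy2 i) l
    have hle : pr P l (shift^[i] y) ≤ (N : ℝ) ^ (-(1 - ε)) := by
      -- Words of logarithmic length are handled by SLD; longer ones are improbable whether they
      -- occur or not, by ND.
      rcases le_or_gt (l : ℝ) ((4 / (-g) + 1) * Real.log N) with hlK | hlK
      · exact h4 i l hi hl hlN hlK hocc
      · have hceil : ⌈4 / (-g) * Real.log N⌉₊ ≤ l := by
          refine Nat.ceil_le.2 ?_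
          linarith
        refine (pr_anti hceil _).trans ((h3 i hi).trans ?_)
        rw [← Real.rpow_neg_one]
        exact Real.rpow_le_rpow_of_exponent_le (by exact_mod_cast hN) (by linarith)
    have := Real.log_le_log hpos hle
    rw [Real.log_rpow hN0] at this
    rw [info]
    linarith
  have h6 := numWords_mul_le_info hP hκ hN hy2 (sub_pos.2 hcr').le hC hkey
  set n : ℝ := (numWords N y x : ℝ)
  set v := (1 - ε) * Real.log N - C
  set u := Real.log N + r
  refine mZM_le_of_numWords_le h5b hN hr0.le ?_
  -- After multiplication by `v`: `n u v ≤ r' N u + u v ≤ r' N u + N ≤ r N v`.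
  refine le_of_mul_le_mul_right ?_ h5c
  have h7 : (n - 1) * v ≤ r' * N := by linarith
  have h8 : (n - 1) * v * u ≤ r' * N * u := mul_le_mul_of_nonneg_right h7 h5a.le
  have h9 : 1 * (N : ℝ) ≤ (r * v - r' * u) * N := mul_le_mul_of_nonneg_right h5e hN0.le
  change n * u * v ≤ r * N * v
  linarith

theorem measurableSet_eventually {Ω : Type*} [MeasurableSpace Ω] {p : ℕ → Ω → Prop}
    (h : ∀ n, MeasurableSet {y | p n y}) : MeasurableSet {y | ∀ᶠ n in atTop, p n y} := by
  have := (measurableSet_frequently (p := fun n y => ¬ p n y) fun n => (h n).compl).compl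
  convert this using 1
  ext y
  simp

/-- The upper bound comes with `y` fixed first; measurability of the event allows the order of the
two variables to be exchanged. -/
theorem ae_prod_of_ae_ae_eventually_le [IsProbabilityMeasure P] [IsProbabilityMeasure Q] {r : EReal}
    (h : ∀ᵐ y ∂Q, ∀ᵐ x ∂P, ∀ᶠ N : ℕ in atTop, mZM N y x ≤ r) :
    ∀ᵐ z ∂(P.prod Q), ∀ᶠ N : ℕ in atTop, mZM N z.2 z.1 ≤ r := by
  have hm : MeasurableSet {z : (ℕ → A) × (ℕ → A) | ∀ᶠ N : ℕ in atTop, mZM N z.2 z.1 ≤ r} :=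
    measurableSet_eventually fun N => measurableSet_le (measurable_mZM N) measurable_const
  rw [Measure.ae_prod_iff_ae_ae hm]
  exact (Measure.ae_ae_comm hm).2 h

theorem ae_prod_of_ae_ae_eventually_ge [IsProbabilityMeasure P] [IsProbabilityMeasure Q] {r : EReal}
    (h : ∀ᵐ x ∂P, ∀ᵐ y ∂Q, ∀ᶠ N : ℕ in atTop, r ≤ mZM N y x) :
    ∀ᵐ z ∂(P.prod Q), ∀ᶠ N : ℕ in atTop, r ≤ mZM N z.2 z.1 := by
  have hm : MeasurableSet {z : (ℕ → A) × (ℕ → A) | ∀ᶠ N : ℕ in atTop, r ≤ mZM N z.2 z.1} :=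
    measurableSet_eventually fun N => measurableSet_le measurable_const (measurable_mZM N)
  rwa [Measure.ae_prod_iff_ae_ae hm]

theorem ae_limsup_mZM_le [IsProbabilityMeasure P] [IsProbabilityMeasure Q] {h : EReal}
    (H : ∀ r : ℝ, h < (r : EReal) → ∀ᵐ y ∂Q, ∀ᵐ x ∂P, ∀ᶠ N : ℕ in atTop, mZM N y x ≤ (r : EReal)) :
    ∀ᵐ z ∂(P.prod Q), limsup (fun N : ℕ => mZM N z.2 z.1) atTop ≤ h := by
  have H' : ∀ᵐ z ∂(P.prod Q), ∀ q : ℚ, h < ((q : ℝ) : EReal) →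
      ∀ᶠ N : ℕ in atTop, mZM N z.2 z.1 ≤ ((q : ℝ) : EReal) := by
    rw [ae_all_iff]
    intro q
    by_cases hq : h < ((q : ℝ) : EReal)
    · filter_upwards [ae_prod_of_ae_ae_eventually_le (H q hq)] with z hz _ using hz
    · exact ae_of_all _ fun _ h => absurd h hq
  filter_upwards [H'] with z hz
  refine EReal.le_of_forall_lt_iff_le.1 fun r hr => ?_
  obtain ⟨q, hq1, hq2⟩ := EReal.lt_iff_exists_rat_btwn.1 hr
  exact (limsup_le_of_le (by isBoundedDefault) (hz q hq1)).trans hq2.le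

theorem ae_le_liminf_mZM [IsProbabilityMeasure P] [IsProbabilityMeasure Q] {D : EReal}
    (H : ∀ d : ℝ, (d : EReal) < D →
      ∀ᵐ x ∂P, ∀ᵐ y ∂Q, ∀ᶠ N : ℕ in atTop, (d : EReal) ≤ mZM N y x) :
    ∀ᵐ z ∂(P.prod Q), D ≤ liminf (fun N : ℕ => mZM N z.2 z.1) atTop := by
  have H' : ∀ᵐ z ∂(P.prod Q), ∀ q : ℚ, ((q : ℝ) : EReal) < D →
      ∀ᶠ N : ℕ in atTop, ((q : ℝ) : EReal) ≤ mZM N z.2 z.1 := by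
    rw [ae_all_iff]
    intro q
    by_cases hq : ((q : ℝ) : EReal) < D
    · filter_upwards [ae_prod_of_ae_ae_eventually_ge (H q hq)] with z hz _ using hz
    · exact ae_of_all _ fun _ h => absurd h hq
  filter_upwards [H'] with z hz
  refine EReal.ge_of_forall_gt_iff_ge.1 fun r hr => ?_
  obtain ⟨q, hq1, hq2⟩ := EReal.lt_iff_exists_rat_btwn.1 hr
  exact hq1.le.trans (le_liminf_of_le (by isBoundedDefault) (hz q hq2))

/-- The convergence theorem for decoupled measures. -/
theorem mZM_bounds [IsProbabilityMeasure P] [IsProbabilityMeasure Q]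
    (hP : MeasurePreserving shift P P) (hQ : Ergodic shift Q) (hsupp : supp Q ⊆ supp P)
    (hND : IsND P Q) (hSLD : IsSLD P) (hUDP : IsUDZeroGap P) (hUDQ : IsUD Q) :
    ∃ D h : EReal, HasLeftDeriv (pressure P Q) 0 D ∧ HasCrossEntropy Q P h ∧
      (∀ᵐ z : (ℕ → A) × (ℕ → A) ∂(P.prod Q),
        D ≤ liminf (fun N : ℕ => mZM N z.2 z.1) atTop ∧
        liminf (fun N : ℕ => mZM N z.2 z.1) atTop ≤ limsup (fun N : ℕ => mZM N z.2 z.1) atTop ∧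
        limsup (fun N : ℕ => mZM N z.2 z.1) atTop ≤ h) ∧
      (IsUDBounded Q → ∀ᵐ z : (ℕ → A) × (ℕ → A) ∂(P.prod Q),
        Tendsto (fun N : ℕ => mZM N z.2 z.1) atTop (𝓝 h)) := by
  obtain ⟨κ, hκ⟩ := hUDP
  obtain ⟨k, τ, hk⟩ := hUDQ
  obtain ⟨h, hh⟩ := exists_hasCrossEntropy hP hQ.toMeasurePreserving hsupp hκ
  obtain ⟨D, hD, hD1, hD2⟩ := exists_hasLeftDeriv_pressure (P := P) (Q := Q) hsupp
  have hup : ∀ᵐ z ∂(P.prod Q), limsup (fun N : ℕ => mZM N z.2 z.1) atTop ≤ h :=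
    ae_limsup_mZM_le fun r hr => ae_ae_eventually_mZM_le hP hQ hsupp hND hSLD hκ hh hr
  have hlow : ∀ᵐ z ∂(P.prod Q), D ≤ liminf (fun N : ℕ => mZM N z.2 z.1) atTop := by
    refine ae_le_liminf_mZM fun d hd => ?_
    rcases le_or_gt d 0 with hd0 | hd0
    · refine ae_of_all _ fun x => ae_of_all _ fun y => Eventually.of_forall fun N => ?_
      exact le_trans (by exact_mod_cast hd0) (mZM_nonneg N y x)
    · obtain ⟨d', hd1, hd2⟩ := EReal.exists_between_coe_real hd
      obtain ⟨s, hs0, hs1, hs⟩ := hD1 d' hd2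
      have hdd := EReal.coe_lt_coe_iff.1 hd1
      have hmom := eventually_moment_le_of_pressure_lt hsupp hs0 hs
      rw [neg_mul] at hmom
      have := ae_ae_eventually_le_numWords hP hQ.toMeasurePreserving hk hs0.le hs1.le hd0.le
        (mul_lt_mul_of_pos_left hdd hs0) hmom
      filter_upwards [this] with x hx
      filter_upwards [hx] with y hy
      filter_upwards [hy] with N hN using le_mZM_of_le_numWords hd0.le hN
  have hmid : ∀ z : (ℕ → A) × (ℕ → A), liminf (fun N : ℕ => mZM N z.2 z.1) atTop ≤
      limsup (fun N : ℕ => mZM N z.2 z.1) atTop := fun z => liminf_le_limsup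
  refine ⟨D, h, hD, hh, ?_, fun hb => ?_⟩
  · filter_upwards [hup, hlow] with z h1 h2 using ⟨h2, hmid z, h1⟩
  -- Every real number below the cross entropy is dominated by a slope of the pressure, so the two
  -- almost sure bounds meet.
  · have hDh : h ≤ D := EReal.ge_of_forall_gt_iff_ge.1 fun c hc => by
      obtain ⟨s, hs0, hs1, hs⟩ :=
        exists_pressure_le_of_lt_crossEntropy hP hQ hsupp hκ hb hh hc
      exact hD2 c s hs0 hs1 hs
    filter_upwards [hup, hlow] with z h1 h2
    exact tendsto_of_le_liminf_of_limsup_le (hDh.trans h2) h1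

end Estimator

/-! ### Ergodicity from uniform lower decoupling -/

section BoundedLowerDecoupling

variable {A : Type*} [MeasurableSpace A] [Fintype A] [MeasurableSingletonClass A]
  {P : Measure (ℕ → A)}

/-- A shift-invariant measure that is selectively lower decoupled with uniform constants is
ergodic. -/
theorem ergodic_of_uniform_lower [IsProbabilityMeasure P] (hP : MeasurePreserving shift P P)
    {c : ℝ} {t : ℕ} (hc : 0 < c)
    (h : ∀ n : ℕ, 1 ≤ n → ∀ a ∈ suppWords P n, ∀ m : ℕ, 1 ≤ m → ∀ b ∈ suppWords P m,
      ∃ l ≤ t, ∃ ξ : Fin l → A,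
        c * (P.real (cyl a) * P.real (cyl b)) ≤ P.real (cyl (concat3 a ξ b))) :
    Ergodic shift P := by
  refine ⟨hP, ⟨fun E hE hinv => ?_⟩⟩
  have hit : ∀ n, shift^[n] ⁻¹' E = E := fun n => by
    induction n with
    | zero => rfl
    | succ n ih => rw [Function.iterate_succ, Set.preimage_comp, ih, hinv]
  have h0 : 0 ≤ c * P.real E := by positivity
  -- For an invariant `E` the gap has no effect, and lower decoupling gives `c P(H) P(E) ≤ (t + 1)
  -- P(H ∩ E)` for cylinders, hence for all measurable `H`. Taking `H = Eᶜ` yields `P(E) P(Eᶜ) = 0`.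
  let μ : Measure (ℕ → A) := (c * P.real E).toNNReal • P
  let ν : Measure (ℕ → A) := ((t : NNReal) + 1) • P.restrict E
  have hμ : ∀ H, (μ H).toReal = c * P.real E * P.real H := fun H => by
    rw [Measure.coe_nnreal_smul_apply, ENNReal.toReal_mul, ENNReal.coe_toReal,
      Real.coe_toNNReal _ h0, measureReal_def P H]
  have hν : ∀ H, MeasurableSet H → (ν H).toReal = (t + 1) * P.real (H ∩ E) := fun H hH => by
    rw [Measure.coe_nnreal_smul_apply, ENNReal.toReal_mul, ENNReal.coe_toReal,
      Measure.restrict_apply hH, measureReal_def]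
    push_cast
    rfl
  have hle : μ ≤ ν := by
    refine measure_le_of_cyl fun n hn a => ?_
    rw [← ENNReal.toReal_le_toReal (measure_ne_top _ _) (measure_ne_top _ _), hμ,
      hν _ (measurableSet_cyl a)]
    by_cases ha : 0 < P.real (cyl a)
    · have h1 := measure_cyl_inter_sum_ge hc.le (h n hn a ha) hE
      simp only [hit, Finset.sum_const, Finset.card_range, nsmul_eq_mul] at h1
      push_cast at h1
      linarith
    · rw [le_antisymm (not_lt.1 ha) measureReal_nonneg, mul_zero]
      positivity
  have h1 := ENNReal.toReal_mono (measure_ne_top _ _) (hle Eᶜ)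
  rw [hμ, hν _ hE.compl, Set.compl_inter_self, measureReal_empty, mul_zero] at h1
  have h2 : P.real E * P.real Eᶜ ≤ 0 := by
    by_contra! hlt
    have := mul_pos hc hlt
    linarith
  rw [eventuallyConst_set']
  rcases mul_eq_zero.1 (le_antisymm h2 (by positivity)) with h3 | h3
  · left
    exact ae_eq_empty.2 ((measureReal_eq_zero_iff (measure_ne_top _ _)).1 h3)
  · right
    exact ae_eq_univ.2 ((measureReal_eq_zero_iff (measure_ne_top _ _)).1 h3)

end BoundedLowerDecoupling

theorem exists_pos_forall_le {ι : Type*} [Finite ι] {f : ι → ℝ} (hf : ∀ i, 0 < f i) :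
    ∃ δ : ℝ, 0 < δ ∧ ∀ i, δ ≤ f i := by
  rcases isEmpty_or_nonempty ι with _ | _
  · exact ⟨1, one_pos, fun i => isEmptyElim i⟩
  · obtain ⟨i, hi⟩ := Finite.exists_min f
    exact ⟨f i, hf i, hi⟩

theorem isLittleO_const_natCast (c : ℝ) : (fun _ : ℕ => c) =o[atTop] fun n : ℕ => (n : ℝ) :=
  isLittleO_const_left.2 (Or.inr (tendsto_norm_atTop_atTop.comp tendsto_natCast_atTop_atTop))

/-! ### Hidden-Markov measures through transfer matrices -/

section HiddenMarkov

open Matrix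

variable {A : Type*} {S : ℕ}

/-- The product of the transfer matrices of the letters of a word. -/
noncomputable def wordMatrix (T : A → Matrix (Fin S) (Fin S) ℝ) {n : ℕ} (a : Fin n → A) :
    Matrix (Fin S) (Fin S) ℝ := (List.ofFn fun i => T (a i)).prod

variable {T : A → Matrix (Fin S) (Fin S) ℝ}

theorem wordMatrix_zero (a : Fin 0 → A) : wordMatrix T a = 1 := by
  simp [wordMatrix]

theorem wordMatrix_succ {n : ℕ} (a : Fin (n + 1) → A) :
    wordMatrix T a = T (a 0) * wordMatrix T (fun i => a i.succ) := by
  simp [wordMatrix, List.ofFn_succ]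

theorem wordMatrix_append {n m : ℕ} (a : Fin n → A) (b : Fin m → A) :
    wordMatrix T (Fin.append a b) = wordMatrix T a * wordMatrix T b := by
  rw [wordMatrix, wordMatrix, wordMatrix, ← List.prod_append, ← List.ofFn_fin_append]
  congr 2
  ext i
  refine Fin.addCases (fun i => ?_) (fun i => ?_) i <;> simp

theorem wordMatrix_nonneg (hT : ∀ c s t, 0 ≤ T c s t) {n : ℕ} (a : Fin n → A) (s t : Fin S) :
    0 ≤ wordMatrix T a s t := by
  induction n generalizing s t with
  | zero => rw [wordMatrix_zero, one_apply]; split_ifs <;> norm_num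
  | succ n ih =>
    rw [wordMatrix_succ, mul_apply]
    exact Finset.sum_nonneg fun u _ => mul_nonneg (hT _ _ _) (ih _ _ _)

/-- An entry is a sum over paths of products of nonnegative entries; if it does not vanish, one path
contributes at least `θ` per letter. -/
theorem wordMatrix_eq_zero_or_le {θ : ℝ} (hθ : 0 < θ)
    (hT : ∀ c s t, T c s t = 0 ∨ θ ≤ T c s t) {n : ℕ} (a : Fin n → A) (s t : Fin S) :
    wordMatrix T a s t = 0 ∨ θ ^ n ≤ wordMatrix T a s t := by
  have hT0 : ∀ c s t, 0 ≤ T c s t := fun c s t => by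
    rcases hT c s t with h | h
    · exact h.ge
    · exact hθ.le.trans h
  induction n generalizing s t with
  | zero =>
    rw [wordMatrix_zero, one_apply]
    split_ifs
    · right; simp
    · left; rfl
  | succ n ih =>
    rw [wordMatrix_succ, mul_apply]
    set b : Fin n → A := fun i => a i.succ
    have hnn : ∀ u ∈ Finset.univ, 0 ≤ T (a 0) s u * wordMatrix T b u t := fun u _ =>
      mul_nonneg (hT0 _ _ _) (wordMatrix_nonneg hT0 _ _ _)
    by_cases h : ∀ u, T (a 0) s u * wordMatrix T b u t = 0
    · left; exact Finset.sum_eq_zero fun u _ => h u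
    · right
      push Not at h
      obtain ⟨u, hu⟩ := h
      refine le_trans ?_ (Finset.single_le_sum hnn (Finset.mem_univ u))
      have h1 := (hT (a 0) s u).resolve_left (left_ne_zero_of_mul hu)
      have h2 := (ih b u t).resolve_left (right_ne_zero_of_mul hu)
      rw [pow_succ']
      exact mul_le_mul h1 h2 (by positivity) (hT0 _ _ _)

theorem sum_wordMatrix [Fintype A] {M : Matrix (Fin S) (Fin S) ℝ} (hM : ∑ c, T c = M) (n : ℕ) :
    ∑ a : Fin n → A, wordMatrix T a = M ^ n := by
  induction n with
  | zero => simp [wordMatrix_zero]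
  | succ n ih =>
    rw [← (Fin.consEquiv fun _ => A).sum_comp, Fintype.sum_prod_type, pow_succ', ← ih, ← hM,
      Finset.sum_mul_sum]
    refine Finset.sum_congr rfl fun c _ => Finset.sum_congr rfl fun a _ => ?_
    rw [wordMatrix_succ]
    simp [Fin.consEquiv]

/-- The sum over the hidden paths in terms of transfer matrices. -/
theorem sum_paths_eq {M : Matrix (Fin S) (Fin S) ℝ} {R : Matrix (Fin S) A ℝ}
    (hM : ∀ s, ∑ t, M s t = 1) (m : ℕ) (a : Fin (m + 1) → A) (v : Fin S → ℝ) :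
    ∑ σ : Fin (m + 1) → Fin S,
      v (σ 0) * (∏ i, R (σ i) (a i)) * ∏ i : Fin m, M (σ i.castSucc) (σ i.succ) =
    v ⬝ᵥ (wordMatrix (fun c => of fun s t => R s c * M s t) a *ᵥ 1) := by
  induction m generalizing v with
  | zero =>
    rw [← (Equiv.funUnique (Fin 1) (Fin S)).symm.sum_comp]
    rw [dotProduct]
    refine Finset.sum_congr rfl fun s _ => ?_
    -- The transfer matrix of the last letter contains one transition more than the path sum; the
    -- row sums `1` of `M` remove it.
    rw [wordMatrix_succ, wordMatrix_zero, mul_one]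
    simp [mulVec, dotProduct, ← Finset.mul_sum, hM]
  | succ m ih =>
    rw [← (Fin.consEquiv fun _ => Fin S).sum_comp, Fintype.sum_prod_type, dotProduct]
    refine Finset.sum_congr rfl fun s _ => ?_
    rw [wordMatrix_succ, ← mulVec_mulVec]
    have h1 := ih (fun i => a i.succ) (fun t => M s t)
    have e : ((of fun s t => R s (a 0) * M s t) *ᵥ
        (wordMatrix (fun c => of fun s t => R s c * M s t) (fun i => a i.succ) *ᵥ 1)) s =
        R s (a 0) * ((fun t => M s t) ⬝ᵥ
        (wordMatrix (fun c => of fun s t => R s c * M s t) (fun i => a i.succ) *ᵥ 1)) := by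
      rw [mulVec, dotProduct, dotProduct, Finset.mul_sum]
      exact Finset.sum_congr rfl fun t _ => by rw [of_apply]; ring
    rw [e, ← h1, Finset.mul_sum, Finset.mul_sum]
    refine Finset.sum_congr rfl fun σ _ => ?_
    have e1 : ∏ i, R ((Fin.cons s σ : Fin (m + 2) → Fin S) i) (a i) =
        R s (a 0) * ∏ i, R (σ i) (a i.succ) := by
      rw [Fin.prod_univ_succ]; simp
    have e2 : ∏ i : Fin (m + 1), M ((Fin.cons s σ : Fin (m + 2) → Fin S) i.castSucc)
        ((Fin.cons s σ : Fin (m + 2) → Fin S) i.succ) =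
        M s (σ 0) * ∏ i : Fin m, M (σ i.castSucc) (σ i.succ) := by
      rw [Fin.prod_univ_succ]
      simp only [Fin.castSucc_zero, Fin.cons_zero, Fin.cons_succ, Fin.castSucc_succ]
    simp only [Fin.consEquiv, Equiv.coe_fn_mk, Fin.cons_zero]
    rw [e1, e2]
    ring

variable [MeasurableSpace A] [Fintype A] [MeasurableSingletonClass A] {P : Measure (ℕ → A)}

/-- A measure whose cylinder probabilities are given by products of transfer matrices `T c`, with
initial vector `p` stationary for the irreducible stochastic matrix `M = ∑ T c`. -/
structure IsTransferRepr (P : Measure (ℕ → A)) (p : Fin S → ℝ) (M : Matrix (Fin S) (Fin S) ℝ)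
    (T : A → Matrix (Fin S) (Fin S) ℝ) : Prop where
  p_nonneg : ∀ s, 0 ≤ p s
  p_sum : ∑ s, p s = 1
  M_row : M *ᵥ 1 = 1
  T_nonneg : ∀ c s t, 0 ≤ T c s t
  T_sum : ∑ c, T c = M
  stationary : p ᵥ* M = p
  irreducible : ∀ s t, ∃ n : ℕ, 0 < (M ^ n) s t
  prob : ∀ (n : ℕ) (a : Fin n → A), P.real (cyl a) = p ⬝ᵥ (wordMatrix T a *ᵥ 1)

theorem IsIrreducibleHMM.exists_transferRepr [IsProbabilityMeasure P] (h : IsIrreducibleHMM P) :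
    ∃ (S : ℕ) (p : Fin S → ℝ) (M : Matrix (Fin S) (Fin S) ℝ)
      (T : A → Matrix (Fin S) (Fin S) ℝ), IsTransferRepr P p M T := by
  obtain ⟨S, p, M, R, hp0, hp1, hM0, hM1, hR0, hR1, hst, hirr, hprob⟩ := h
  refine ⟨S, p, M, fun c => of fun s t => R s c * M s t, hp0, hp1, ?_, ?_, ?_, ?_, hirr, ?_⟩
  · ext s; simp [mulVec, dotProduct, hM1]
  · exact fun c s t => mul_nonneg (hR0 s c) (hM0 s t)
  · ext s t
    simp [Matrix.sum_apply, ← Finset.sum_mul, hR1]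
  · ext t
    simp [vecMul, dotProduct, hst]
  · intro n a
    cases n with
    | zero => simp [cyl_zero, wordMatrix_zero, dotProduct, hp1]
    | succ m => rw [hprob m a, sum_paths_eq hM1]

namespace IsTransferRepr

variable {p : Fin S → ℝ} {M : Matrix (Fin S) (Fin S) ℝ}

theorem vecMul_pow (h : IsTransferRepr P p M T) (n : ℕ) : p ᵥ* M ^ n = p := by
  induction n with
  | zero => simp
  | succ n ih => rw [pow_succ, ← vecMul_vecMul, ih, h.stationary]

theorem pow_nonneg (h : IsTransferRepr P p M T) (n : ℕ) (s t : Fin S) : 0 ≤ (M ^ n) s t := by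
  rw [← sum_wordMatrix h.T_sum n, Matrix.sum_apply]
  exact Finset.sum_nonneg fun a _ => wordMatrix_nonneg h.T_nonneg a s t

/-- Some state has positive weight, and irreducibility with `p = p M ^ n` spreads positivity to
every state. -/
theorem exists_pos_le (h : IsTransferRepr P p M T) : ∃ δ : ℝ, 0 < δ ∧ δ ≤ 1 ∧ ∀ s, δ ≤ p s := by
  have hpos : ∀ t, 0 < p t := by
    intro t
    obtain ⟨s, hs⟩ : ∃ s, 0 < p s := by
      by_contra! hcon
      have := h.p_sum
      rw [Finset.sum_eq_zero fun s _ => le_antisymm (hcon s) (h.p_nonneg s)] at this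
      norm_num at this
    obtain ⟨n, hn⟩ := h.irreducible s t
    rw [← h.vecMul_pow n, vecMul, dotProduct]
    exact (mul_pos hs hn).trans_le (Finset.single_le_sum (f := fun s => p s * (M ^ n) s t)
      (fun u _ => mul_nonneg (h.p_nonneg u) (h.pow_nonneg n u t)) (Finset.mem_univ s))
  obtain ⟨δ, hδ, hδp⟩ := exists_pos_forall_le hpos
  refine ⟨min δ 1, lt_min hδ one_pos, min_le_right _ _, fun s => (min_le_left _ _).trans ?_⟩
  exact hδp s

theorem left_nonneg (h : IsTransferRepr P p M T) {n : ℕ} (a : Fin n → A) (t : Fin S) :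
    0 ≤ (p ᵥ* wordMatrix T a) t := by
  rw [vecMul, dotProduct]
  exact Finset.sum_nonneg fun s _ => mul_nonneg (h.p_nonneg s) (wordMatrix_nonneg h.T_nonneg a s t)

theorem right_nonneg (h : IsTransferRepr P p M T) {n : ℕ} (a : Fin n → A) (s : Fin S) :
    0 ≤ (wordMatrix T a *ᵥ 1) s := by
  rw [mulVec, dotProduct]
  exact Finset.sum_nonneg fun t _ => mul_nonneg (wordMatrix_nonneg h.T_nonneg a s t) zero_le_one

theorem sum_left (h : IsTransferRepr P p M T) {n : ℕ} (a : Fin n → A) :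
    ∑ t, (p ᵥ* wordMatrix T a) t = P.real (cyl a) := by
  rw [h.prob, dotProduct_mulVec]
  simp [dotProduct]

theorem sum_right (h : IsTransferRepr P p M T) {n : ℕ} (a : Fin n → A) :
    ∑ s, p s * (wordMatrix T a *ᵥ 1) s = P.real (cyl a) := by
  rw [h.prob, dotProduct]

/-- Started at any single state `t`, the word `b` has probability at most `δ⁻¹` times its stationary
probability, because `t` has stationary weight at least `δ`. -/
theorem prob_append_le (h : IsTransferRepr P p M T) {δ : ℝ} (hδ : 0 < δ) (hδp : ∀ s, δ ≤ p s)
    {n m : ℕ} (a : Fin n → A) (b : Fin m → A) :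
    P.real (cyl (Fin.append a b)) ≤ δ⁻¹ * (P.real (cyl a) * P.real (cyl b)) := by
  have hb : ∀ t, (wordMatrix T b *ᵥ 1) t ≤ δ⁻¹ * P.real (cyl b) := by
    intro t
    rw [← div_eq_inv_mul, le_div_iff₀ hδ, ← h.sum_right b, mul_comm]
    refine (mul_le_mul_of_nonneg_right (hδp t) (h.right_nonneg b t)).trans ?_
    exact Finset.single_le_sum (f := fun s => p s * (wordMatrix T b *ᵥ 1) s)
      (fun s _ => mul_nonneg (h.p_nonneg s) (h.right_nonneg b s)) (Finset.mem_univ t)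
  rw [h.prob, wordMatrix_append, ← mulVec_mulVec, dotProduct_mulVec, dotProduct]
  calc ∑ t, (p ᵥ* wordMatrix T a) t * (wordMatrix T b *ᵥ 1) t
      ≤ ∑ t, (p ᵥ* wordMatrix T a) t * (δ⁻¹ * P.real (cyl b)) :=
        Finset.sum_le_sum fun t _ => mul_le_mul_of_nonneg_left (hb t) (h.left_nonneg a t)
    _ = _ := by rw [← Finset.sum_mul, h.sum_left]; ring

theorem exists_isUDWith [IsProbabilityMeasure P] (h : IsTransferRepr P p M T) :
    ∃ C : ℝ, IsUDWith P (fun _ => C) (fun _ => 0) := by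
  obtain ⟨δ, hδ, hδ1, hδp⟩ := h.exists_pos_le
  refine ⟨Real.log δ⁻¹, fun _ => Real.log_nonneg (one_le_inv₀ hδ |>.2 hδ1), ?_, ?_, ?_⟩
  · exact isLittleO_const_natCast _
  · simp
  · intro n _ a _ ξ _ m _ b _
    have e : cyl (concat3 a ξ b) = cyl (Fin.append a b) := by
      ext x
      rw [mem_cyl_concat3, mem_cyl_append, cyl_zero]
      simp
    rw [e, Real.exp_log (inv_pos.2 hδ)]
    exact h.prob_append_le hδ hδp a b

theorem isSE [IsProbabilityMeasure P] (h : IsTransferRepr P p M T) : IsSE P := by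
  obtain ⟨δ, hδ, hδ1, hδp⟩ := h.exists_pos_le
  obtain ⟨θ, hθ, hθ1, hθT⟩ : ∃ θ : ℝ, 0 < θ ∧ θ < 1 ∧ ∀ c s t, T c s t = 0 ∨ θ ≤ T c s t := by
    obtain ⟨θ, hθ, hθT⟩ := exists_pos_forall_le
      (f := fun q : A × Fin S × Fin S => if T q.1 q.2.1 q.2.2 = 0 then 1 else T q.1 q.2.1 q.2.2)
      (by
        intro q
        split_ifs with hq
        · exact one_pos
        · exact lt_of_le_of_ne (h.T_nonneg _ _ _) (Ne.symm hq))
    -- Keeping `θ` below one makes `log (δ * θ)` negative, as required of the exponent in SE.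
    refine ⟨min θ (1 / 2), lt_min hθ (by norm_num), (min_le_right _ _).trans_lt (by norm_num),
      fun c s t => ?_⟩
    have h1 := hθT (c, s, t)
    simp only at h1
    split_ifs at h1 with hq
    · exact Or.inl hq
    · exact Or.inr ((min_le_left _ _).trans h1)
  have hδθ : δ * θ < 1 := by nlinarith
  refine ⟨1, Real.log (δ * θ), le_rfl, Real.log_neg (by positivity) hδθ, fun n hn a ha => ?_⟩
  have hpos : P.real (cyl a) ≠ 0 := ne_of_gt ha
  rw [← h.sum_right a] at hpos
  obtain ⟨s, -, hs⟩ := Finset.exists_ne_zero_of_sum_ne_zero hpos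
  have hs' := right_ne_zero_of_mul hs
  rw [mulVec, dotProduct] at hs'
  obtain ⟨t, -, ht⟩ := Finset.exists_ne_zero_of_sum_ne_zero hs'
  have hst := (wordMatrix_eq_zero_or_le hθ hθT a s t).resolve_left (left_ne_zero_of_mul ht)
  rw [Real.rpow_one, mul_comm, Real.exp_nat_mul, Real.exp_log (by positivity), mul_pow]
  have hδn : δ ^ n ≤ δ := pow_le_of_le_one hδ.le hδ1 (by omega)
  have h1 : θ ^ n ≤ (wordMatrix T a *ᵥ 1) s := by
    refine hst.trans ?_
    have := Finset.single_le_sum (f := fun t => wordMatrix T a s t * (1 : Fin S → ℝ) t)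
      (fun u _ => mul_nonneg (wordMatrix_nonneg h.T_nonneg a s u) zero_le_one) (Finset.mem_univ t)
    simpa [mulVec, dotProduct] using this
  calc δ ^ n * θ ^ n ≤ p s * (wordMatrix T a *ᵥ 1) s :=
        mul_le_mul (hδn.trans (hδp s)) h1 (by positivity) (h.p_nonneg s)
    _ ≤ P.real (cyl a) := by
        rw [← h.sum_right a]
        exact Finset.single_le_sum (f := fun s => p s * (wordMatrix T a *ᵥ 1) s)
          (fun s _ => mul_nonneg (h.p_nonneg s) (h.right_nonneg a s)) (Finset.mem_univ s)

theorem sum_prob_concat3 (h : IsTransferRepr P p M T) {n m : ℕ} (l : ℕ) (a : Fin n → A)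
    (b : Fin m → A) : ∑ ξ : Fin l → A, P.real (cyl (concat3 a ξ b)) =
      ∑ s, ∑ t, (p ᵥ* wordMatrix T a) s * (M ^ l) s t * (wordMatrix T b *ᵥ 1) t := by
  have h1 : ∀ ξ : Fin l → A, P.real (cyl (concat3 a ξ b)) =
      (p ᵥ* wordMatrix T a) ⬝ᵥ (wordMatrix T ξ *ᵥ (wordMatrix T b *ᵥ 1)) := fun ξ => by
    rw [h.prob, concat3, wordMatrix_append, wordMatrix_append, ← mulVec_mulVec,
      dotProduct_mulVec, mulVec_mulVec]
  simp only [h1]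
  rw [← dotProduct_sum, ← Matrix.sum_mulVec, sum_wordMatrix h.T_sum]
  simp only [dotProduct, mulVec, Finset.mul_sum, mul_assoc]

/-- After `a` some hidden state `s` carries at least a share `1 / S` of the mass, and some state `t`
emits `b` with at least its average probability. Irreducibility joins `s` to `t` in boundedly many
steps with probability at least `ω`, and the best of the at most `|A| ^ N` fillings retains a fixed
share. -/
theorem exists_uniform_lower [IsProbabilityMeasure P] (h : IsTransferRepr P p M T) :
    ∃ (c : ℝ) (N : ℕ), 0 < c ∧ c ≤ 1 ∧ ∀ (n : ℕ) (a : Fin n → A) (m : ℕ) (b : Fin m → A),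
      ∃ l ≤ N, ∃ ξ : Fin l → A,
        c * (P.real (cyl a) * P.real (cyl b)) ≤ P.real (cyl (concat3 a ξ b)) := by
  choose f hf using h.irreducible
  obtain ⟨ω, hω, hωf⟩ := exists_pos_forall_le
    (f := fun q : Fin S × Fin S => (M ^ f q.1 q.2) q.1 q.2) fun q => hf _ _
  obtain ⟨N, hN⟩ := (Set.finite_range fun q : Fin S × Fin S => f q.1 q.2).bddAbove
  have hS : (0 : ℝ) < S := by
    have : S ≠ 0 := by
      rintro rfl
      simpa using h.p_sum
    exact_mod_cast Nat.pos_of_ne_zero this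
  have hA : (1 : ℝ) ≤ Fintype.card A := by exact_mod_cast card_pos (Q := P)
  have hA0 : (0 : ℝ) < Fintype.card A := by linarith
  set c : ℝ := ω / (S * (Fintype.card A : ℝ) ^ N) with hc
  have hc0 : 0 < c := by positivity
  refine ⟨min c 1, N, lt_min hc0 one_pos, min_le_right _ _, fun n a m b => ?_⟩
  obtain ⟨s, -, hs⟩ : ∃ s ∈ Finset.univ, P.real (cyl a) / S ≤ (p ᵥ* wordMatrix T a) s := by
    refine Finset.exists_le_of_sum_le ⟨⟨0, by exact_mod_cast hS⟩, Finset.mem_univ _⟩ ?_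
    rw [h.sum_left]
    simp
    rw [mul_div_cancel₀ _ hS.ne']
  obtain ⟨t, -, ht⟩ : ∃ t ∈ Finset.univ, p t * P.real (cyl b) ≤
      p t * (wordMatrix T b *ᵥ 1) t := by
    refine Finset.exists_le_of_sum_le ⟨⟨0, by exact_mod_cast hS⟩, Finset.mem_univ _⟩ ?_
    rw [h.sum_right, ← Finset.sum_mul, h.p_sum, one_mul]
  obtain ⟨δ, hδ, -, hδp⟩ := h.exists_pos_le
  replace ht := le_of_mul_le_mul_left ht (hδ.trans_le (hδp t))
  have hl : f s t ≤ N := hN ⟨(s, t), rfl⟩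
  have hterm : P.real (cyl a) / S * ω * P.real (cyl b) ≤
      ∑ ξ : Fin (f s t) → A, P.real (cyl (concat3 a ξ b)) := by
    rw [h.sum_prob_concat3]
    have hnn : ∀ s' t', 0 ≤ (p ᵥ* wordMatrix T a) s' * (M ^ f s t) s' t' *
        (wordMatrix T b *ᵥ 1) t' := fun s' t' =>
      mul_nonneg (mul_nonneg (h.left_nonneg a s') (h.pow_nonneg _ _ _)) (h.right_nonneg b t')
    refine le_trans ?_ ((Finset.single_le_sum (f := fun t' => (p ᵥ* wordMatrix T a) s *
      (M ^ f s t) s t' * (wordMatrix T b *ᵥ 1) t') (fun t' _ => hnn s t')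
      (Finset.mem_univ t)).trans (Finset.single_le_sum (f := fun s' => ∑ t',
      (p ᵥ* wordMatrix T a) s' * (M ^ f s t) s' t' * (wordMatrix T b *ᵥ 1) t')
      (fun s' _ => Finset.sum_nonneg fun t' _ => hnn s' t') (Finset.mem_univ s)))
    have := h.left_nonneg a s
    have := h.pow_nonneg (f s t) s t
    have := hωf (s, t)
    gcongr
  obtain ⟨ξ, -, hξ⟩ : ∃ ξ ∈ (Finset.univ : Finset (Fin (f s t) → A)),
      c * (P.real (cyl a) * P.real (cyl b)) ≤ P.real (cyl (concat3 a ξ b)) := by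
    obtain ⟨x⟩ : Nonempty (ℕ → A) := nonempty_of_isProbabilityMeasure P
    refine Finset.exists_le_of_sum_le ⟨fun _ => x 0, Finset.mem_univ _⟩ (le_trans ?_ hterm)
    rw [Finset.sum_const, Finset.card_univ, Fintype.card_fun, Fintype.card_fin, nsmul_eq_mul]
    push_cast
    have h1 : (Fintype.card A : ℝ) ^ f s t ≤ (Fintype.card A : ℝ) ^ N :=
      pow_le_pow_right₀ hA hl
    calc (Fintype.card A : ℝ) ^ f s t * (c * (P.real (cyl a) * P.real (cyl b)))
        ≤ (Fintype.card A : ℝ) ^ N * (c * (P.real (cyl a) * P.real (cyl b))) := by gcongr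
      _ = _ := by rw [hc]; field_simp
  exact ⟨f s t, hl, ξ, (mul_le_mul_of_nonneg_right (min_le_left _ _) (by positivity)).trans hξ⟩

end IsTransferRepr

theorem IsIrreducibleHMM.isUDZeroGap [IsProbabilityMeasure P] (h : IsIrreducibleHMM P) :
    IsUDZeroGap P := by
  obtain ⟨S, p, M, T, hr⟩ := h.exists_transferRepr
  obtain ⟨C, hC⟩ := hr.exists_isUDWith
  exact ⟨_, hC⟩

theorem IsIrreducibleHMM.isUDBounded [IsProbabilityMeasure P] (h : IsIrreducibleHMM P) :
    IsUDBounded P := by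
  obtain ⟨S, p, M, T, hr⟩ := h.exists_transferRepr
  obtain ⟨C, hC⟩ := hr.exists_isUDWith
  exact ⟨_, _, hC, isBigO_const_const _ one_ne_zero _, isBigO_const_const _ one_ne_zero _⟩

theorem IsIrreducibleHMM.isSE [IsProbabilityMeasure P] (h : IsIrreducibleHMM P) : IsSE P := by
  obtain ⟨S, p, M, T, hr⟩ := h.exists_transferRepr
  exact hr.isSE

theorem IsIrreducibleHMM.isSLD [IsProbabilityMeasure P] (hP : MeasurePreserving shift P P)
    (h : IsIrreducibleHMM P) : IsSLD P := by
  obtain ⟨S, p, M, T, hr⟩ := h.exists_transferRepr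
  obtain ⟨c, N, hc, hc1, hlow⟩ := hr.exists_uniform_lower
  refine ⟨fun _ => -Real.log c, fun _ => N, fun _ => neg_nonneg.2 (Real.log_nonpos hc.le hc1),
    isLittleO_const_natCast _,
    isLittleO_const_natCast _, ?_⟩
  intro n _ a ha m _ b hb
  obtain ⟨l, hl, ξ, hξ⟩ := hlow n a m b
  have hpos : 0 < P.real (cyl (concat3 a ξ b)) := lt_of_lt_of_le (mul_pos hc (mul_pos ha hb)) hξ
  refine ⟨l, hl, ξ, hpos.trans_le (real_cyl_concat3_le_mid hP a ξ b), ?_⟩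
  rwa [neg_neg, Real.exp_log hc]

theorem IsIrreducibleHMM.ergodic [IsProbabilityMeasure P] (hP : MeasurePreserving shift P P)
    (h : IsIrreducibleHMM P) : Ergodic shift P := by
  obtain ⟨S, p, M, T, hr⟩ := h.exists_transferRepr
  obtain ⟨c, N, hc, -, hlow⟩ := hr.exists_uniform_lower
  exact ergodic_of_uniform_lower hP hc fun n _ a _ m _ b _ => hlow n a m b

end HiddenMarkov

end ZivMerhav

theorem corollary4p2 {A : Type*} [Fintype A] [MeasurableSpace A] [MeasurableSingletonClass A]
    (P Q : Measure (ℕ → A)) [IsProbabilityMeasure P] [IsProbabilityMeasure Q]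
    (hP : MeasurePreserving ZivMerhav.shift P P) (hQ : MeasurePreserving ZivMerhav.shift Q Q)
    (hsupp : ZivMerhav.supp Q ⊆ ZivMerhav.supp P) (hND : ZivMerhav.IsND P Q) :
    (ZivMerhav.IsSLD P → ZivMerhav.IsUDZeroGap P → ZivMerhav.IsSE P → ZivMerhav.IsUD Q →
      Ergodic ZivMerhav.shift Q →
      ∃ D h : EReal, ZivMerhav.HasLeftDeriv (ZivMerhav.pressure P Q) 0 D ∧
        ZivMerhav.HasCrossEntropy Q P h ∧
        (∀ᵐ z : (ℕ → A) × (ℕ → A) ∂(P.prod Q),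
          D ≤ liminf (fun N : ℕ => ZivMerhav.mZM N z.2 z.1) atTop ∧
          liminf (fun N : ℕ => ZivMerhav.mZM N z.2 z.1) atTop ≤
            limsup (fun N : ℕ => ZivMerhav.mZM N z.2 z.1) atTop ∧
          limsup (fun N : ℕ => ZivMerhav.mZM N z.2 z.1) atTop ≤ h) ∧
        (ZivMerhav.IsUDBounded Q → ∀ᵐ z : (ℕ → A) × (ℕ → A) ∂(P.prod Q),
          Tendsto (fun N : ℕ => ZivMerhav.mZM N z.2 z.1) atTop (𝓝 h))) ∧
    (ZivMerhav.IsIrreducibleHMM P → ZivMerhav.IsIrreducibleHMM Q →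
      (ZivMerhav.IsSLD P ∧ ZivMerhav.IsUDZeroGap P ∧ ZivMerhav.IsSE P ∧
        ZivMerhav.IsUDBounded Q ∧ Ergodic ZivMerhav.shift Q) ∧
      ∃ h : EReal, ZivMerhav.HasCrossEntropy Q P h ∧
        ∀ᵐ z : (ℕ → A) × (ℕ → A) ∂(P.prod Q),
          Tendsto (fun N : ℕ => ZivMerhav.mZM N z.2 z.1) atTop (𝓝 h)) := by
  refine ⟨fun hSLD hUDP _ hUDQ hQe =>
    ZivMerhav.mZM_bounds hP hQe hsupp hND hSLD hUDP hUDQ, fun hPm hQm => ?_⟩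
  have hSLD := hPm.isSLD hP
  have hUDP := hPm.isUDZeroGap
  have hUDQ := hQm.isUDBounded
  have hQe := hQm.ergodic hQ
  refine ⟨⟨hSLD, hUDP, hPm.isSE, hUDQ, hQe⟩, ?_⟩
  obtain ⟨k, τ, hk, -⟩ := id hUDQ
  obtain ⟨-, h, -, hh, -, hlim⟩ :=
    ZivMerhav.mZM_bounds hP hQe hsupp hND hSLD hUDP ⟨k, τ, hk⟩
  exact ⟨h, hh, hlim hUDQ⟩
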